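/- Let $\mathcal C_n$ be the $n$-qubit Clifford group, i.e. the set of $n$-qubit unitaries that are products of Hadamard gates, phase gates $S=\mathrm{diag}(1,i)$ and CNOT gates. A stabilizer sketch of size $2^k$ ($0\le k\le n$) of an $n$-qubit state $\psi$ consists of a circuit of $O(n^2)$ such gates for some $C\in\mathcal C_n$, together with the $2^k$ amplitudes $\langle 0^{n-k}z|C|\psi\rangle$, $z\in\{0,1\}^k$; it is random if $C$ is uniformly distributed in $\mathcal C_n$. Every $C\in\mathcal C_n$ has such a circuit. There is a deterministic classical algorithm (a fixed program for a machine with unit-cost exact real arithmetic, including square roots) and there are functions $N(p)=O(1+\log(1/p))$, for $p\in(0,1)$, and $b(n,\epsilon)=\mathrm{poly}(n,\log(1/\epsilon))$ such that the following holds. The algorithm takes as input integers $n\ge 1$ and $1\le r\le 2^n$, real numbers $\epsilon,p\in(0,1)$, an $n$-qubit Hermitian operator $M$ with $\|M\|\le 1$ and $\mathrm{rank}(M)\le r$, and $N(p)$ independent random stabilizer sketches of an $n$-qubit state $\psi$ (a unit vector), each of size $2^k$, where $k$ is the largest integer with $k\le n$ and $$2^k\le 24\cdot\max\{\epsilon^{-2},\sqrt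 r\,\epsilon^{-1}\}.$$ It always halts, after at most $2^{O(n)}\,(1+\log(1/p))$ elementary operations, and it outputs a real number $E$ such that, with probability at least $1-p$ over the random Cliffords, $|E-\langle\psi|M|\psi\rangle|\le\epsilon$. This remains true if the amplitudes in the sketches are specified only approximately, with an error of at most $2^{-b(n,\epsilon)}$ in each real and imaginary part; for any $b'\in\mathbb N$, every sketch can be specified with error at most $2^{-b'}$ by multiples of $2^{-b'}$ in $[-1,1]$. For $r=2^n$, the $N(p)$ sketches with amplitudes given to $b(n,\epsilon)$ bits of precision take altogether at most $\mathrm{poly}(n,\log(1/\epsilon))\cdot\sqrt{2^n}\,\epsilon^{-1}\,(1+\log(1/p))$ bits. -/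

import Mathlib

open Matrix MeasureTheory ProbabilityTheory

/-! ### Qubits, Clifford circuits, Clifford unitaries -/

/-- Labels of the computational basis states of `n` qubits: strings of `n` bits. -/
abbrev Qubits (n : ℕ) : Type := Fin n → Bool

/-- The `n`-bit string that is the binary expansion of `m < 2 ^ n`, most significant bit first.
For `z < 2 ^ k` with `k ≤ n` it is the string `0^(n-k) z`. -/
def ket (n m : ℕ) : Qubits n := fun q => m.testBit q.rev

/-- The elementary Clifford gates on `n` qubits: Hadamard, phase gate, controlled NOT. -/
inductive Gate (n : ℕ) : Type
  | hadamard (q : Fin n) : Gate n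
  | phase (q : Fin n) : Gate n
  | cnot (control target : Fin n) (h : control ≠ target) : Gate n

/-- The `2 ^ n × 2 ^ n` unitary matrix of a gate. -/
noncomputable def Gate.matrix {n : ℕ} : Gate n → Matrix (Qubits n) (Qubits n) ℂ
  | .hadamard q => Matrix.of fun x y =>
      if ∀ l, l ≠ q → x l = y l then
        ((1 / Real.sqrt 2 : ℝ) : ℂ) * (if x q = true ∧ y q = true then -1 else 1)
      else 0
  | .phase q => Matrix.diagonal fun x => if x q = true then Complex.I else 1
  | .cnot c t _ => Matrix.of fun x y =>
      if x = Function.update y t (xor (y t) (y c)) then 1 else 0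

/-- The unitary implemented by a circuit; the head of the list is the gate applied first. -/
noncomputable def circuitMatrix {n : ℕ} : List (Gate n) → Matrix (Qubits n) (Qubits n) ℂ
  | [] => 1
  | G :: w => circuitMatrix w * G.matrix

/-- The `n`-qubit Clifford group, as a type: the unitaries that are implemented by a circuit of
Hadamard, phase and controlled NOT gates. -/
def Clifford (n : ℕ) : Type :=
  {C : Matrix (Qubits n) (Qubits n) ℂ // ∃ w : List (Gate n), circuitMatrix w = C}

instance (n : ℕ) : MeasurableSpace (Clifford n) := ⊤

/-- The joint law of `N` independent, uniformly random `n`-qubit Clifford unitaries. (On an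
infinite set `uniformOn` would be the zero measure.) -/
noncomputable def iidCliffords (n N : ℕ) : Measure (Fin N → Clifford n) :=
  Measure.pi fun _ => uniformOn Set.univ

/-- The amplitude `⟨0^(n-k) z| C |ψ⟩`, for `z < 2 ^ k`. -/
noncomputable def amplitude {n : ℕ} (C : Clifford n) (ψ : EuclideanSpace ℂ (Qubits n))
    (z : ℕ) : ℂ :=
  (C.1 *ᵥ ψ.ofLp) (ket n z)

/-- The expectation value `⟨ψ|M|ψ⟩`. -/
noncomputable def expectation {n : ℕ} (M : Matrix (Qubits n) (Qubits n) ℂ)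
    (ψ : EuclideanSpace ℂ (Qubits n)) : ℂ :=
  star ψ.ofLp ⬝ᵥ (M *ᵥ ψ.ofLp)

/-! ### Stabilizer sketches -/

/-- The data of a stabilizer sketch of size `2 ^ k`: a circuit and `2 ^ k` complex numbers. -/
structure Sketch (n k : ℕ) : Type where
  circuit : List (Gate n)
  amp : Fin (2 ^ k) → ℂ

/-- `S` is a stabilizer sketch of `ψ` with Clifford unitary `C`: its circuit implements `C` and has
at most `len` gates, and the real and imaginary parts of its numbers agree up to an error of at most
`δ` with those of the amplitudes `⟨0^(n-k) z|C|ψ⟩`. (The case of zero error is included.) -/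
def Sketch.Describes {n k : ℕ} (S : Sketch n k) (C : Clifford n)
    (ψ : EuclideanSpace ℂ (Qubits n)) (len : ℕ) (δ : ℝ) : Prop :=
  circuitMatrix S.circuit = C.1 ∧ S.circuit.length ≤ len ∧
    ∀ z : Fin (2 ^ k),
      |(S.amp z).re - (amplitude C ψ z).re| ≤ δ ∧ |(S.amp z).im - (amplitude C ψ z).im| ≤ δ

/-- The real and imaginary parts of the numbers in the sketch are integer multiples of `2 ^ (-b)`
in the interval `[-1, 1]`, so that each of them can be written down with `b + 2` bits. -/
def Sketch.HasBits {n k : ℕ} (S : Sketch n k) (b : ℕ) : Prop :=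
  ∀ z : Fin (2 ^ k), ∃ u v : ℤ, |u| ≤ 2 ^ b ∧ |v| ≤ 2 ^ b ∧
    (S.amp z).re = u / 2 ^ b ∧ (S.amp z).im = v / 2 ^ b

/-- Number of bits used for a sketch of size `2 ^ k` with at most `len` gates and amplitudes of `b`
bits of precision: a two-bit code (gate type or end of circuit) and two qubit labels for each of
`len + 1` circuit entries, and `b + 2` bits for each real or imaginary part. -/
def sketchBits (n k len b : ℕ) : ℕ :=
  (len + 1) * (2 + 2 * Nat.size n) + 2 ^ k * (2 * (b + 2))

/-! ### Real random access machine

A program is a fixed finite text (it contains no constants other than natural numbers). The memory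
consists of arrays of natural numbers and arrays of real numbers, with two indices each. The
operations `+`, `-` (truncated), `*` on natural numbers, `+`, `-`, `*`, `/`, square root on real
numbers, conversion of a natural number to a real number, comparisons, and memory accesses have unit
cost. There is no rounding, and no other passage from real to natural numbers than branching on
comparisons. -/

/-- The memory: `s.nat a i j` and `s.real a i j` are the entries `(i, j)` of the arrays
number `a`. -/
structure Memory : Type where
  nat : ℕ → ℕ → ℕ → ℕ
  real : ℕ → ℕ → ℕ → ℝ

/-- Expressions of type natural number. -/
inductive NatExpr : Type
  | const (m : ℕ)
  | read (a : ℕ) (i j : NatExpr)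
  | add (e f : NatExpr)
  | sub (e f : NatExpr)
  | mul (e f : NatExpr)

/-- The value of an expression. -/
def NatExpr.eval (s : Memory) : NatExpr → ℕ
  | const m => m
  | read a i j => s.nat a (i.eval s) (j.eval s)
  | add e f => e.eval s + f.eval s
  | sub e f => e.eval s - f.eval s
  | mul e f => e.eval s * f.eval s

/-- The number of elementary operations in the evaluation of an expression. -/
def NatExpr.cost : NatExpr → ℕ
  | const _ => 1
  | read _ i j => i.cost + j.cost + 1
  | add e f => e.cost + f.cost + 1
  | sub e f => e.cost + f.cost + 1
  | mul e f => e.cost + f.cost + 1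

/-- Expressions of type real number. -/
inductive RealExpr : Type
  | cast (e : NatExpr)
  | read (a : ℕ) (i j : NatExpr)
  | add (e f : RealExpr)
  | sub (e f : RealExpr)
  | mul (e f : RealExpr)
  | div (e f : RealExpr)
  | sqrt (e : RealExpr)

/-- The value of an expression (exact real arithmetic). -/
noncomputable def RealExpr.eval (s : Memory) : RealExpr → ℝ
  | cast e => (e.eval s : ℝ)
  | read a i j => s.real a (i.eval s) (j.eval s)
  | add e f => e.eval s + f.eval s
  | sub e f => e.eval s - f.eval s
  | mul e f => e.eval s * f.eval s
  | div e f => e.eval s / f.eval s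
  | sqrt e => Real.sqrt (e.eval s)

/-- The number of elementary operations in the evaluation of an expression. -/
def RealExpr.cost : RealExpr → ℕ
  | cast e => e.cost + 1
  | read _ i j => i.cost + j.cost + 1
  | add e f => e.cost + f.cost + 1
  | sub e f => e.cost + f.cost + 1
  | mul e f => e.cost + f.cost + 1
  | div e f => e.cost + f.cost + 1
  | sqrt e => e.cost + 1

/-- Tests. -/
inductive Test : Type
  | natLE (e f : NatExpr)
  | realLE (e f : RealExpr)
  | neg (b : Test)
  | and (b c : Test)

/-- Truth of a test. -/
def Test.Holds (s : Memory) : Test → Prop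
  | natLE e f => e.eval s ≤ f.eval s
  | realLE e f => e.eval s ≤ f.eval s
  | neg b => ¬ b.Holds s
  | and b c => b.Holds s ∧ c.Holds s

/-- The number of elementary operations in a test. -/
def Test.cost : Test → ℕ
  | natLE e f => e.cost + f.cost + 1
  | realLE e f => e.cost + f.cost + 1
  | neg b => b.cost + 1
  | and b c => b.cost + c.cost + 1

/-- Overwrite one entry of an array. -/
def overwrite {α : Type} (mem : ℕ → ℕ → ℕ → α) (a i j : ℕ) (v : α) : ℕ → ℕ → ℕ → α :=
  fun a' i' j' => if a' = a ∧ i' = i ∧ j' = j then v else mem a' i' j'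

/-- Programs. -/
inductive Program : Type
  | skip
  | writeNat (a : ℕ) (i j e : NatExpr)
  | writeReal (a : ℕ) (i j : NatExpr) (e : RealExpr)
  | seq (P Q : Program)
  | branch (b : Test) (P Q : Program)
  | loop (b : Test) (P : Program)

/-- `Exec P s t s'`: started in memory `s`, the program `P` halts after exactly `t` elementary
operations, in memory `s'`. (`loop b P` is `while b do P`.) -/
inductive Exec : Program → Memory → ℕ → Memory → Prop
  | skip (s : Memory) : Exec .skip s 1 s
  | writeNat (a : ℕ) (i j e : NatExpr) (s : Memory) :
      Exec (.writeNat a i j e) s (i.cost + j.cost + e.cost + 1)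
        { s with nat := overwrite s.nat a (i.eval s) (j.eval s) (e.eval s) }
  | writeReal (a : ℕ) (i j : NatExpr) (e : RealExpr) (s : Memory) :
      Exec (.writeReal a i j e) s (i.cost + j.cost + e.cost + 1)
        { s with real := overwrite s.real a (i.eval s) (j.eval s) (e.eval s) }
  | seq {P Q : Program} {s s' s'' : Memory} {t t' : ℕ} :
      Exec P s t s' → Exec Q s' t' s'' → Exec (.seq P Q) s (t + t') s''
  | branchTrue {b : Test} {P Q : Program} {s s' : Memory} {t : ℕ} :
      b.Holds s → Exec P s t s' → Exec (.branch b P Q) s (b.cost + t + 1) s'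
  | branchFalse {b : Test} {P Q : Program} {s s' : Memory} {t : ℕ} :
      ¬ b.Holds s → Exec Q s t s' → Exec (.branch b P Q) s (b.cost + t + 1) s'
  | loopTrue {b : Test} {P : Program} {s s' s'' : Memory} {t t' : ℕ} :
      b.Holds s → Exec P s t s' → Exec (.loop b P) s' t' s'' →
        Exec (.loop b P) s (b.cost + t + t' + 1) s''
  | loopFalse {b : Test} {P : Program} {s : Memory} :
      ¬ b.Holds s → Exec (.loop b P) s (b.cost + 1) s

/-- Programs are deterministic: running time and final memory are determined by the input. -/
theorem Exec.deterministic {P : Program} {s s₁ s₂ : Memory} {t₁ t₂ : ℕ}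
    (h₁ : Exec P s t₁ s₁) (h₂ : Exec P s t₂ s₂) : t₁ = t₂ ∧ s₁ = s₂ := by
  induction h₁ generalizing t₂ s₂ with
  | skip s => cases h₂; exact ⟨rfl, rfl⟩
  | writeNat a i j e s => cases h₂; exact ⟨rfl, rfl⟩
  | writeReal a i j e s => cases h₂; exact ⟨rfl, rfl⟩
  | seq _ _ ih ih' =>
    cases h₂ with
    | seq k k' =>
      obtain ⟨rfl, rfl⟩ := ih k
      obtain ⟨rfl, rfl⟩ := ih' k'
      exact ⟨rfl, rfl⟩
  | branchTrue hb _ ih =>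
    cases h₂ with
    | branchTrue _ k => obtain ⟨rfl, rfl⟩ := ih k; exact ⟨rfl, rfl⟩
    | branchFalse hb' _ => exact absurd hb hb'
  | branchFalse hb _ ih =>
    cases h₂ with
    | branchTrue hb' _ => exact absurd hb' hb
    | branchFalse _ k => obtain ⟨rfl, rfl⟩ := ih k; exact ⟨rfl, rfl⟩
  | loopTrue hb _ _ ih ih' =>
    cases h₂ with
    | loopTrue _ k k' =>
      obtain ⟨rfl, rfl⟩ := ih k
      obtain ⟨rfl, rfl⟩ := ih' k'
      exact ⟨rfl, rfl⟩
    | loopFalse hb' => exact absurd hb hb'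
  | loopFalse hb =>
    cases h₂ with
    | loopTrue hb' _ _ => exact absurd hb' hb
    | loopFalse _ => exact ⟨rfl, rfl⟩

/-! ### Input and output of the expectation value algorithm -/

/-- Code of a gate in memory: type of the gate, first qubit, second qubit. -/
def Gate.code {n : ℕ} : Gate n → ℕ × ℕ × ℕ
  | .hadamard q => (0, q, 0)
  | .phase q => (1, q, 0)
  | .cnot c t _ => (2, c, t)

/-- The initial memory. Natural numbers: array 0 holds `n`, `r` and the number `N` of sketches;
array 1 the length of the circuit of sketch `j`; arrays 2, 3, 4 the codes of gate `i` of that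
circuit. Real numbers: array 0 holds `ε` and `p`; arrays 1 and 2 the real and imaginary parts of the
entries of `M`; arrays 3 and 4 those of the amplitudes `z` of sketch `j`.
All other cells are zero. -/
noncomputable def inputMemory {n k N : ℕ} (r : ℕ) (ε p : ℝ)
    (M : Matrix (Qubits n) (Qubits n) ℂ) (S : Fin N → Sketch n k) : Memory where
  nat a i j :=
    match a with
    | 0 => if i = 0 then (if j = 0 then n else if j = 1 then r else if j = 2 then N else 0) else 0
    | 1 => if h : i < N then (if j = 0 then (S ⟨i, h⟩).circuit.length else 0) else 0
    | 2 => if h : i < N then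
        (((S ⟨i, h⟩).circuit[j]?).map fun G => G.code.1).getD 0 else 0
    | 3 => if h : i < N then
        (((S ⟨i, h⟩).circuit[j]?).map fun G => G.code.2.1).getD 0 else 0
    | 4 => if h : i < N then
        (((S ⟨i, h⟩).circuit[j]?).map fun G => G.code.2.2).getD 0 else 0
    | _ => 0
  real a i j :=
    match a with
    | 0 => if i = 0 then (if j = 0 then ε else if j = 1 then p else 0) else 0
    | 1 => if i < 2 ^ n ∧ j < 2 ^ n then (M (ket n i) (ket n j)).re else 0
    | 2 => if i < 2 ^ n ∧ j < 2 ^ n then (M (ket n i) (ket n j)).im else 0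
    | 3 => if h : i < N ∧ j < 2 ^ k then ((S ⟨i, h.1⟩).amp ⟨j, h.2⟩).re else 0
    | 4 => if h : i < N ∧ j < 2 ^ k then ((S ⟨i, h.1⟩).amp ⟨j, h.2⟩).im else 0
    | _ => 0

/-- Started in memory `s`, the program halts after `t` elementary operations and outputs the real
number `E` (in cell `(0, 0)` of the real array 5). -/
def Program.Outputs (P : Program) (s : Memory) (t : ℕ) (E : ℝ) : Prop :=
  ∃ s' : Memory, Exec P s t s' ∧ s'.real 5 0 0 = E

/-! Let `Π` be the projection onto the basis states `0^(n-k) z`. A sketch with Clifford unitary `C`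
determines `Pψ`, where `P = C†ΠC`. Two independent sketches give the estimate `4^(n-k) ⟨P₁ψ|M|P₂ψ⟩`
(`pairEstimate`).

The operator `2^(n-k) Π` is the sum of the operators `Z^a` over `2^(n-k)` exponents `a`
(`sketchForm_eq`). Multiplying `C` by a Pauli operator changes the sign of the term of a suitable
nonzero `a`, so only `a = 0` survives averaging and the estimate is unbiased (`sum_pairEstimate`).
For second moments, the same sign argument removes the cross terms (`sum_pauliForm_mul_star`). All
nontrivial Pauli operators have equal second moments, because Clifford circuits permute them
transitively, and the sum of these moments is known from Parseval (`sum_norm_pauliForm_sq`). This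
yields `sum_norm_sketchForm_sq_le`. Applied to `C₁` and then to each row of `M` for `C₂`, it bounds
the variance by `2‖Mψ‖²/2^k + ‖M‖_F²/4^k`, with `‖M‖_F² ≤ rank M`.

If `k < n`, maximality of `k` gives `2^k > 12 max(ε⁻², √r ε⁻¹)`, and by Chebyshev a pair misses by
more than `0.95 ε` with probability at most `1/5` (`five_mul_bad_pairs_le`). Among `O(1 + log(1/p))`
independent pairs the bad ones then fail to be a minority with probability at most `p`
(`card_majority_bad_le`), so an approximate median of the estimates is accurate. If `k = n`, then `P
= 1` and a single pair gives the expectation value exactly, up to the precision of the amplitudes.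

The uniform distribution requires the Clifford group to be finite, and the sketches require short
circuits; both come from `exists_short_circuit`. Gaussian elimination on Pauli labels reduces a
circuit to a Pauli operator times a scalar (`exists_circuit_undo`, `exists_eq_smul_pauli`). The
scalar is an eighth root of unity, since it lies in `ℚ(ω)` with `ω = e^(iπ/4)` and has order a power
of two (`phase_pow_eight`).

The machine program stores vectors of length `2^n`, undoes each circuit gate by gate, evaluates the
matrix element for each pair, and finds a median by bisection. Its correctness and running time are
proved together through `Runs`, a Hoare logic with time bounds. -/

/-! ### Pauli operators up to phase -/

/-- Labels of `n`-qubit Pauli operators up to phase: on each qubit, the exponents of `X` and `Z`. -/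
abbrev PauliLabel (n : ℕ) : Type := Fin n → Bool × Bool

/-- `(-1) ^ b`. -/
def sgn (b : Bool) : ℂ := if b then -1 else 1

@[simp] lemma sgn_true : sgn true = -1 := rfl

@[simp] lemma sgn_false : sgn false = 1 := rfl

lemma sgn_xor (a b : Bool) : sgn (xor a b) = sgn a * sgn b := by
  cases a <;> cases b <;> simp

lemma sgn_mul_self (a : Bool) : sgn a * sgn a = 1 := by cases a <;> simp

lemma star_sgn (a : Bool) : star (sgn a) = sgn a := by cases a <;> simp

lemma norm_sgn (a : Bool) : ‖sgn a‖ = 1 := by cases a <;> simp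

variable {n : ℕ}

/-- The action of a Pauli operator on basis labels. -/
def flipBits (p : PauliLabel n) (u : Qubits n) : Qubits n := fun l => xor (u l) (p l).1

/-- The sign in the action of a Pauli operator on a basis state. -/
def pauliSign (p : PauliLabel n) (u : Qubits n) : ℂ := ∏ l, sgn ((p l).2 && u l)

/-- The Pauli operator `∏ X ^ x Z ^ z`. -/
def pauli (p : PauliLabel n) : Matrix (Qubits n) (Qubits n) ℂ :=
  Matrix.of fun u v => if u = flipBits p v then pauliSign p v else 0

lemma flipBits_flipBits (p : PauliLabel n) (u : Qubits n) : flipBits p (flipBits p u) = u := by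
  ext l; simp [flipBits]

lemma flipBits_involutive (p : PauliLabel n) : Function.Involutive (flipBits p) :=
  flipBits_flipBits p

lemma eq_flipBits_iff (p : PauliLabel n) (u v : Qubits n) : u = flipBits p v ↔ v = flipBits p u := by
  constructor <;> (rintro rfl; rw [flipBits_flipBits])

lemma mul_pauli_apply (G : Matrix (Qubits n) (Qubits n) ℂ) (p : PauliLabel n) (u v : Qubits n) :
    (G * pauli p) u v = G u (flipBits p v) * pauliSign p v := by
  simp [Matrix.mul_apply, pauli]

lemma pauli_mul_apply (G : Matrix (Qubits n) (Qubits n) ℂ) (p : PauliLabel n) (u v : Qubits n) :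
    (pauli p * G) u v = pauliSign p (flipBits p u) * G (flipBits p u) v := by
  simp [Matrix.mul_apply, pauli, eq_flipBits_iff p u]

/-! ### Gates -/

/-- A single-qubit operator, acting on the qubit `q`. -/
def onQubit (q : Fin n) (A : Matrix Bool Bool ℂ) : Matrix (Qubits n) (Qubits n) ℂ :=
  Matrix.of fun x y => if ∀ l, l ≠ q → x l = y l then A (x q) (y q) else 0

/-- The Hadamard matrix. -/
noncomputable def hadamardMatrix : Matrix Bool Bool ℂ :=
  Matrix.of fun a b => ((1 / Real.sqrt 2 : ℝ) : ℂ) * (if a = true ∧ b = true then -1 else 1)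

/-- The phase matrix. -/
noncomputable def phaseMatrix : Matrix Bool Bool ℂ :=
  Matrix.diagonal fun a => if a = true then Complex.I else 1

lemma hadamard_eq (q : Fin n) : (Gate.hadamard q).matrix = onQubit q hadamardMatrix := rfl

lemma eq_of_agree {x y : Qubits n} {q : Fin n} (h : ∀ l, l ≠ q → x l = y l) (hq : x q = y q) :
    x = y := by
  ext l
  by_cases hl : l = q
  · rw [hl, hq]
  · rw [h l hl]

lemma phase_eq (q : Fin n) : (Gate.phase q).matrix = onQubit q phaseMatrix := by
  ext x y
  simp only [Gate.matrix, onQubit, phaseMatrix, Matrix.of_apply, Matrix.diagonal_apply]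
  by_cases h : x = y
  · subst h; simp
  · rw [if_neg h]
    split_ifs with h1 h2 h3
    · exact absurd (eq_of_agree h1 h2) h
    · exact absurd (eq_of_agree h1 h2) h
    · rfl
    · rfl

lemma onQubit_mul (q : Fin n) (A B : Matrix Bool Bool ℂ) :
    onQubit q A * onQubit q B = onQubit q (A * B) := by
  ext x y
  simp only [onQubit, Matrix.mul_apply, Matrix.of_apply]
  by_cases h : ∀ l, l ≠ q → x l = y l
  · rw [if_pos h]
    -- Only the two labels that agree with `x` away from `q` contribute, which turns the sum over
    -- all strings into a `2 × 2` matrix product.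
    have hinj : Function.Injective fun b : Bool => Function.update x q b :=
      Function.update_injective x q
    rw [← Finset.sum_subset (Finset.subset_univ (Finset.univ.map ⟨_, hinj⟩)), Finset.sum_map]
    · refine Finset.sum_congr rfl fun b _ => ?_
      simp only [Function.Embedding.coeFn_mk, Function.update_self]
      rw [if_pos, if_pos]
      · intro l hl; rw [Function.update_of_ne hl]; exact h l hl
      · intro l hl; rw [Function.update_of_ne hl]
    · intro z _ hz
      rw [if_neg, zero_mul]
      intro hxz
      apply hz
      simp only [Finset.mem_map, Finset.mem_univ, Function.Embedding.coeFn_mk, true_and]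
      exact ⟨z q, eq_of_agree (q := q) (fun l hl => by rw [Function.update_of_ne hl, hxz l hl])
        (by simp)⟩
  · rw [if_neg h]
    refine Finset.sum_eq_zero fun z _ => ?_
    split_ifs with h1 h2
    · exact absurd (fun l hl => (h1 l hl).trans (h2 l hl)) h
    all_goals simp

lemma onQubit_one (q : Fin n) : onQubit q (1 : Matrix Bool Bool ℂ) = 1 := by
  ext x y
  simp only [onQubit, Matrix.of_apply, Matrix.one_apply]
  by_cases h : x = y
  · subst h; simp
  · rw [if_neg h]
    split_ifs with h1 h2
    · exact absurd (eq_of_agree h1 h2) h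
    · rfl
    · rfl

lemma onQubit_smul (q : Fin n) (c : ℂ) (A : Matrix Bool Bool ℂ) :
    onQubit q (c • A) = c • onQubit q A := by
  ext x y
  simp [onQubit]

lemma onQubit_conjTranspose (q : Fin n) (A : Matrix Bool Bool ℂ) :
    (onQubit q A)ᴴ = onQubit q Aᴴ := by
  ext x y
  simp only [onQubit, Matrix.conjTranspose_apply, Matrix.of_apply, apply_ite star, star_zero]
  simp only [eq_comm]

lemma inv_sqrt_two_sq : ((1 / Real.sqrt 2 : ℝ) : ℂ) * ((1 / Real.sqrt 2 : ℝ) : ℂ) = 1 / 2 := by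
  rw [← Complex.ofReal_mul, div_mul_div_comm, Real.mul_self_sqrt (by norm_num)]
  norm_num

lemma hadamardMatrix_conjTranspose : hadamardMatrixᴴ = hadamardMatrix := by
  ext a b
  cases a <;> cases b <;> simp [hadamardMatrix]

lemma hadamardMatrix_mul_self : hadamardMatrix * hadamardMatrix = 1 := by
  have h := inv_sqrt_two_sq
  ext a b
  simp only [Matrix.mul_apply, Fintype.sum_bool, hadamardMatrix, Matrix.of_apply]
  generalize ((1 / Real.sqrt 2 : ℝ) : ℂ) = s at h
  cases a <;> cases b <;> simp <;> linear_combination 2 * h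

lemma phaseMatrix_conjTranspose_mul : phaseMatrixᴴ * phaseMatrix = 1 := by
  ext a b
  cases a <;> cases b <;> simp [phaseMatrix, Matrix.mul_apply, Matrix.diagonal_apply]

lemma phaseMatrix_pow : phaseMatrix * phaseMatrix * phaseMatrix * phaseMatrix = 1 := by
  simp only [phaseMatrix, Matrix.diagonal_mul_diagonal]
  rw [← Matrix.diagonal_one]
  congr 1
  ext a
  cases a <;> simp

/-- The action of a controlled NOT gate on basis labels. -/
def cnotBits (c t : Fin n) (y : Qubits n) : Qubits n := Function.update y t (xor (y t) (y c))

lemma cnotBits_cnotBits {c t : Fin n} (h : c ≠ t) (y : Qubits n) :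
    cnotBits c t (cnotBits c t y) = y := by
  ext l
  by_cases hl : l = t
  · subst hl; simp [cnotBits, Function.update_of_ne h]
  · simp [cnotBits, Function.update_of_ne hl]

lemma eq_cnotBits_iff {c t : Fin n} (h : c ≠ t) (x y : Qubits n) :
    x = cnotBits c t y ↔ y = cnotBits c t x := by
  constructor <;> (rintro rfl; rw [cnotBits_cnotBits h])

lemma cnot_apply {c t : Fin n} (h : c ≠ t) (x y : Qubits n) :
    (Gate.cnot c t h).matrix x y = if x = cnotBits c t y then 1 else 0 := rfl

lemma cnot_conjTranspose {c t : Fin n} (h : c ≠ t) :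
    (Gate.cnot c t h).matrixᴴ = (Gate.cnot c t h).matrix := by
  ext x y
  simp [Matrix.conjTranspose_apply, cnot_apply, eq_cnotBits_iff h x y, apply_ite]

lemma cnot_mul_self {c t : Fin n} (h : c ≠ t) :
    (Gate.cnot c t h).matrix * (Gate.cnot c t h).matrix = 1 := by
  ext x y
  simp [Matrix.mul_apply, cnot_apply, cnotBits_cnotBits h, Matrix.one_apply]

lemma Gate.conjTranspose_mul (G : Gate n) : G.matrixᴴ * G.matrix = 1 := by
  cases G with
  | hadamard q =>
    rw [hadamard_eq, onQubit_conjTranspose, onQubit_mul, hadamardMatrix_conjTranspose,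
      hadamardMatrix_mul_self, onQubit_one]
  | phase q =>
    rw [phase_eq, onQubit_conjTranspose, onQubit_mul, phaseMatrix_conjTranspose_mul, onQubit_one]
  | cnot c t h => rw [cnot_conjTranspose, cnot_mul_self]

/-- A circuit that implements the inverse of a gate. -/
def Gate.inverse : Gate n → List (Gate n)
  | .hadamard q => [.hadamard q]
  | .phase q => [.phase q, .phase q, .phase q]
  | .cnot c t h => [.cnot c t h]

lemma circuitMatrix_append (w w' : List (Gate n)) :
    circuitMatrix (w ++ w') = circuitMatrix w' * circuitMatrix w := by
  induction w with
  | nil => simp [circuitMatrix]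
  | cons G w ih => simp [circuitMatrix, ih, Matrix.mul_assoc]

lemma Gate.inverse_mul (G : Gate n) : circuitMatrix G.inverse * G.matrix = 1 := by
  cases G with
  | hadamard q =>
    simp [Gate.inverse, circuitMatrix, hadamard_eq, onQubit_mul, hadamardMatrix_mul_self,
      onQubit_one]
  | phase q =>
    simp [Gate.inverse, circuitMatrix, phase_eq, onQubit_mul, phaseMatrix_pow, onQubit_one]
  | cnot c t h => simp [Gate.inverse, circuitMatrix, cnot_mul_self]

lemma Gate.length_inverse_le (G : Gate n) : G.inverse.length ≤ 3 := by
  cases G <;> simp [Gate.inverse]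

lemma circuitMatrix_conjTranspose_mul (w : List (Gate n)) :
    (circuitMatrix w)ᴴ * circuitMatrix w = 1 := by
  induction w with
  | nil => simp [circuitMatrix]
  | cons G w ih =>
    rw [circuitMatrix, Matrix.conjTranspose_mul, Matrix.mul_assoc, ← Matrix.mul_assoc _ _ G.matrix,
      ih, Matrix.one_mul, G.conjTranspose_mul]

/-- Hadamard and CNOT are involutions and `S⁻¹ = S³`, whence the factor 3. -/
lemma exists_inverse_circuit (w : List (Gate n)) :
    ∃ w' : List (Gate n), w'.length ≤ 3 * w.length ∧ circuitMatrix w' * circuitMatrix w = 1 := by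
  induction w with
  | nil => exact ⟨[], by simp, by simp [circuitMatrix]⟩
  | cons G w ih =>
    obtain ⟨w', hl, h⟩ := ih
    refine ⟨w' ++ G.inverse, ?_, ?_⟩
    · have := G.length_inverse_le
      simp only [List.length_append, List.length_cons]
      omega
    · rw [circuitMatrix_append, circuitMatrix, Matrix.mul_assoc, ← Matrix.mul_assoc _ _ G.matrix, h,
        Matrix.one_mul, G.inverse_mul]

/-! ### The action of circuits on Pauli operators -/

/-- Conjugation of Pauli operators by a gate, up to phase. -/
def Gate.act : Gate n → PauliLabel n → PauliLabel n
  | .hadamard q, p => Function.update p q ((p q).2, (p q).1)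
  | .phase q, p => Function.update p q ((p q).1, xor (p q).2 (p q).1)
  | .cnot c t _, p => Function.update (Function.update p t (xor (p t).1 (p c).1, (p t).2))
      c ((p c).1, xor (p c).2 (p t).2)

/-- `U` conjugates one Pauli operator to another, up to phase. -/
def Conjugates (U : Matrix (Qubits n) (Qubits n) ℂ) (p p' : PauliLabel n) : Prop :=
  ∃ c : ℂ, ‖c‖ = 1 ∧ U * pauli p = c • (pauli p' * U)

/-- Flips and signs factorise over the qubits and the factors away from `q` agree on both sides, so
the relation reduces to one between `2 × 2` matrices. -/
lemma onQubit_conjugates {q : Fin n} {A : Matrix Bool Bool ℂ} {p : PauliLabel n} {b : Bool × Bool}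
    {c : ℂ} (hc : ‖c‖ = 1)
    (h : ∀ u v : Bool, A u (xor v (p q).1) * sgn ((p q).2 && v) =
      c * (sgn (b.2 && xor u b.1) * A (xor u b.1) v)) :
    Conjugates (onQubit q A) p (Function.update p q b) := by
  refine ⟨c, hc, ?_⟩
  ext u v
  rw [Matrix.smul_apply, mul_pauli_apply, pauli_mul_apply, smul_eq_mul]
  have key : (∀ l, l ≠ q → u l = flipBits p v l) ↔
      ∀ l, l ≠ q → flipBits (Function.update p q b) u l = v l := by
    refine forall_congr' fun l => imp_congr_right fun hl => ?_
    simp only [flipBits, Function.update_of_ne hl]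
    generalize u l = a, v l = d, (p l).1 = e
    revert a d e; decide
  simp only [onQubit, Matrix.of_apply]
  by_cases hag : ∀ l, l ≠ q → u l = flipBits p v l
  · have hag' := key.1 hag
    rw [if_pos hag, if_pos hag']
    have e1 : pauliSign p v = sgn ((p q).2 && v q) *
        ∏ l ∈ Finset.univ.erase q, sgn ((p l).2 && v l) :=
      (Finset.mul_prod_erase _ (fun l => sgn ((p l).2 && v l)) (Finset.mem_univ q)).symm
    have e2 : pauliSign (Function.update p q b) (flipBits (Function.update p q b) u) =
        sgn (b.2 && xor (u q) b.1) * ∏ l ∈ Finset.univ.erase q, sgn ((p l).2 && v l) := by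
      rw [pauliSign, ← Finset.mul_prod_erase _ _ (Finset.mem_univ q)]
      congr 1
      · simp [flipBits]
      · refine Finset.prod_congr rfl fun l hl => ?_
        have hl' := Finset.ne_of_mem_erase hl
        rw [hag' l hl', Function.update_of_ne hl']
    rw [e1, e2]
    have e3 : flipBits (Function.update p q b) u q = xor (u q) b.1 := by simp [flipBits]
    have e4 : flipBits p v q = xor (v q) (p q).1 := rfl
    rw [e3, e4]
    linear_combination (∏ l ∈ Finset.univ.erase q, sgn ((p l).2 && v l)) * h (u q) (v q)
  · rw [if_neg hag, if_neg (fun h' => hag (key.2 h'))]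
    simp

lemma Gate.conjugates (G : Gate n) (p : PauliLabel n) : Conjugates G.matrix p (G.act p) := by
  cases G with
  | hadamard q =>
    rw [hadamard_eq]
    -- `H` exchanges `X` and `Z`; restoring the order `XZ` costs a sign exactly when both are
    -- present.
    refine onQubit_conjugates (c := sgn ((p q).1 && (p q).2)) (norm_sgn _) fun u v => ?_
    generalize p q = b
    obtain ⟨x, z⟩ := b
    simp only [hadamardMatrix, Matrix.of_apply]
    cases u <;> cases v <;> cases x <;> cases z <;> simp
  | phase q =>
    rw [phase_eq]
    -- `S X S⁻¹ = i X Z`, while `S` commutes with `Z`.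
    refine onQubit_conjugates (c := if (p q).1 then Complex.I else 1) (by split_ifs <;> simp)
      fun u v => ?_
    generalize p q = b
    obtain ⟨x, z⟩ := b
    simp only [phaseMatrix, Matrix.diagonal_apply]
    cases u <;> cases v <;> cases x <;> cases z <;> simp
  | cnot c t h =>
    -- CNOT permutes the basis by a linear map over `𝔽₂`, so with `X` written before `Z` no phase
    -- arises.
    refine ⟨1, by simp, ?_⟩
    ext u v
    rw [one_smul, mul_pauli_apply, pauli_mul_apply, cnot_apply, cnot_apply]
    set p' := Gate.act (.cnot c t h) p with hp'
    have hp't : p' t = (xor (p t).1 (p c).1, (p t).2) := by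
      simp [hp', Gate.act, Function.update_of_ne h.symm]
    have hp'c : p' c = ((p c).1, xor (p c).2 (p t).2) := by simp [hp', Gate.act]
    have hp'l : ∀ l, l ≠ c → l ≠ t → p' l = p l := fun l h1 h2 => by
      simp [hp', Gate.act, Function.update_of_ne h1, Function.update_of_ne h2]
    have hflip : cnotBits c t (flipBits p v) = flipBits p' (cnotBits c t v) := by
      ext l
      by_cases hl : l = t
      · subst hl
        simp only [cnotBits, flipBits, Function.update_self, hp't]
        generalize v l = a, v c = d, (p l).1 = e, (p c).1 = f
        revert a d e f; decide
      · have : (p' l).1 = (p l).1 := by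
          by_cases hc : l = c
          · subst hc; rw [hp'c]
          · rw [hp'l l hc hl]
        simp [cnotBits, flipBits, Function.update_of_ne hl, this]
    rw [hflip]
    have key : pauliSign p v = pauliSign p' (cnotBits c t v) := by
      have hct : t ∈ Finset.univ.erase c := Finset.mem_erase.2 ⟨h.symm, Finset.mem_univ _⟩
      rw [pauliSign, pauliSign, ← Finset.mul_prod_erase _ _ (Finset.mem_univ c),
        ← Finset.mul_prod_erase _ _ hct, ← Finset.mul_prod_erase _ _ (Finset.mem_univ c),
        ← Finset.mul_prod_erase _ _ hct, ← mul_assoc, ← mul_assoc]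
      congr 1
      · simp only [hp'c, hp't, cnotBits, Function.update_self, Function.update_of_ne h]
        generalize v t = a, v c = d, (p t).2 = e, (p c).2 = f
        cases a <;> cases d <;> cases e <;> cases f <;> simp
      · refine Finset.prod_congr rfl fun l hl => ?_
        simp only [Finset.mem_erase, Finset.mem_univ, and_true] at hl
        rw [hp'l l hl.2 hl.1, cnotBits, Function.update_of_ne hl.1]
    by_cases hu : u = flipBits p' (cnotBits c t v)
    · have hu' := (eq_flipBits_iff p' _ _).1 hu
      rw [if_pos hu, if_pos hu'.symm, one_mul, mul_one, ← hu', key]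
    · rw [if_neg hu, if_neg fun h' => hu ((eq_flipBits_iff p' _ _).2 h'.symm)]; simp

/-- Conjugation of Pauli operators by a circuit, up to phase. -/
def circuitAct : List (Gate n) → PauliLabel n → PauliLabel n
  | [], p => p
  | G :: w, p => circuitAct w (G.act p)

lemma circuitAct_append (w w' : List (Gate n)) (p : PauliLabel n) :
    circuitAct (w ++ w') p = circuitAct w' (circuitAct w p) := by
  induction w generalizing p with
  | nil => rfl
  | cons G w ih => exact ih _

lemma Conjugates.mul {U V : Matrix (Qubits n) (Qubits n) ℂ} {p p' p'' : PauliLabel n}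
    (hU : Conjugates U p p') (hV : Conjugates V p' p'') : Conjugates (V * U) p p'' := by
  obtain ⟨c, hc, h⟩ := hU
  obtain ⟨d, hd, h'⟩ := hV
  refine ⟨c * d, by rw [norm_mul, hc, hd, one_mul], ?_⟩
  rw [Matrix.mul_assoc, h, Matrix.mul_smul, ← Matrix.mul_assoc, h', Matrix.smul_mul, smul_smul,
    Matrix.mul_assoc]

lemma circuit_conjugates (w : List (Gate n)) (p : PauliLabel n) :
    Conjugates (circuitMatrix w) p (circuitAct w p) := by
  induction w generalizing p with
  | nil => exact ⟨1, by simp, by simp [circuitMatrix, circuitAct]⟩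
  | cons G w ih => exact (G.conjugates p).mul (ih _)

/-! ### Synthesis of short circuits -/

/-- The sign that tells whether two Pauli operators commute. -/
def commSign (p p' : PauliLabel n) : ℂ :=
  ∏ l, sgn (xor ((p l).1 && (p' l).2) ((p l).2 && (p' l).1))

/-- The label of the identity. -/
def idLabel (n : ℕ) : PauliLabel n := fun _ => (false, false)

/-- The label of the Pauli operator `X` on qubit `q`. -/
def labelX (q : Fin n) : PauliLabel n := Function.update (idLabel n) q (true, false)

/-- The label of the Pauli operator `Z` on qubit `q`. -/
def labelZ (q : Fin n) : PauliLabel n := Function.update (idLabel n) q (false, true)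

lemma commSign_update (p : PauliLabel n) (q : Fin n) (b : Bool × Bool) :
    commSign p (Function.update (idLabel n) q b) =
      sgn (xor ((p q).1 && b.2) ((p q).2 && b.1)) := by
  rw [commSign, Finset.prod_eq_single q]
  · simp
  · intro l _ hl
    simp [Function.update_of_ne hl, idLabel]
  · simp

lemma sgn_injective : Function.Injective sgn := by
  intro a b h
  cases a <;> cases b <;> first | rfl | (exfalso; norm_num [sgn] at h)

lemma commSign_labelX (p : PauliLabel n) (q : Fin n) : commSign p (labelX q) = sgn (p q).2 := by
  rw [labelX, commSign_update]; simp

lemma commSign_labelZ (p : PauliLabel n) (q : Fin n) : commSign p (labelZ q) = sgn (p q).1 := by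
  rw [labelZ, commSign_update]; simp

/-- Nondegeneracy of the symplectic form: commutation with `X_q` and `Z_q` reads off the two
exponents at `q`. -/
lemma eq_of_commSign_eq {p p' : PauliLabel n}
    (hX : ∀ q, commSign p (labelX q) = commSign p' (labelX q))
    (hZ : ∀ q, commSign p (labelZ q) = commSign p' (labelZ q)) : p = p' := by
  ext q
  · have := hZ q
    rw [commSign_labelZ, commSign_labelZ] at this
    exact sgn_injective this
  · have := hX q
    rw [commSign_labelX, commSign_labelX] at this
    exact sgn_injective this

lemma commSign_update_update (p p' : PauliLabel n) (q : Fin n) (b b' : Bool × Bool)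
    (h : xor (b.1 && b'.2) (b.2 && b'.1) = xor ((p q).1 && (p' q).2) ((p q).2 && (p' q).1)) :
    commSign (Function.update p q b) (Function.update p' q b') = commSign p p' := by
  refine Finset.prod_congr rfl fun l _ => ?_
  by_cases hl : l = q
  · subst hl; simp [h]
  · simp [Function.update_of_ne hl]

/-- Gates act as symplectic maps. Only the factors at the one or two qubits of the gate change, and
these are checked over all cases. -/
lemma Gate.commSign_act (G : Gate n) (p p' : PauliLabel n) :
    commSign (G.act p) (G.act p') = commSign p p' := by
  cases G with
  | hadamard q =>
    refine commSign_update_update _ _ _ _ _ ?_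
    generalize p q = b, p' q = b'
    revert b b'; decide
  | phase q =>
    refine commSign_update_update _ _ _ _ _ ?_
    generalize p q = b, p' q = b'
    revert b b'; decide
  | cnot c t h =>
    have hct : t ∈ Finset.univ.erase c := Finset.mem_erase.2 ⟨h.symm, Finset.mem_univ _⟩
    rw [commSign, commSign, ← Finset.mul_prod_erase _ _ (Finset.mem_univ c),
      ← Finset.mul_prod_erase _ _ hct, ← Finset.mul_prod_erase _ _ (Finset.mem_univ c),
      ← Finset.mul_prod_erase _ _ hct, ← mul_assoc, ← mul_assoc]
    congr 1
    · simp only [Gate.act, Function.update_self, Function.update_of_ne h.symm, ← sgn_xor]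
      congr 1
      generalize p c = a, p t = b, p' c = a', p' t = b'
      revert a b a' b'; decide
    · refine Finset.prod_congr rfl fun l hl => ?_
      simp only [Finset.mem_erase, Finset.mem_univ, and_true] at hl
      simp [Gate.act, Function.update_of_ne hl.1, Function.update_of_ne hl.2]

lemma commSign_circuitAct (w : List (Gate n)) (p p' : PauliLabel n) :
    commSign (circuitAct w p) (circuitAct w p') = commSign p p' := by
  induction w generalizing p p' with
  | nil => rfl
  | cons G w ih => rw [circuitAct, circuitAct, ih, G.commSign_act]

lemma act_hadamard_eq {q : Fin n} {p : PauliLabel n} (h : p q = (false, false)) :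
    (Gate.hadamard q).act p = p := by
  simp only [Gate.act, h]; rw [← h, Function.update_eq_self]

lemma act_phase_eq {q : Fin n} {p : PauliLabel n} (h : (p q).1 = false) :
    (Gate.phase q).act p = p := by
  simp only [Gate.act, h, Bool.xor_false]; rw [← h, Prod.mk.eta, Function.update_eq_self]

lemma act_cnot_eq {c t : Fin n} (hct : c ≠ t) {p : PauliLabel n} (hc : (p c).1 = false)
    (ht : (p t).2 = false) : (Gate.cnot c t hct).act p = p := by
  ext l <;> by_cases h1 : l = c
  · subst h1; simp [Gate.act]
  · by_cases h2 : l = t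
    · subst h2; simp [Gate.act, Function.update_of_ne h1, hc]
    · simp [Gate.act, Function.update_of_ne h1, Function.update_of_ne h2]
  · subst h1; simp [Gate.act, ht]
  · by_cases h2 : l = t
    · subst h2; simp [Gate.act, Function.update_of_ne h1]
    · simp [Gate.act, Function.update_of_ne h1, Function.update_of_ne h2]

/-- Qubit by qubit modification of a Pauli label by a circuit that fixes all labels in `F`. -/
lemma exists_sweep (F : Set (PauliLabel n)) (Inv : PauliLabel n → Prop)
    (R : Bool × Bool → Bool × Bool → Prop) (m : ℕ) (T : Finset (Fin n))
    (step : ∀ j ∈ T, ∀ p, Inv p → ∃ w : List (Gate n), w.length ≤ m ∧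
      (∀ f ∈ F, circuitAct w f = f) ∧ Inv (circuitAct w p) ∧ R (p j) (circuitAct w p j) ∧
      ∀ i, i ≠ j → circuitAct w p i = p i) (p : PauliLabel n) (hp : Inv p) :
    ∃ w : List (Gate n), w.length ≤ m * T.card ∧ (∀ f ∈ F, circuitAct w f = f) ∧
      Inv (circuitAct w p) ∧ (∀ j ∈ T, R (p j) (circuitAct w p j)) ∧
      ∀ i, i ∉ T → circuitAct w p i = p i := by
  induction T using Finset.induction_on with
  | empty => exact ⟨[], by simp, fun _ _ => rfl, hp, by simp, fun _ _ => rfl⟩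
  | insert a T ha ih =>
    obtain ⟨w, hl, hF, hI, hR, hT⟩ := ih fun j hj => step j (Finset.mem_insert_of_mem hj)
    obtain ⟨w', hl', hF', hI', hR', hT'⟩ := step a (Finset.mem_insert_self a T) _ hI
    refine ⟨w ++ w', ?_, ?_, ?_, ?_, ?_⟩
    · rw [List.length_append, Finset.card_insert_of_notMem ha, mul_add, mul_one]
      omega
    · intro f hf
      rw [circuitAct_append, hF f hf, hF' f hf]
    · rwa [circuitAct_append]
    · intro j hj
      rw [circuitAct_append]
      rcases Finset.mem_insert.1 hj with rfl | hj
      · rwa [hT _ ha] at hR'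
      · rw [hT' j (fun h => ha (h ▸ hj))]
        exact hR j hj
    · intro i hi
      rw [Finset.mem_insert, not_or] at hi
      rw [circuitAct_append, hT' i hi.1, hT i hi.2]

/-- Gaussian elimination: make every nontrivial factor an `X`, bring an `X` to `q`, and clear the
rest by CNOTs controlled by `q`. All gates act outside `A`, so labels supported in `A` are
untouched. -/
lemma exists_circuit_to_labelX (A : Finset (Fin n)) {q : Fin n} (hq : q ∉ A) (p : PauliLabel n)
    (hA : ∀ j ∈ A, p j = (false, false)) (hp : p ≠ idLabel n) :
    ∃ w : List (Gate n), w.length ≤ 3 * n ∧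
      (∀ f : PauliLabel n, (∀ j, j ∉ A → f j = (false, false)) → circuitAct w f = f) ∧
      circuitAct w p = labelX q := by
  have hcard : ∀ T : Finset (Fin n), T.card ≤ n := fun T => by
    simpa using Finset.card_le_univ T
  -- One gate per qubit removes the `Z` exponent: `H` turns `Z` into `X`, and `S` turns `XZ` into
  -- `X`.
  obtain ⟨w₁, hl₁, hF₁, -, hR₁, hT₁⟩ := exists_sweep
    {f : PauliLabel n | ∀ j, j ∉ A → f j = (false, false)} (fun _ => True)
    (fun b b' => b'.2 = false ∧ (b ≠ (false, false) → b'.1 = true)) 1 Aᶜ (by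
      intro j hj p _
      have hj' : j ∉ A := Finset.mem_compl.1 hj
      rcases hb : p j with ⟨x, z⟩
      by_cases hz : z = false
      · subst hz
        refine ⟨[], by simp, fun _ _ => rfl, trivial, ?_, fun _ _ => rfl⟩
        simp only [circuitAct, hb]
        cases x <;> simp
      · by_cases hx : x = false
        · refine ⟨[.hadamard j], by simp, fun f hf => act_hadamard_eq (hf j hj'), trivial, ?_,
            fun i hi => by simp [circuitAct, Gate.act, Function.update_of_ne hi]⟩
          cases x <;> cases z <;> simp [circuitAct, Gate.act, hb] at hx hz ⊢
        · refine ⟨[.phase j], by simp, fun f hf => act_phase_eq (by rw [hf j hj']), trivial, ?_,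
            fun i hi => by simp [circuitAct, Gate.act, Function.update_of_ne hi]⟩
          cases x <;> cases z <;> simp_all [circuitAct, Gate.act]) p trivial
  set p₁ := circuitAct w₁ p with hp₁
  have hz₁ : ∀ j, (p₁ j).2 = false := fun j => by
    by_cases hj : j ∈ A
    · rw [hT₁ j (by simpa using hj), hA j hj]
    · exact (hR₁ j (by simpa using hj)).1
  have hA₁ : ∀ j ∈ A, p₁ j = (false, false) := fun j hj => by
    rw [hT₁ j (by simpa using hj), hA j hj]
  -- A CNOT copies `X` from its control to its target, here from some nontrivial qubit `j` to `q`.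
  obtain ⟨w₂, hl₂, hF₂, hq₂, hz₂, hA₂⟩ : ∃ w : List (Gate n), w.length ≤ 1 ∧
      (∀ f : PauliLabel n, (∀ j, j ∉ A → f j = (false, false)) → circuitAct w f = f) ∧
      (circuitAct w p₁ q).1 = true ∧ (∀ j, (circuitAct w p₁ j).2 = false) ∧
      ∀ j ∈ A, circuitAct w p₁ j = (false, false) := by
    by_cases hqx : (p₁ q).1 = true
    · exact ⟨[], by simp, fun _ _ => rfl, hqx, hz₁, hA₁⟩
    · obtain ⟨j, hj⟩ : ∃ j, p j ≠ (false, false) := by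
        by_contra! hall
        exact hp (funext hall)
      have hjA : j ∉ A := fun hjA => hj (hA j hjA)
      have hjx : (p₁ j).1 = true := (hR₁ j (by simpa using hjA)).2 hj
      have hjq : j ≠ q := by rintro rfl; exact hqx hjx
      refine ⟨[.cnot j q hjq], by simp, fun f hf => act_cnot_eq hjq (by rw [hf j hjA])
        (by rw [hf q hq]), ?_, ?_, ?_⟩
      · simp [circuitAct, Gate.act, Function.update_of_ne hjq.symm, hjx, hqx]
      · intro i
        by_cases h1 : i = j
        · subst h1; simp [circuitAct, Gate.act, hz₁]
        · by_cases h2 : i = q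
          · subst h2; simp [circuitAct, Gate.act, Function.update_of_ne h1, hz₁]
          · simp [circuitAct, Gate.act, Function.update_of_ne h1, Function.update_of_ne h2, hz₁]
      · intro i hi
        have h1 : i ≠ j := by rintro rfl; exact hjA hi
        have h2 : i ≠ q := by rintro rfl; exact hq hi
        simp [circuitAct, Gate.act, Function.update_of_ne h1, Function.update_of_ne h2, hA₁ i hi]
  set p₂ := circuitAct w₂ p₁ with hp₂
  -- CNOTs with control `q` cancel the remaining `X` factors.
  obtain ⟨w₃, hl₃, hF₃, hI₃, hR₃, hT₃⟩ := exists_sweep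
    {f : PauliLabel n | ∀ j, j ∉ A → f j = (false, false)}
    (fun p => (p q).1 = true ∧ ∀ j, (p j).2 = false)
    (fun _ b' => b' = (false, false)) 1 (insert q A)ᶜ (by
      rintro j hj p ⟨hpq, hpz⟩
      have hj' : j ∉ A := fun h => by simp [h] at hj
      have hjq : q ≠ j := by rintro rfl; simp at hj
      by_cases hx : (p j).1 = true
      · have hfix : ∀ i, i ≠ j → circuitAct [.cnot q j hjq] p i = p i := by
          intro i hi
          by_cases h1 : i = q
          · subst h1
            simp only [circuitAct, Gate.act, Function.update_self, hpz j, Bool.xor_false]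
          · simp [circuitAct, Gate.act, Function.update_of_ne h1, Function.update_of_ne hi]
        have hjj : circuitAct [.cnot q j hjq] p j = (false, false) := by
          simp [circuitAct, Gate.act, Function.update_of_ne hjq.symm, hx, hpq, hpz j]
        refine ⟨[.cnot q j hjq], by simp, fun f hf => act_cnot_eq hjq (by rw [hf q hq])
          (by rw [hf j hj']), ⟨by rw [hfix q hjq]; exact hpq, fun i => ?_⟩, hjj, hfix⟩
        by_cases hi : i = j
        · rw [hi, hjj]
        · rw [hfix i hi, hpz i]
      · exact ⟨[], by simp, fun _ _ => rfl, ⟨hpq, hpz⟩,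
          Prod.ext (Bool.eq_false_of_not_eq_true hx) (hpz j), fun _ _ => rfl⟩) p₂ ⟨hq₂, hz₂⟩
  refine ⟨w₁ ++ (w₂ ++ w₃), ?_, ?_, ?_⟩
  · have h1 := hcard Aᶜ
    have h3 : (insert q A)ᶜ.card ≤ n - 1 := by
      rw [Finset.card_compl, Finset.card_insert_of_notMem hq, Fintype.card_fin]
      omega
    have : 0 < n := Fin.pos q
    simp only [List.length_append]
    omega
  · intro f hf
    rw [circuitAct_append, circuitAct_append, hF₁ f hf, hF₂ f hf, hF₃ f hf]
  · rw [circuitAct_append, circuitAct_append, ← hp₁, ← hp₂]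
    funext i
    by_cases hi : i = q
    · subst hi
      rw [labelX, Function.update_self]
      exact Prod.ext hI₃.1 (hI₃.2 _)
    · rw [labelX, Function.update_of_ne hi]
      by_cases hiA : i ∈ A
      · rw [hT₃ i (by simp [hiA]), hA₂ i hiA]; rfl
      · exact hR₃ i (by simp [hi, hiA])

/-- The elimination dual to `exists_circuit_to_labelX`, subject to the further condition that `X_q`
stay fixed. So `q` is only acted on by `HSH`, or as the target of CNOTs, which carry `Z` from target
to control. -/
lemma exists_circuit_to_labelZ (A : Finset (Fin n)) {q : Fin n} (hq : q ∉ A) (p : PauliLabel n)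
    (hA : ∀ j ∈ A, p j = (false, false)) (hp : (p q).2 = true) :
    ∃ w : List (Gate n), w.length ≤ 6 * n ∧
      (∀ f : PauliLabel n, (∀ j, j ∉ A → j ≠ q → f j = (false, false)) → (f q).2 = false →
        circuitAct w f = f) ∧
      circuitAct w p = labelZ q := by
  set F : Set (PauliLabel n) :=
    {f | (∀ j, j ∉ A → j ≠ q → f j = (false, false)) ∧ (f q).2 = false} with hF
  obtain ⟨w₁, hl₁, hF₁, hq₁, hT₁⟩ : ∃ w : List (Gate n), w.length ≤ 3 ∧
      (∀ f ∈ F, circuitAct w f = f) ∧ circuitAct w p q = (false, true) ∧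
      ∀ i, i ≠ q → circuitAct w p i = p i := by
    -- `HSH` maps the exponents `(1,1)` to `(0,1)` and fixes those without a `Z` part.
    by_cases hx : (p q).1 = true
    · refine ⟨[.hadamard q, .phase q, .hadamard q], by simp, ?_, ?_, ?_⟩
      · rintro f ⟨-, hf⟩
        simp only [circuitAct, Gate.act, Function.update_self, Function.update_idem, hf]
        simp only [Bool.xor_false]
        rw [← hf, Prod.mk.eta, Function.update_eq_self]
      · simp [circuitAct, Gate.act, hp, hx]
      · intro i hi
        simp [circuitAct, Gate.act, Function.update_of_ne hi]
    · exact ⟨[], by simp, fun _ _ => rfl, Prod.ext (Bool.eq_false_of_not_eq_true hx) hp, fun _ _ => rfl⟩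
  set p₁ := circuitAct w₁ p with hp₁
  have hA₁ : ∀ j ∈ A, p₁ j = (false, false) := fun j hj => by
    rw [hT₁ j (by rintro rfl; exact hq hj), hA j hj]
  obtain ⟨w₂, hl₂, hF₂, hI₂, hR₂, hT₂⟩ := exists_sweep F (fun _ => True)
    (fun _ b' => b'.1 = false) 2 (insert q A)ᶜ (by
      rintro j hj p -
      have hj' : j ∉ A := fun h => by simp [h] at hj
      have hjq : j ≠ q := by rintro rfl; simp at hj
      rcases hb : p j with ⟨x, z⟩
      by_cases hx : x = false
      · exact ⟨[], by simp, fun _ _ => rfl, trivial, by simp [circuitAct, hb, hx],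
          fun _ _ => rfl⟩
      · by_cases hz : z = false
        · refine ⟨[.hadamard j], by simp, fun f hf => act_hadamard_eq (hf.1 j hj' hjq), trivial,
            by simp [circuitAct, Gate.act, hb, hz],
            fun i hi => by simp [circuitAct, Gate.act, Function.update_of_ne hi]⟩
        · refine ⟨[.phase j, .hadamard j], by simp, fun f hf => ?_, trivial, ?_,
            fun i hi => by simp [circuitAct, Gate.act, Function.update_of_ne hi]⟩
          · have h0 := hf.1 j hj' hjq
            rw [circuitAct, act_phase_eq (by rw [h0]), circuitAct, act_hadamard_eq h0, circuitAct]
          · cases x <;> cases z <;> simp_all [circuitAct, Gate.act]) p₁ trivial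
  set p₂ := circuitAct w₂ p₁ with hp₂
  have hq₂ : p₂ q = (false, true) := by rw [hT₂ q (by simp), hq₁]
  have hA₂ : ∀ j ∈ A, p₂ j = (false, false) := fun j hj => by
    rw [hT₂ j (by simp [hj]), hA₁ j hj]
  have hx₂ : ∀ j, (p₂ j).1 = false := fun j => by
    by_cases h1 : j = q
    · rw [h1, hq₂]
    · by_cases hj : j ∈ A
      · rw [hA₂ j hj]
      · exact hR₂ j (by simp [h1, hj])
  obtain ⟨w₃, hl₃, hF₃, hI₃, hR₃, hT₃⟩ := exists_sweep F
    (fun p => (p q).2 = true ∧ ∀ j, (p j).1 = false)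
    (fun _ b' => b' = (false, false)) 1 (insert q A)ᶜ (by
      rintro j hj p ⟨hpq, hpx⟩
      have hj' : j ∉ A := fun h => by simp [h] at hj
      have hjq : j ≠ q := by rintro rfl; simp at hj
      by_cases hz : (p j).2 = true
      · have hfix : ∀ i, i ≠ j → circuitAct [.cnot j q hjq] p i = p i := by
          intro i hi
          by_cases h1 : i = q
          · subst h1
            simp only [circuitAct, Gate.act, Function.update_of_ne hi, Function.update_self, hpx j,
              Bool.xor_false]
          · simp [circuitAct, Gate.act, Function.update_of_ne h1, Function.update_of_ne hi]
        have hjj : circuitAct [.cnot j q hjq] p j = (false, false) := by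
          simp [circuitAct, Gate.act, hz, hpq, hpx j]
        refine ⟨[.cnot j q hjq], by simp, fun f hf => act_cnot_eq hjq (by rw [hf.1 j hj' hjq])
          hf.2, ⟨by rw [hfix q hjq.symm]; exact hpq, fun i => ?_⟩, hjj, hfix⟩
        by_cases hi : i = j
        · rw [hi, hjj]
        · rw [hfix i hi, hpx i]
      · exact ⟨[], by simp, fun _ _ => rfl, ⟨hpq, hpx⟩,
          Prod.ext (hpx j) (Bool.eq_false_of_not_eq_true hz), fun _ _ => rfl⟩) p₂ ⟨by rw [hq₂], hx₂⟩
  refine ⟨w₁ ++ (w₂ ++ w₃), ?_, ?_, ?_⟩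
  · have h3 : (insert q A)ᶜ.card ≤ n - 1 := by
      rw [Finset.card_compl, Finset.card_insert_of_notMem hq, Fintype.card_fin]
      omega
    have : 0 < n := Fin.pos q
    simp only [List.length_append]
    omega
  · intro f hf hf'
    rw [circuitAct_append, circuitAct_append, hF₁ f ⟨hf, hf'⟩, hF₂ f ⟨hf, hf'⟩, hF₃ f ⟨hf, hf'⟩]
  · rw [circuitAct_append, circuitAct_append, ← hp₁, ← hp₂]
    funext i
    by_cases hi : i = q
    · subst hi
      rw [labelZ, Function.update_self]
      exact Prod.ext (hI₃.2 _) hI₃.1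
    · rw [labelZ, Function.update_of_ne hi]
      by_cases hiA : i ∈ A
      · rw [hT₃ i (by simp [hiA]), hA₂ i hiA]; rfl
      · exact hR₃ i (by simp [hi, hiA])

lemma labelX_of_ne {q j : Fin n} (h : j ≠ q) : labelX q j = (false, false) := by
  rw [labelX, Function.update_of_ne h]; rfl

lemma labelZ_of_ne {q j : Fin n} (h : j ≠ q) : labelZ q j = (false, false) := by
  rw [labelZ, Function.update_of_ne h]; rfl

/-- Induction on the set of qubits whose `X_j`, `Z_j` are already restored. Adding a qubit costs
`3n` gates for `X_q` and `6n` for `Z_q`. -/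
lemma exists_circuit_undo_on (w : List (Gate n)) (A : Finset (Fin n)) :
    ∃ w' : List (Gate n), w'.length ≤ 9 * n * A.card ∧
      ∀ j ∈ A, circuitAct w' (circuitAct w (labelX j)) = labelX j ∧
        circuitAct w' (circuitAct w (labelZ j)) = labelZ j := by
  induction A using Finset.induction_on with
  | empty => exact ⟨[], by simp, by simp⟩
  | insert q A hq ih =>
    obtain ⟨w', hl, hw⟩ := ih
    set g : PauliLabel n → PauliLabel n := fun p => circuitAct w' (circuitAct w p) with hg
    have hsign : ∀ p p', commSign (g p) (g p') = commSign p p' := fun p p' => by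
      simp only [hg, commSign_circuitAct]
    -- A label that is trivial on `A` commutes with `X_j` and `Z_j` for `j ∈ A`. These are fixed by
    -- `g`, so its image commutes with them too and is again trivial on `A`.
    have hzero : ∀ p : PauliLabel n, (∀ j ∈ A, p j = (false, false)) →
        ∀ j ∈ A, g p j = (false, false) := by
      intro p hp j hj
      have h1 := hsign p (labelX j)
      have h2 := hsign p (labelZ j)
      rw [show g (labelX j) = labelX j from (hw j hj).1, commSign_labelX, commSign_labelX,
        hp j hj] at h1
      rw [show g (labelZ j) = labelZ j from (hw j hj).2, commSign_labelZ, commSign_labelZ,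
        hp j hj] at h2
      exact Prod.ext (sgn_injective h2) (sgn_injective h1)
    have hne : ∀ j ∈ A, j ≠ q := fun j hj h => hq (h ▸ hj)
    have hX := hzero (labelX q) fun j hj => labelX_of_ne (hne j hj)
    have hZ := hzero (labelZ q) fun j hj => labelZ_of_ne (hne j hj)
    -- The image of `X_q` anticommutes with that of `Z_q`, so it is not the identity.
    have hXne : g (labelX q) ≠ idLabel n := by
      intro h0
      have := hsign (labelX q) (labelZ q)
      rw [h0, commSign_labelZ] at this
      have h1 : commSign (idLabel n) (g (labelZ q)) = 1 := by simp [commSign, idLabel]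
      rw [h1] at this
      norm_num [labelX] at this
    obtain ⟨w₁, hl₁, hF₁, h₁⟩ := exists_circuit_to_labelX A hq _ hX hXne
    have hfix₁ : ∀ f : PauliLabel n, (∀ j, j ∉ A → f j = (false, false)) →
        circuitAct w₁ f = f := hF₁
    have hZ₁ : ∀ j ∈ A, circuitAct w₁ (g (labelZ q)) j = (false, false) := by
      intro j hj
      have hfx : circuitAct w₁ (labelX j) = labelX j :=
        hfix₁ _ fun i hi => labelX_of_ne (by rintro rfl; exact hi hj)
      have hfz : circuitAct w₁ (labelZ j) = labelZ j :=
        hfix₁ _ fun i hi => labelZ_of_ne (by rintro rfl; exact hi hj)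
      have h1 := commSign_circuitAct w₁ (g (labelZ q)) (labelX j)
      have h2 := commSign_circuitAct w₁ (g (labelZ q)) (labelZ j)
      rw [hfx, commSign_labelX, commSign_labelX, hZ j hj] at h1
      rw [hfz, commSign_labelZ, commSign_labelZ, hZ j hj] at h2
      exact Prod.ext (sgn_injective h2) (sgn_injective h1)
    -- The image of `Z_q` anticommutes with `X_q`, which forces a `Z` at `q`.
    have hq₁ : (circuitAct w₁ (g (labelZ q)) q).2 = true := by
      have h1 := commSign_circuitAct w₁ (g (labelZ q)) (g (labelX q))
      rw [h₁, commSign_labelX, hsign, commSign_labelX] at h1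
      have h2 := sgn_injective h1
      rw [h2]; simp [labelZ]
    obtain ⟨w₂, hl₂, hF₂, h₂⟩ := exists_circuit_to_labelZ A hq _ hZ₁ hq₁
    refine ⟨w' ++ (w₁ ++ w₂), ?_, ?_⟩
    · rw [Finset.card_insert_of_notMem hq]
      simp only [List.length_append]
      rw [mul_add, mul_one]
      omega
    · intro j hj
      simp only [circuitAct_append]
      rcases Finset.mem_insert.1 hj with rfl | hj
      · refine ⟨?_, h₂⟩
        rw [show circuitAct w' (circuitAct w (labelX j)) = g (labelX j) from rfl, h₁]
        exact hF₂ _ (fun i _ hi => labelX_of_ne hi) (by simp [labelX])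
      · rw [(hw j hj).1, (hw j hj).2,
          hF₁ _ fun i hi => labelX_of_ne (by rintro rfl; exact hi hj),
          hF₁ _ fun i hi => labelZ_of_ne (by rintro rfl; exact hi hj)]
        exact ⟨hF₂ _ (fun i hi _ => labelX_of_ne (by rintro rfl; exact hi hj))
            (by rw [labelX_of_ne (hne j hj).symm]),
          hF₂ _ (fun i hi _ => labelZ_of_ne (by rintro rfl; exact hi hj))
            (by rw [labelZ_of_ne (hne j hj).symm])⟩

/-- Once all `X_q` and `Z_q` are restored, every label has its original commutation signs and is
therefore restored as well. -/
lemma exists_circuit_undo (w : List (Gate n)) :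
    ∃ w' : List (Gate n), w'.length ≤ 9 * n ^ 2 ∧ ∀ p, circuitAct (w ++ w') p = p := by
  obtain ⟨w', hl, hw⟩ := exists_circuit_undo_on w Finset.univ
  refine ⟨w', by simpa [sq, mul_assoc] using hl, fun p => ?_⟩
  refine eq_of_commSign_eq (fun q => ?_) fun q => ?_
  · have := commSign_circuitAct (w ++ w') p (labelX q)
    rw [circuitAct_append w w' (labelX q), (hw q (Finset.mem_univ q)).1] at this
    exact this
  · have := commSign_circuitAct (w ++ w') p (labelZ q)
    rw [circuitAct_append w w' (labelZ q), (hw q (Finset.mem_univ q)).2] at this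
    exact this

/-! ### Circuits for Pauli operators and global phases -/

/-- The single-qubit Pauli operator `X ^ x Z ^ z`. -/
def pauliMatrix (b : Bool × Bool) : Matrix Bool Bool ℂ :=
  Matrix.of fun u v => if u = xor v b.1 then sgn (b.2 && v) else 0

lemma onQubit_mul_pauli (q : Fin n) (b : Bool × Bool) (p : PauliLabel n)
    (hp : p q = (false, false)) :
    onQubit q (pauliMatrix b) * pauli p = pauli (Function.update p q b) := by
  ext u v
  rw [mul_pauli_apply]
  simp only [onQubit, pauliMatrix, pauli, Matrix.of_apply]
  have key : u = flipBits (Function.update p q b) v ↔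
      (∀ l, l ≠ q → u l = flipBits p v l) ∧ u q = xor (flipBits p v q) b.1 := by
    constructor
    · rintro rfl
      refine ⟨fun l hl => by simp [flipBits, Function.update_of_ne hl], by simp [flipBits, hp]⟩
    · rintro ⟨h1, h2⟩
      refine eq_of_agree (q := q) (fun l hl => ?_) ?_
      · rw [h1 l hl]; simp [flipBits, Function.update_of_ne hl]
      · rw [h2]; simp [flipBits, hp]
  by_cases h : u = flipBits (Function.update p q b) v
  · obtain ⟨h1, h2⟩ := key.1 h
    rw [if_pos h1, if_pos h2, if_pos h, pauliSign, pauliSign,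
      ← Finset.mul_prod_erase _ _ (Finset.mem_univ q),
      ← Finset.mul_prod_erase _ _ (Finset.mem_univ q), ← mul_assoc]
    congr 1
    · simp [flipBits, hp]
    · refine Finset.prod_congr rfl fun l hl => ?_
      rw [Function.update_of_ne (Finset.ne_of_mem_erase hl)]
  · rw [if_neg h]
    by_cases h1 : ∀ l, l ≠ q → u l = flipBits p v l
    · rw [if_pos h1, if_neg fun h2 => h (key.2 ⟨h1, h2⟩), zero_mul]
    · rw [if_neg h1, zero_mul]

lemma phaseMatrix_sq : phaseMatrix * phaseMatrix = pauliMatrix (false, true) := by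
  ext a b
  cases a <;> cases b <;> simp [phaseMatrix, pauliMatrix]

lemma hadamardMatrix_conj_Z :
    hadamardMatrix * (pauliMatrix (false, true) * hadamardMatrix) = pauliMatrix (true, false) := by
  have h := inv_sqrt_two_sq
  ext a b
  simp only [Matrix.mul_apply, Fintype.sum_bool, hadamardMatrix, pauliMatrix, Matrix.of_apply]
  generalize ((1 / Real.sqrt 2 : ℝ) : ℂ) = s at h
  cases a <;> cases b <;> simp <;> linear_combination 2 * h

lemma pauliMatrix_X_mul_Z :
    pauliMatrix (true, false) * pauliMatrix (false, true) = pauliMatrix (true, true) := by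
  ext a b
  cases a <;> cases b <;> simp [pauliMatrix, Matrix.mul_apply]

lemma exists_circuit_pauliMatrix (q : Fin n) (b : Bool × Bool) :
    ∃ w : List (Gate n), w.length ≤ 6 ∧ circuitMatrix w = onQubit q (pauliMatrix b) := by
  obtain ⟨x, z⟩ := b
  cases x <;> cases z
  · refine ⟨[], by simp, ?_⟩
    have : pauliMatrix (false, false) = 1 := by
      ext a b
      cases a <;> cases b <;> simp [pauliMatrix]
    rw [this, onQubit_one]; rfl
  · exact ⟨[.phase q, .phase q], by simp,
      by simp [circuitMatrix, phase_eq, onQubit_mul, phaseMatrix_sq]⟩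
  · refine ⟨[.hadamard q, .phase q, .phase q, .hadamard q], by simp, ?_⟩
    simp only [circuitMatrix, phase_eq, hadamard_eq, onQubit_mul, Matrix.one_mul]
    rw [Matrix.mul_assoc, Matrix.mul_assoc, ← Matrix.mul_assoc phaseMatrix, phaseMatrix_sq,
      hadamardMatrix_conj_Z]
  · refine ⟨[.phase q, .phase q, .hadamard q, .phase q, .phase q, .hadamard q], by simp, ?_⟩
    simp only [circuitMatrix, phase_eq, hadamard_eq, onQubit_mul, Matrix.one_mul]
    rw [Matrix.mul_assoc, phaseMatrix_sq, Matrix.mul_assoc hadamardMatrix, phaseMatrix_sq,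
      Matrix.mul_assoc hadamardMatrix, hadamardMatrix_conj_Z, pauliMatrix_X_mul_Z]

lemma pauli_idLabel : pauli (idLabel n) = 1 := by
  ext u v
  have : flipBits (idLabel n) v = v := by ext l; simp [flipBits, idLabel]
  simp [pauli, this, Matrix.one_apply]
  simp [pauliSign, idLabel]

lemma exists_circuit_pauli (p : PauliLabel n) :
    ∃ w : List (Gate n), w.length ≤ 6 * n ∧ circuitMatrix w = pauli p := by
  have key : ∀ A : Finset (Fin n), ∃ w : List (Gate n), w.length ≤ 6 * A.card ∧
      circuitMatrix w = pauli fun j => if j ∈ A then p j else (false, false) := by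
    intro A
    induction A using Finset.induction_on with
    | empty => exact ⟨[], by simp, by
      rw [circuitMatrix, ← pauli_idLabel]; congr 1⟩
    | insert q A hq ih =>
      obtain ⟨w, hl, hw⟩ := ih
      obtain ⟨w', hl', hw'⟩ := exists_circuit_pauliMatrix q (p q)
      refine ⟨w ++ w', ?_, ?_⟩
      · rw [List.length_append, Finset.card_insert_of_notMem hq]; omega
      · rw [circuitMatrix_append, hw, hw', onQubit_mul_pauli _ _ _ (by simp [hq])]
        congr 1
        funext j
        by_cases hj : j = q
        · subst hj; simp
        · simp [hj]
  obtain ⟨w, hl, hw⟩ := key Finset.univ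
  exact ⟨w, by simpa using hl, by simpa using hw⟩

lemma pauliSign_labelZ (q : Fin n) (u : Qubits n) : pauliSign (labelZ q) u = sgn (u q) := by
  rw [pauliSign, Finset.prod_eq_single q]
  · simp [labelZ]
  · intro l _ hl; simp [labelZ_of_ne hl]
  · simp

lemma flipBits_labelZ (q : Fin n) (u : Qubits n) : flipBits (labelZ q) u = u := by
  ext l
  by_cases hl : l = q
  · subst hl; simp [flipBits, labelZ]
  · simp [flipBits, labelZ_of_ne hl]

lemma pauliSign_labelX (q : Fin n) (u : Qubits n) : pauliSign (labelX q) u = 1 := by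
  refine Finset.prod_eq_one fun l _ => ?_
  by_cases hl : l = q
  · subst hl; simp [labelX]
  · simp [labelX_of_ne hl]

lemma flipBits_labelX (q : Fin n) (u : Qubits n) :
    flipBits (labelX q) u = Function.update u q (!(u q)) := by
  ext l
  by_cases hl : l = q
  · subst hl; simp [flipBits, labelX]
  · simp [flipBits, labelX_of_ne hl, Function.update_of_ne hl]

/-- A unitary that commutes with all Pauli operators up to phase is a multiple of one. -/
lemma exists_eq_smul_pauli {U : Matrix (Qubits n) (Qubits n) ℂ} (hU : Uᴴ * U = 1)
    (h : ∀ p, Conjugates U p p) : ∃ (c : ℂ) (p : PauliLabel n), U = c • pauli p := by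
  have hU0 : U ≠ 0 := by
    rintro rfl
    simp only [Matrix.mul_zero] at hU
    exact zero_ne_one hU
  obtain ⟨u₀, v₀, h₀⟩ : ∃ u v, U u v ≠ 0 := by
    by_contra! hall
    exact hU0 (by ext u v; exact hall u v)
  -- commutation with `Z` operators
  have hsupp : ∀ u v, U u v ≠ 0 → ∀ q, xor (u q) (v q) = xor (u₀ q) (v₀ q) := by
    intro u v huv q
    obtain ⟨c, -, hc⟩ := h (labelZ q)
    have e : ∀ u v, U u v ≠ 0 → sgn (xor (u q) (v q)) = c := by
      intro u v huv
      have := congrFun (congrFun hc u) v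
      rw [Matrix.smul_apply, mul_pauli_apply, pauli_mul_apply, flipBits_labelZ, flipBits_labelZ,
        pauliSign_labelZ, pauliSign_labelZ, smul_eq_mul] at this
      rw [sgn_xor]
      have h2 : (sgn (u q) * sgn (v q) - c) * U u v = 0 := by
        linear_combination sgn (u q) * this + c * U u v * sgn_mul_self (u q)
      exact sub_eq_zero.1 ((mul_eq_zero.1 h2).resolve_right huv)
    exact sgn_injective ((e u v huv).trans (e u₀ v₀ h₀).symm)
  -- commutation with `X` operators
  have hX : ∀ q, ∃ s : Bool, ∀ u v,
      U (flipBits (labelX q) u) (flipBits (labelX q) v) = sgn s * U u v := by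
    intro q
    obtain ⟨c, hcn, hc⟩ := h (labelX q)
    have e : ∀ u v, U u v = c * U (flipBits (labelX q) u) (flipBits (labelX q) v) := by
      intro u v
      have := congrFun (congrFun hc u) (flipBits (labelX q) v)
      rw [Matrix.smul_apply, mul_pauli_apply, pauli_mul_apply, flipBits_flipBits,
        pauliSign_labelX, pauliSign_labelX, smul_eq_mul, mul_one, one_mul] at this
      exact this
    -- Flipping the bit twice returns to the same entry, and the entry at `(u₀, v₀)` is nonzero.
    have hc2 : c * c = 1 := by
      have h1 := e (flipBits (labelX q) u₀) (flipBits (labelX q) v₀)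
      rw [flipBits_flipBits, flipBits_flipBits] at h1
      have h2 := e u₀ v₀
      rw [h1] at h2
      have h3 : (c * c - 1) * U u₀ v₀ = 0 := by linear_combination -h2
      exact sub_eq_zero.1 ((mul_eq_zero.1 h3).resolve_right h₀)
    rcases mul_self_eq_one_iff.1 hc2 with h1 | h1
    · exact ⟨false, fun u v => by rw [e u v, h1]; simp⟩
    · exact ⟨true, fun u v => by rw [e u v, h1]; simp⟩
  choose s hs using hX
  -- The `X` exponents are the common difference of row and column at nonzero entries; the `Z`
  -- exponents are the signs under simultaneous flips.
  set p : PauliLabel n := fun q => (xor (u₀ q) (v₀ q), s q) with hp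
  set d : Qubits n → ℂ := fun v => U (flipBits p v) v with hd
  have hstep : ∀ q v, d (Function.update v q (!(v q))) = sgn (s q) * d v := by
    intro q v
    have hcomm : flipBits p (Function.update v q (!(v q))) =
        flipBits (labelX q) (flipBits p v) := by
      rw [flipBits_labelX]
      ext l
      by_cases hl : l = q
      · subst hl; simp [flipBits]
      · simp [flipBits, Function.update_of_ne hl]
    simp only [hd]
    rw [hcomm, ← flipBits_labelX, hs]
  -- Starting from the zero string, each bit that is set multiplies the entry by the sign of that
  -- qubit.
  have hd_all : ∀ (A : Finset (Fin n)) (v : Qubits n), (∀ q, q ∉ A → v q = false) →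
      d v = pauliSign p v * d fun _ => false := by
    intro A
    induction A using Finset.induction_on with
    | empty =>
      intro v hv
      have : v = fun _ => false := funext fun q => hv q (by simp)
      subst this
      simp [pauliSign]
    | insert a A ha ih =>
      intro v hv
      by_cases hva : v a = false
      · refine ih v fun q hq => ?_
        by_cases hqa : q = a
        · rw [hqa, hva]
        · exact hv q (by simp [hq, hqa])
      · have h1 := ih (Function.update v a false) fun q hq => by
          by_cases hqa : q = a
          · subst hqa; simp
          · rw [Function.update_of_ne hqa]; exact hv q (by simp [hq, hqa])
        have h2 := hstep a (Function.update v a false)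
        have h3 : Function.update (Function.update v a false) a
            (!(Function.update v a false a)) = v := by
          ext l
          by_cases hl : l = a
          · subst hl; simpa using hva
          · simp [Function.update_of_ne hl]
        rw [h3, h1] at h2
        rw [h2, pauliSign, pauliSign, ← Finset.mul_prod_erase _ _ (Finset.mem_univ a),
          ← Finset.mul_prod_erase _ _ (Finset.mem_univ a), Function.update_self]
        have h4 : ∏ x ∈ Finset.univ.erase a, sgn ((p x).2 && Function.update v a false x) =
            ∏ x ∈ Finset.univ.erase a, sgn ((p x).2 && v x) :=
          Finset.prod_congr rfl fun l hl => by
            rw [Function.update_of_ne (Finset.ne_of_mem_erase hl)]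
        rw [h4]
        have hva' : v a = true := by simpa using hva
        simp [hva', hp, mul_assoc]
  refine ⟨d fun _ => false, p, ?_⟩
  ext u v
  simp only [Matrix.smul_apply, pauli, Matrix.of_apply, smul_eq_mul]
  by_cases huv : u = flipBits p v
  · rw [if_pos huv, huv]
    have := hd_all Finset.univ v (by simp)
    rw [mul_comm, ← this]
  · rw [if_neg huv, mul_zero]
    by_contra hne
    apply huv
    ext l
    have := hsupp u v hne l
    simp only [flipBits, hp, ← this]
    generalize u l = a, v l = b
    revert a b; decide

/-- The eighth root of unity `(1 + i) / √2`. -/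
noncomputable def omega8 : ℂ := ((1 / Real.sqrt 2 : ℝ) : ℂ) * (1 + Complex.I)

lemma omega8_sq : omega8 ^ 2 = Complex.I := by
  have h := inv_sqrt_two_sq
  have hI := Complex.I_mul_I
  rw [omega8]
  linear_combination (1 + Complex.I) ^ 2 * h + (1 / 2) * hI

lemma omega8_pow_four : omega8 ^ 4 = -1 := by
  rw [show (4 : ℕ) = 2 * 2 from rfl, pow_mul, omega8_sq, Complex.I_sq]

lemma isPrimitiveRoot_omega8 : IsPrimitiveRoot omega8 8 := by
  have h : orderOf omega8 = 2 ^ (2 + 1) := by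
    refine orderOf_eq_prime_pow ?_ ?_
    · norm_num [omega8_pow_four]
    · rw [show (2 : ℕ) ^ (2 + 1) = 4 * 2 from rfl, pow_mul, omega8_pow_four]; norm_num
  rw [show (8 : ℕ) = 2 ^ (2 + 1) from rfl, ← h]
  exact IsPrimitiveRoot.orderOf omega8

lemma inv_sqrt_two_eq_omega8 :
    ((1 / Real.sqrt 2 : ℝ) : ℂ) = (omega8 - omega8 ^ 3) / 2 := by
  have hI := Complex.I_mul_I
  rw [show omega8 ^ 3 = omega8 ^ 2 * omega8 by ring, omega8_sq, omega8]
  linear_combination (((1 / Real.sqrt 2 : ℝ) : ℂ) / 2) * hI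

-- With `i = ω²` and `1/√2 = (ω - ω³)/2`, all gates have entries in `ℚ(ω)`. This bounds the degree
-- of any scalar that a circuit implements.
open IntermediateField in
lemma circuitMatrix_mem_adjoin (w : List (Gate n)) (u v : Qubits n) :
    circuitMatrix w u v ∈ (ℚ⟮omega8⟯ : IntermediateField ℚ ℂ) := by
  have hω : omega8 ∈ (ℚ⟮omega8⟯ : IntermediateField ℚ ℂ) := mem_adjoin_simple_self ℚ _
  have hI : Complex.I ∈ (ℚ⟮omega8⟯ : IntermediateField ℚ ℂ) := by
    rw [← omega8_sq]; exact pow_mem hω 2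
  have hr : ((1 / Real.sqrt 2 : ℝ) : ℂ) ∈ (ℚ⟮omega8⟯ : IntermediateField ℚ ℂ) := by
    rw [inv_sqrt_two_eq_omega8]
    exact div_mem (sub_mem hω (pow_mem hω 3)) (ofNat_mem _ 2)
  have hG : ∀ (G : Gate n) (u v : Qubits n),
      G.matrix u v ∈ (ℚ⟮omega8⟯ : IntermediateField ℚ ℂ) := by
    intro G u v
    cases G with
    | hadamard q =>
      simp only [Gate.matrix, Matrix.of_apply]
      split_ifs
      · exact mul_mem hr (neg_mem (one_mem _))
      · exact mul_mem hr (one_mem _)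
      · exact zero_mem _
    | phase q =>
      simp only [Gate.matrix, Matrix.diagonal_apply]
      split_ifs
      · exact hI
      · exact one_mem _
      · exact zero_mem _
    | cnot c t h =>
      rw [cnot_apply]
      split_ifs
      · exact one_mem _
      · exact zero_mem _
  induction w generalizing u v with
  | nil =>
    simp only [circuitMatrix, Matrix.one_apply]
    split_ifs
    · exact one_mem _
    · exact zero_mem _
  | cons G w ih =>
    rw [circuitMatrix, Matrix.mul_apply]
    exact sum_mem fun y _ => mul_mem (ih u y) (hG G y v)

/-- Every gate has fourth power one. Through determinants this makes scalar circuits roots of unity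
of order a power of two. -/
lemma Gate.det_pow_four (G : Gate n) : G.matrix.det ^ 4 = 1 := by
  have key : G.matrix * G.matrix * G.matrix * G.matrix = 1 := by
    cases G with
    | hadamard q =>
      rw [hadamard_eq, onQubit_mul, hadamardMatrix_mul_self, onQubit_mul, onQubit_mul,
        Matrix.one_mul, hadamardMatrix_mul_self, onQubit_one]
    | phase q => rw [phase_eq, onQubit_mul, onQubit_mul, onQubit_mul, phaseMatrix_pow, onQubit_one]
    | cnot c t h => rw [cnot_mul_self, Matrix.one_mul, cnot_mul_self]
  have := congrArg Matrix.det key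
  simp only [Matrix.det_mul, Matrix.det_one] at this
  rw [← this]; ring

lemma det_circuitMatrix_pow_four (w : List (Gate n)) : (circuitMatrix w).det ^ 4 = 1 := by
  induction w with
  | nil => simp [circuitMatrix]
  | cons G w ih => rw [circuitMatrix, Matrix.det_mul, mul_pow, ih, G.det_pow_four, one_mul]

open IntermediateField in
/-- The global phases in the Clifford group are eighth roots of unity. -/
lemma phase_pow_eight {c : ℂ} {w : List (Gate n)} (h : circuitMatrix w = c • 1) : c ^ 8 = 1 := by
  have hmem : c ∈ (ℚ⟮omega8⟯ : IntermediateField ℚ ℂ) := by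
    have := circuitMatrix_mem_adjoin w (fun _ => false) (fun _ => false)
    rw [h] at this
    simpa using this
  -- `det (c • 1) = c^(2^n)`, and its fourth power is one.
  have hpow : c ^ 2 ^ (n + 2) = 1 := by
    have := det_circuitMatrix_pow_four w
    rw [h, Matrix.det_smul, Matrix.det_one, mul_one, ← pow_mul] at this
    simpa [pow_add] using this
  obtain ⟨j, -, hj⟩ := (Nat.dvd_prime_pow Nat.prime_two).1 (orderOf_dvd_of_pow_eq_one hpow)
  have hprim : IsPrimitiveRoot c (2 ^ j) := hj ▸ IsPrimitiveRoot.orderOf c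
  have hint : IsIntegral ℚ omega8 :=
    (isPrimitiveRoot_omega8.isIntegral (by norm_num)).tower_top
  have : FiniteDimensional ℚ (ℚ⟮omega8⟯ : IntermediateField ℚ ℂ) :=
    adjoin.finiteDimensional hint
  have hdeg : Module.finrank ℚ (ℚ⟮omega8⟯ : IntermediateField ℚ ℂ) = 4 := by
    rw [adjoin.finrank hint, ← Polynomial.cyclotomic_eq_minpoly_rat isPrimitiveRoot_omega8
      (by norm_num), Polynomial.natDegree_cyclotomic]
    decide
  have hle : (minpoly ℚ c).natDegree ≤ 4 := by
    rw [← hdeg, ← minpoly_eq (⟨c, hmem⟩ : (ℚ⟮omega8⟯ : IntermediateField ℚ ℂ))]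
    exact minpoly.natDegree_le _
  rw [← Polynomial.cyclotomic_eq_minpoly_rat hprim (by positivity),
    Polynomial.natDegree_cyclotomic] at hle
  -- An element of order `2^j` has degree `φ(2^j)` over `ℚ`, which is `2^(j-1)` for `j ≥ 1` and
  -- exceeds `[ℚ(ω) : ℚ] = 4` once `j ≥ 4`.
  have hj3 : j ≤ 3 := by
    by_contra! hlt
    rw [Nat.totient_prime_pow Nat.prime_two (by omega)] at hle
    have : 2 ^ 3 ≤ 2 ^ (j - 1) := Nat.pow_le_pow_right (by norm_num) (by omega)
    omega
  have : c ^ 2 ^ j = 1 := hprim.pow_eq_one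
  rw [show (8 : ℕ) = 2 ^ j * 2 ^ (3 - j) by rw [← pow_add]; norm_num [Nat.add_sub_cancel' hj3],
    pow_mul, this, one_pow]

/-- The identity `(S H)³ = ω`. -/
lemma exists_circuit_omega8 (q : Fin n) :
    ∃ w : List (Gate n), w.length ≤ 6 ∧ circuitMatrix w = omega8 • 1 := by
  refine ⟨[.hadamard q, .phase q, .hadamard q, .phase q, .hadamard q, .phase q], by simp, ?_⟩
  simp only [circuitMatrix, phase_eq, hadamard_eq, onQubit_mul, Matrix.one_mul]
  rw [← onQubit_one q, ← onQubit_smul]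
  congr 1
  have e1 : phaseMatrix * hadamardMatrix * phaseMatrix = Matrix.of fun a b =>
      ((1 / Real.sqrt 2 : ℝ) : ℂ) * (if a = b then 1 else Complex.I) := by
    ext a b
    simp only [phaseMatrix, hadamardMatrix, Matrix.diagonal_mul, Matrix.mul_diagonal]
    cases a <;> cases b <;> simp [mul_comm, mul_left_comm]
    linear_combination (-(Real.sqrt 2 : ℂ)⁻¹) * Complex.I_mul_I
  have e2 : hadamardMatrix * phaseMatrix * hadamardMatrix = Matrix.of fun a b =>
      (1 / 2 : ℂ) * (if a = b then 1 + Complex.I else 1 - Complex.I) := by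
    have h := inv_sqrt_two_sq
    ext a b
    simp only [phaseMatrix, hadamardMatrix, Matrix.mul_apply, Fintype.sum_bool,
      Matrix.of_apply]
    generalize ((1 / Real.sqrt 2 : ℝ) : ℂ) = s at h
    cases a <;> cases b <;> simp
    · linear_combination (1 + Complex.I) * h
    · linear_combination (1 - Complex.I) * h
    · linear_combination (1 - Complex.I) * h
    · linear_combination (1 + Complex.I) * h
  have e3 : phaseMatrix * hadamardMatrix * phaseMatrix * hadamardMatrix * phaseMatrix *
      hadamardMatrix = (phaseMatrix * hadamardMatrix * phaseMatrix) *
        (hadamardMatrix * phaseMatrix * hadamardMatrix) := by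
    simp only [Matrix.mul_assoc]
  have hI := Complex.I_mul_I
  rw [e3, e1, e2]
  ext a b
  simp only [Matrix.mul_apply, Fintype.sum_bool, Matrix.of_apply, omega8, Matrix.smul_apply,
    smul_eq_mul]
  generalize ((1 / Real.sqrt 2 : ℝ) : ℂ) = s
  cases a <;> cases b <;> simp
  · linear_combination (-s / 2) * hI
  · linear_combination (s / 2) * hI
  · linear_combination (s / 2) * hI
  · linear_combination (-s / 2) * hI

lemma exists_circuit_omega8_pow (q : Fin n) (i : ℕ) :
    ∃ w : List (Gate n), w.length ≤ 6 * i ∧ circuitMatrix w = omega8 ^ i • 1 := by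
  induction i with
  | zero => exact ⟨[], by simp, by simp [circuitMatrix]⟩
  | succ i ih =>
    obtain ⟨w, hl, hw⟩ := ih
    obtain ⟨w', hl', hw'⟩ := exists_circuit_omega8 q
    refine ⟨w ++ w', ?_, ?_⟩
    · rw [List.length_append]; omega
    · rw [circuitMatrix_append, hw, hw', Matrix.smul_mul, Matrix.one_mul, smul_smul, pow_succ']

/-- Every Clifford unitary has a circuit with `O(n ^ 2)` gates. -/
lemma exists_short_circuit (hn : 1 ≤ n) (w : List (Gate n)) :
    ∃ w' : List (Gate n), w'.length ≤ 81 * n ^ 2 ∧ circuitMatrix w' = circuitMatrix w := by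
  obtain ⟨w₁, hl₁, hw₁⟩ := exists_circuit_undo w
  obtain ⟨c, p, hp⟩ := exists_eq_smul_pauli (circuitMatrix_conjTranspose_mul (w ++ w₁))
    fun p => by
      have := circuit_conjugates (w ++ w₁) p
      rwa [hw₁] at this
  obtain ⟨w₂, hl₂, hw₂⟩ := exists_circuit_pauli p
  obtain ⟨w₁', hl₁', hw₁'⟩ := exists_inverse_circuit w₁
  obtain ⟨w₂', hl₂', hw₂'⟩ := exists_inverse_circuit w₂
  -- Appending the elimination circuit `w₁` leaves a Pauli operator up to phase; cancelling that
  -- operator leaves a scalar implemented by a circuit, to which `phase_pow_eight` applies.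
  have hc : circuitMatrix ((w ++ w₁) ++ w₂') = c • 1 := by
    rw [circuitMatrix_append, hp, Matrix.mul_smul, ← hw₂, hw₂']
  obtain ⟨i, hi, hic⟩ := isPrimitiveRoot_omega8.eq_pow_of_pow_eq_one (phase_pow_eight hc)
  obtain ⟨w₃, hl₃, hw₃⟩ := exists_circuit_omega8_pow (⟨0, hn⟩ : Fin n) i
  refine ⟨w₃ ++ (w₂ ++ w₁'), ?_, ?_⟩
  -- The phase takes at most `6 · 7` gates, the Pauli operator `6n`, and the inverse of `w₁` takes
  -- `3 · 9n²`.
  · simp only [List.length_append]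
    nlinarith
  · rw [circuitMatrix_append, circuitMatrix_append, hw₂, hw₃, hic, Matrix.mul_smul,
      Matrix.mul_one]
    have : circuitMatrix w₁' * circuitMatrix (w ++ w₁) = circuitMatrix w := by
      rw [circuitMatrix_append, ← Matrix.mul_assoc, hw₁', Matrix.one_mul]
    rw [← this, hp, Matrix.mul_smul]

/-! ### Averages over the Clifford group -/

/-- Circuits of bounded length already reach every element, and there are finitely many of them. -/
lemma finite_clifford (hn : 1 ≤ n) : Finite (Clifford n) := by
  have : Finite (Gate n) := by
    let f : Gate n → ℕ × Fin n × Fin n := fun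
      | .hadamard q => (0, q, q)
      | .phase q => (1, q, q)
      | .cnot c t _ => (2, c, t)
    have hf : Function.Injective f := by
      intro G G' h
      cases G <;> cases G' <;> simp_all [f]
    have hr : Set.range f ⊆ (Set.Iio 3 ×ˢ Set.univ) := by
      rintro _ ⟨G, rfl⟩
      cases G <;> simp [f]
    exact Set.finite_univ_iff.1 (Set.Finite.of_finite_image
      (((Set.finite_Iio 3).prod Set.finite_univ).subset (by rw [Set.image_univ]; exact hr))
      hf.injOn)
  have hfin : {w : List (Gate n) | w.length ≤ 81 * n ^ 2}.Finite := List.finite_length_le _ _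
  have := hfin.to_subtype
  refine Finite.of_surjective
    (fun w : {w : List (Gate n) | w.length ≤ 81 * n ^ 2} =>
      (⟨circuitMatrix w.1, w.1, rfl⟩ : Clifford n)) ?_
  rintro ⟨_, w, rfl⟩
  obtain ⟨w', hl, hw⟩ := exists_short_circuit hn w
  exact ⟨⟨w', hl⟩, Subtype.ext hw⟩

/-- Multiplication of a Clifford unitary by a circuit. -/
noncomputable def Clifford.comp (w : List (Gate n)) (C : Clifford n) : Clifford n :=
  ⟨circuitMatrix w * C.1, by
    obtain ⟨C, v, rfl⟩ := C
    exact ⟨v ++ w, circuitMatrix_append v w⟩⟩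

lemma Clifford.conjTranspose_mul (C : Clifford n) : C.1ᴴ * C.1 = 1 := by
  obtain ⟨C, v, rfl⟩ := C
  exact circuitMatrix_conjTranspose_mul v

lemma Clifford.comp_injective (w : List (Gate n)) : Function.Injective (Clifford.comp w) := by
  intro C C' h
  have h' : circuitMatrix w * C.1 = circuitMatrix w * C'.1 := congrArg Subtype.val h
  have := congrArg (fun A => (circuitMatrix w)ᴴ * A) h'
  simp only [← Matrix.mul_assoc, circuitMatrix_conjTranspose_mul, Matrix.one_mul] at this
  exact Subtype.ext this

/-- Left invariance of the uniform distribution, the source of all the averaging identities below.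
-/
lemma sum_clifford_comp [Fintype (Clifford n)] {α : Type*} [AddCommMonoid α] (w : List (Gate n))
    (f : Clifford n → α) : ∑ C, f (Clifford.comp w C) = ∑ C, f C :=
  (Finite.injective_iff_bijective.1 (Clifford.comp_injective w)).sum_comp f

/-- The matrix element of a Pauli operator. -/
noncomputable def pauliForm (p : PauliLabel n) (v w : Qubits n → ℂ) : ℂ :=
  star v ⬝ᵥ (pauli p *ᵥ w)

lemma pauli_mulVec (p : PauliLabel n) (w : Qubits n → ℂ) (u : Qubits n) :
    (pauli p *ᵥ w) u = pauliSign p (flipBits p u) * w (flipBits p u) := by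
  simp [Matrix.mulVec, dotProduct, pauli, eq_flipBits_iff p u]

lemma pauliForm_eq (p : PauliLabel n) (v w : Qubits n → ℂ) :
    pauliForm p v w = ∑ u, star (v (flipBits p u)) * (pauliSign p u * w u) := by
  rw [pauliForm, dotProduct, ← (flipBits_involutive p).bijective.sum_comp]
  simp [pauli_mulVec, flipBits_flipBits]

lemma dotProduct_mulVec_unitary {U : Matrix (Qubits n) (Qubits n) ℂ} (hU : Uᴴ * U = 1)
    (v w : Qubits n → ℂ) : star (U *ᵥ v) ⬝ᵥ (U *ᵥ w) = star v ⬝ᵥ w := by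
  rw [Matrix.star_mulVec, ← Matrix.dotProduct_mulVec, Matrix.mulVec_mulVec, hU, Matrix.one_mulVec]

lemma norm_pauliForm_of_conjugates {U : Matrix (Qubits n) (Qubits n) ℂ} (hU : Uᴴ * U = 1)
    {p p' : PauliLabel n} (h : Conjugates U p p') (v w : Qubits n → ℂ) :
    ‖pauliForm p' (U *ᵥ v) (U *ᵥ w)‖ = ‖pauliForm p v w‖ := by
  obtain ⟨c, hc, h⟩ := h
  have h1 : pauliForm p v w = c * pauliForm p' (U *ᵥ v) (U *ᵥ w) := by
    rw [pauliForm, pauliForm, Matrix.mulVec_mulVec w, ← smul_eq_mul, ← dotProduct_smul,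
      ← Matrix.smul_mulVec, ← h, ← Matrix.mulVec_mulVec, dotProduct_mulVec_unitary hU]
  rw [h1, norm_mul, hc, one_mul]

/-- All nontrivial Pauli operators have the same second moment. -/
lemma sum_norm_pauliForm_sq_eq [Fintype (Clifford n)] {p p' : PauliLabel n} (hp : p ≠ idLabel n)
    (hp' : p' ≠ idLabel n) (v w : Qubits n → ℂ) :
    ∑ C : Clifford n, ‖pauliForm p (C.1 *ᵥ v) (C.1 *ᵥ w)‖ ^ 2 =
      ∑ C : Clifford n, ‖pauliForm p' (C.1 *ᵥ v) (C.1 *ᵥ w)‖ ^ 2 := by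
  obtain ⟨q, -⟩ : ∃ q : Fin n, p q ≠ (false, false) := by
    by_contra! hall
    exact hp (funext hall)
  have key : ∀ p : PauliLabel n, p ≠ idLabel n →
      ∑ C : Clifford n, ‖pauliForm p (C.1 *ᵥ v) (C.1 *ᵥ w)‖ ^ 2 =
      ∑ C : Clifford n, ‖pauliForm (labelX q) (C.1 *ᵥ v) (C.1 *ᵥ w)‖ ^ 2 := by
    intro p hp
    -- The elimination circuit carries `p` to `X_q`; absorbing it into `C` changes the matrix
    -- element only by a phase.
    obtain ⟨c, -, -, hc⟩ := exists_circuit_to_labelX ∅ (Finset.notMem_empty q) p (by simp) hp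
    rw [← sum_clifford_comp c fun C => ‖pauliForm (labelX q) (C.1 *ᵥ v) (C.1 *ᵥ w)‖ ^ 2]
    refine Finset.sum_congr rfl fun C _ => ?_
    have := norm_pauliForm_of_conjugates (circuitMatrix_conjTranspose_mul c)
      (hc ▸ circuit_conjugates c p) (C.1 *ᵥ v) (C.1 *ᵥ w)
    rw [Clifford.comp, ← Matrix.mulVec_mulVec, ← Matrix.mulVec_mulVec, this]
  rw [key p hp, key p' hp']

/-- The sign character `(-1) ^ (a · u)`. -/
def dotSign (a u : Qubits n) : ℂ := ∏ l, sgn (a l && u l)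

lemma dotSign_mul (a u u' : Qubits n) :
    dotSign a u * dotSign a u' = ∏ l, sgn (a l && xor (u l) (u' l)) := by
  rw [dotSign, dotSign, ← Finset.prod_mul_distrib]
  refine Finset.prod_congr rfl fun l _ => ?_
  generalize a l = x, u l = y, u' l = z
  cases x <;> cases y <;> cases z <;> simp

lemma star_dotSign (a u : Qubits n) : star (dotSign a u) = dotSign a u := by
  simp only [dotSign, star_prod, star_sgn]

lemma sum_dotSign_mul (u u' : Qubits n) :
    ∑ a, dotSign a u * dotSign a u' = if u = u' then 2 ^ n else 0 := by
  simp only [dotSign_mul]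
  have := Finset.prod_univ_sum (fun _ : Fin n => (Finset.univ : Finset Bool))
    (fun l b => sgn (b && xor (u l) (u' l)))
  rw [Fintype.piFinset_univ] at this
  rw [← this]
  split_ifs with h
  · subst h
    simp
  · obtain ⟨l, hl⟩ := Function.ne_iff.1 h
    refine Finset.prod_eq_zero (Finset.mem_univ l) ?_
    generalize u l = a, u' l = b at hl
    cases a <;> cases b <;> simp at hl ⊢

/-- Parseval for the characters of `𝔽₂^n`. -/
lemma sum_norm_dotSign_sq (g : Qubits n → ℂ) :
    ∑ a : Qubits n, ‖∑ u, dotSign a u * g u‖ ^ 2 = 2 ^ n * ∑ u, ‖g u‖ ^ 2 := by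
  have key : ∑ a : Qubits n, (∑ u, dotSign a u * g u) * star (∑ u, dotSign a u * g u) =
      2 ^ n * ∑ u, g u * star (g u) := by
    calc _ = ∑ a : Qubits n, ∑ u, ∑ u', (dotSign a u * dotSign a u') * (g u * star (g u')) := by
          refine Finset.sum_congr rfl fun a _ => ?_
          rw [star_sum, Finset.sum_mul_sum]
          refine Finset.sum_congr rfl fun u _ => Finset.sum_congr rfl fun u' _ => ?_
          rw [star_mul', star_dotSign]; ring
      _ = ∑ u, ∑ u', (∑ a, dotSign a u * dotSign a u') * (g u * star (g u')) := by
          rw [Finset.sum_comm]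
          refine Finset.sum_congr rfl fun u _ => ?_
          rw [Finset.sum_comm]
          exact Finset.sum_congr rfl fun u' _ => by rw [Finset.sum_mul]
      _ = _ := by
          simp [sum_dotSign_mul, Finset.mul_sum]
  have conv : ∀ z : ℂ, z * star z = ((‖z‖ ^ 2 : ℝ) : ℂ) := fun z => by
    rw [Complex.star_def, Complex.mul_conj, Complex.normSq_eq_norm_sq]
  simp only [conv] at key
  exact_mod_cast key

/-- The squared length of a vector. -/
noncomputable def lenSq (v : Qubits n → ℂ) : ℝ := ∑ u, ‖v u‖ ^ 2

lemma lenSq_eq_dotProduct (v : Qubits n → ℂ) : (lenSq v : ℂ) = star v ⬝ᵥ v := by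
  rw [lenSq, dotProduct]
  push_cast
  refine Finset.sum_congr rfl fun u _ => ?_
  rw [Pi.star_apply, mul_comm, Complex.star_def, Complex.mul_conj, Complex.normSq_eq_norm_sq]
  push_cast; rfl

lemma lenSq_nonneg (v : Qubits n → ℂ) : 0 ≤ lenSq v :=
  Finset.sum_nonneg fun _ _ => sq_nonneg _

lemma lenSq_mulVec_unitary {U : Matrix (Qubits n) (Qubits n) ℂ} (hU : Uᴴ * U = 1)
    (v : Qubits n → ℂ) : lenSq (U *ᵥ v) = lenSq v := by
  have : (lenSq (U *ᵥ v) : ℂ) = lenSq v := by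
    rw [lenSq_eq_dotProduct, lenSq_eq_dotProduct, dotProduct_mulVec_unitary hU]
  exact_mod_cast this

/-- For a fixed `X` part, Parseval evaluates the sum over the `Z` part; the sum over all shifts then
factorises. -/
lemma sum_norm_pauliForm_sq (v w : Qubits n → ℂ) :
    ∑ p : PauliLabel n, ‖pauliForm p v w‖ ^ 2 = 2 ^ n * (lenSq v * lenSq w) := by
  rw [← (Equiv.arrowProdEquivProdArrow (Fin n) (fun _ => Bool) (fun _ => Bool)).symm.sum_comp,
    Fintype.sum_prod_type]
  have h1 : ∀ (x z : Qubits n), pauliForm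
      ((Equiv.arrowProdEquivProdArrow (Fin n) (fun _ => Bool) (fun _ => Bool)).symm (x, z)) v w =
      ∑ u, dotSign z u * (star (v (fun l => xor (u l) (x l))) * w u) := by
    intro x z
    rw [pauliForm_eq]
    refine Finset.sum_congr rfl fun u _ => ?_
    have : ∀ a b c : ℂ, a * (b * c) = b * (a * c) := fun a b c => by ring
    rw [this]
    rfl
  simp only [h1, sum_norm_dotSign_sq]
  rw [← Finset.mul_sum, Finset.sum_comm]
  congr 1
  have h2 : ∀ u : Qubits n, ∑ x : Qubits n, ‖star (v (fun l => xor (u l) (x l))) * w u‖ ^ 2 =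
      lenSq v * ‖w u‖ ^ 2 := by
    intro u
    have hbij : Function.Bijective fun x : Qubits n => (fun l => xor (u l) (x l) : Qubits n) :=
      Function.Involutive.bijective fun x => by ext l; simp
    simp only [norm_mul, norm_star, mul_pow]
    rw [← Finset.sum_mul, lenSq]
    congr 1
    exact hbij.sum_comp fun y => ‖v y‖ ^ 2
  simp only [h2]
  rw [← Finset.mul_sum]; rfl

/-- The label of the operator `Z ^ a`. -/
def labelZs (a : Qubits n) : PauliLabel n := fun l => (false, a l)

lemma pauliForm_labelZs (a : Qubits n) (v w : Qubits n → ℂ) :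
    pauliForm (labelZs a) v w = ∑ u, dotSign a u * (star (v u) * w u) := by
  rw [pauliForm_eq]
  refine Finset.sum_congr rfl fun u _ => ?_
  have h1 : flipBits (labelZs a) u = u := by ext l; simp [flipBits, labelZs]
  have h2 : pauliSign (labelZs a) u = dotSign a u := rfl
  rw [h1, h2]; ring

lemma pauliForm_labelZs_labelX (a : Qubits n) (q : Fin n) (v w : Qubits n → ℂ) :
    pauliForm (labelZs a) (pauli (labelX q) *ᵥ v) (pauli (labelX q) *ᵥ w) =
      sgn (a q) * pauliForm (labelZs a) v w := by
  rw [pauliForm_labelZs, pauliForm_labelZs, ← (flipBits_involutive (labelX q)).bijective.sum_comp,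
    Finset.mul_sum]
  refine Finset.sum_congr rfl fun u _ => ?_
  simp only [pauli_mulVec, flipBits_flipBits, pauliSign_labelX, one_mul]
  have key : dotSign a (flipBits (labelX q) u) = sgn (a q) * dotSign a u := by
    rw [flipBits_labelX, dotSign, dotSign, ← Finset.mul_prod_erase _ _ (Finset.mem_univ q),
      ← Finset.mul_prod_erase _ _ (Finset.mem_univ q), ← mul_assoc]
    congr 1
    · rw [Function.update_self]
      generalize a q = x, u q = y
      cases x <;> cases y <;> simp
    · refine Finset.prod_congr rfl fun l hl => ?_
      rw [Function.update_of_ne (Finset.ne_of_mem_erase hl)]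
  rw [key]; ring

/-- Replacing `C` by `X_q C`, for a qubit `q` where `a` and `b` differ, changes the sign of each
summand but not the sum. -/
lemma sum_pauliForm_mul_star [Fintype (Clifford n)] {a b : Qubits n} (hab : a ≠ b)
    (v w v' w' : Qubits n → ℂ) :
    ∑ C : Clifford n, pauliForm (labelZs a) (C.1 *ᵥ v) (C.1 *ᵥ w) *
      star (pauliForm (labelZs b) (C.1 *ᵥ v') (C.1 *ᵥ w')) = 0 := by
  obtain ⟨q, hq⟩ := Function.ne_iff.1 hab
  obtain ⟨c, -, hc⟩ := exists_circuit_pauli (labelX q)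
  have h := sum_clifford_comp c fun C : Clifford n =>
    pauliForm (labelZs a) (C.1 *ᵥ v) (C.1 *ᵥ w) *
      star (pauliForm (labelZs b) (C.1 *ᵥ v') (C.1 *ᵥ w'))
  simp only [Clifford.comp, ← Matrix.mulVec_mulVec, hc, pauliForm_labelZs_labelX, star_mul',
    star_sgn] at h
  have hs : sgn (a q) * sgn (b q) = -1 := by
    generalize a q = x, b q = y at hq
    cases x <;> cases y <;> simp at hq ⊢
  have h2 : ∀ s t x y : ℂ, s * x * (t * y) = s * t * (x * y) := fun s t x y => by ring
  simp only [h2, hs, ← Finset.mul_sum] at h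
  rw [neg_one_mul] at h
  exact self_eq_neg.1 h.symm

lemma pauliForm_labelZs_zero (v w : Qubits n → ℂ) :
    pauliForm (labelZs fun _ => false) v w = star v ⬝ᵥ w := by
  rw [pauliForm_labelZs, dotProduct]
  exact Finset.sum_congr rfl fun u _ => by simp [dotSign]

/-- The basis labels `0^(n-k) z`. -/
def IsLow (k : ℕ) (u : Qubits n) : Prop := ∀ q : Fin n, (q : ℕ) < n - k → u q = false

instance (k : ℕ) (u : Qubits n) : Decidable (IsLow k u) :=
  inferInstanceAs (Decidable (∀ q : Fin n, (q : ℕ) < n - k → u q = false))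

/-- The matrix element of the projection onto the stabilizer code of a sketch. -/
noncomputable def sketchForm (k : ℕ) (C : Clifford n) (v w : Qubits n → ℂ) : ℂ :=
  ∑ u, if IsLow k u then star ((C.1 *ᵥ v) u) * (C.1 *ᵥ w) u else 0

/-- The exponents of the operators `Z ^ a` in the stabilizer group of a sketch. -/
def stabExponents (n k : ℕ) : Finset (Qubits n) :=
  Fintype.piFinset fun l : Fin n => if (l : ℕ) < n - k then Finset.univ else {false}

lemma card_stabExponents {k : ℕ} : (stabExponents n k).card = 2 ^ (n - k) := by
  rw [stabExponents, Fintype.card_piFinset]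
  have h : ∀ l : Fin n, (if (l : ℕ) < n - k then (Finset.univ : Finset Bool) else {false}).card =
      if (l : ℕ) < n - k then 2 else 1 := fun l => by split_ifs <;> rfl
  simp only [h]
  rw [Fin.prod_univ_eq_prod_range (fun l => if l < n - k then 2 else 1) n, Finset.prod_ite,
    Finset.prod_const, Finset.prod_const_one, mul_one]
  congr 1
  have : (Finset.range n).filter (fun l => l < n - k) = Finset.range (n - k) := by
    ext l; simp; omega
  rw [this, Finset.card_range]

lemma sum_stabExponents (k : ℕ) (u : Qubits n) :
    ∑ a ∈ stabExponents n k, dotSign a u = if IsLow k u then 2 ^ (n - k) else 0 := by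
  split_ifs with h
  · have : ∀ a ∈ stabExponents n k, dotSign a u = 1 := by
      intro a ha
      refine Finset.prod_eq_one fun l _ => ?_
      by_cases hl : (l : ℕ) < n - k
      · simp [h l hl]
      · have := Fintype.mem_piFinset.1 ha l
        rw [if_neg hl, Finset.mem_singleton] at this
        simp [this]
    rw [Finset.sum_congr rfl this]
    simp [card_stabExponents]
  · simp only [dotSign, stabExponents]
    rw [← Finset.prod_univ_sum (fun l : Fin n => if (l : ℕ) < n - k then Finset.univ else {false})
      fun l b => sgn (b && u l)]
    simp only [IsLow, not_forall] at h
    obtain ⟨q, hq, hu⟩ := h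
    refine Finset.prod_eq_zero (Finset.mem_univ q) ?_
    simp [hq, hu]

/-- The projection onto `0^(n-k)` is the average of the stabilizer group `{Z^a}`. -/
lemma sketchForm_eq (k : ℕ) (C : Clifford n) (v w : Qubits n → ℂ) :
    2 ^ (n - k) * sketchForm k C v w =
      ∑ a ∈ stabExponents n k, pauliForm (labelZs a) (C.1 *ᵥ v) (C.1 *ᵥ w) := by
  simp only [pauliForm_labelZs]
  rw [Finset.sum_comm, sketchForm, Finset.mul_sum]
  refine Finset.sum_congr rfl fun u _ => ?_
  rw [← Finset.sum_mul, sum_stabExponents]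
  split_ifs <;> simp

lemma zero_mem_stabExponents (n k : ℕ) : (fun _ => false) ∈ stabExponents n k := by
  refine Fintype.mem_piFinset.2 fun l => ?_
  split_ifs <;> simp

lemma sum_sketchForm [Fintype (Clifford n)] (k : ℕ) (v w : Qubits n → ℂ) :
    2 ^ (n - k) * ∑ C : Clifford n, sketchForm k C v w =
      Fintype.card (Clifford n) * (star v ⬝ᵥ w) := by
  rw [Finset.mul_sum]
  simp only [sketchForm_eq]
  rw [Finset.sum_comm, Finset.sum_eq_single_of_mem _ (zero_mem_stabExponents n k)]
  · simp [pauliForm_labelZs_zero, dotProduct_mulVec_unitary (Clifford.conjTranspose_mul _)]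
  · intro a _ ha
    -- The vanishing of a single term is the orthogonality relation with `b = 0`, whose second
    -- factor is the constant `⟨v|v⟩`; it must be nonzero to be divided out.
    by_cases hvw : star v ⬝ᵥ v = 0
    · have : v = 0 := by
        rw [← lenSq_eq_dotProduct, Complex.ofReal_eq_zero, lenSq,
          Finset.sum_eq_zero_iff_of_nonneg fun _ _ => sq_nonneg _] at hvw
        ext u
        simpa using hvw u (Finset.mem_univ u)
      simp [this, pauliForm]
    · have := sum_pauliForm_mul_star ha v w v v
      simp only [pauliForm_labelZs_zero,
        dotProduct_mulVec_unitary (Clifford.conjTranspose_mul _)] at this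
      rw [← Finset.sum_mul] at this
      exact (mul_eq_zero.1 this).resolve_right (by simpa using hvw)

lemma norm_sq_eq_mul_star (z : ℂ) : ((‖z‖ ^ 2 : ℝ) : ℂ) = z * star z := by
  rw [Complex.star_def, Complex.mul_conj, Complex.normSq_eq_norm_sq]

/-- Expanding the square over the stabilizer group leaves only diagonal terms. The identity
contributes `|⟨v|w⟩|²`, and each of the other `2^(n-k) - 1` terms contributes the second moment
common to all nontrivial Pauli operators. -/
lemma sum_norm_sketchForm_sq_le [Fintype (Clifford n)] {k : ℕ} (hn : 1 ≤ n) (hk : k ≤ n)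
    (v w : Qubits n → ℂ) :
    (2 ^ (n - k)) ^ 2 * ∑ C : Clifford n, ‖sketchForm k C v w‖ ^ 2 ≤
      Fintype.card (Clifford n) * (‖star v ⬝ᵥ w‖ ^ 2 + lenSq v * lenSq w / 2 ^ k) := by
  have hexp : (2 ^ (n - k)) ^ 2 * ∑ C : Clifford n, ‖sketchForm k C v w‖ ^ 2 =
      ∑ a ∈ stabExponents n k,
        ∑ C : Clifford n, ‖pauliForm (labelZs a) (C.1 *ᵥ v) (C.1 *ᵥ w)‖ ^ 2 := by
    have : (((2 ^ (n - k)) ^ 2 * ∑ C : Clifford n, ‖sketchForm k C v w‖ ^ 2 : ℝ) : ℂ) =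
        ((∑ a ∈ stabExponents n k,
        ∑ C : Clifford n, ‖pauliForm (labelZs a) (C.1 *ᵥ v) (C.1 *ᵥ w)‖ ^ 2 : ℝ) : ℂ) := by
      push_cast [Finset.mul_sum]
      calc _ = ∑ C : Clifford n, (2 ^ (n - k) * sketchForm k C v w) *
            star (2 ^ (n - k) * sketchForm k C v w) := by
            refine Finset.sum_congr rfl fun C _ => ?_
            have := norm_sq_eq_mul_star (sketchForm k C v w)
            push_cast at this
            rw [this, star_mul']
            simp
            ring
        _ = ∑ a ∈ stabExponents n k, ∑ b ∈ stabExponents n k, ∑ C : Clifford n,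
            pauliForm (labelZs a) (C.1 *ᵥ v) (C.1 *ᵥ w) *
              star (pauliForm (labelZs b) (C.1 *ᵥ v) (C.1 *ᵥ w)) := by
            simp only [sketchForm_eq, star_sum, Finset.sum_mul_sum]
            rw [Finset.sum_comm]
            exact Finset.sum_congr rfl fun a _ => Finset.sum_comm
        _ = _ := by
            refine Finset.sum_congr rfl fun a ha => ?_
            rw [Finset.sum_eq_single_of_mem a ha fun b _ hb => sum_pauliForm_mul_star hb.symm _ _ _ _]
            refine Finset.sum_congr rfl fun C _ => ?_
            have := norm_sq_eq_mul_star (pauliForm (labelZs a) (C.1 *ᵥ v) (C.1 *ᵥ w))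
            push_cast at this
            rw [this]
    exact_mod_cast this
  set S := ∑ C : Clifford n, ‖pauliForm (labelX ⟨0, hn⟩) (C.1 *ᵥ v) (C.1 *ᵥ w)‖ ^ 2 with hS
  have hne : labelX (⟨0, hn⟩ : Fin n) ≠ idLabel n := fun h => by
    have := congrFun h ⟨0, hn⟩
    simp [labelX, idLabel] at this
  have hpS : ∀ p : PauliLabel n, p ≠ idLabel n →
      ∑ C : Clifford n, ‖pauliForm p (C.1 *ᵥ v) (C.1 *ᵥ w)‖ ^ 2 = S :=
    fun p hp => sum_norm_pauliForm_sq_eq hp hne v w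
  have hid : ∑ C : Clifford n, ‖pauliForm (idLabel n) (C.1 *ᵥ v) (C.1 *ᵥ w)‖ ^ 2 =
      Fintype.card (Clifford n) * ‖star v ⬝ᵥ w‖ ^ 2 := by
    have : ∀ C : Clifford n, pauliForm (idLabel n) (C.1 *ᵥ v) (C.1 *ᵥ w) = star v ⬝ᵥ w :=
      fun C => by
        rw [pauliForm, pauli_idLabel, Matrix.one_mulVec,
          dotProduct_mulVec_unitary C.conjTranspose_mul]
    simp [this]
  have hall : ∑ p : PauliLabel n, ∑ C : Clifford n,
      ‖pauliForm p (C.1 *ᵥ v) (C.1 *ᵥ w)‖ ^ 2 =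
      Fintype.card (Clifford n) * (2 ^ n * (lenSq v * lenSq w)) := by
    rw [Finset.sum_comm]
    simp [sum_norm_pauliForm_sq, lenSq_mulVec_unitary (Clifford.conjTranspose_mul _)]
  -- The common value `S` is found from the total over all `4^n` labels.
  have hSeq : Fintype.card (Clifford n) * ‖star v ⬝ᵥ w‖ ^ 2 + (4 ^ n - 1) * S =
      Fintype.card (Clifford n) * (2 ^ n * (lenSq v * lenSq w)) := by
    rw [← hall, ← Finset.add_sum_erase _ _ (Finset.mem_univ (idLabel n)), hid,
      Finset.sum_congr rfl fun p hp => hpS p (Finset.ne_of_mem_erase hp), Finset.sum_const,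
      Finset.card_erase_of_mem (Finset.mem_univ _), Finset.card_univ, nsmul_eq_mul,
      Nat.cast_sub Fintype.card_pos]
    simp
  have hsum : ∑ a ∈ stabExponents n k,
      ∑ C : Clifford n, ‖pauliForm (labelZs a) (C.1 *ᵥ v) (C.1 *ᵥ w)‖ ^ 2 =
      Fintype.card (Clifford n) * ‖star v ⬝ᵥ w‖ ^ 2 + (2 ^ (n - k) - 1) * S := by
    have h0 : labelZs (fun _ => false) = idLabel n := rfl
    have h1 : ∀ a ∈ (stabExponents n k).erase (fun _ => false),
        ∑ C : Clifford n, ‖pauliForm (labelZs a) (C.1 *ᵥ v) (C.1 *ᵥ w)‖ ^ 2 = S :=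
      fun a ha => hpS (labelZs a) fun h => Finset.ne_of_mem_erase ha
        (funext fun l => congrArg Prod.snd (congrFun h l))
    rw [← Finset.add_sum_erase _ _ (zero_mem_stabExponents n k), h0, hid,
      Finset.sum_congr rfl h1, Finset.sum_const,
      Finset.card_erase_of_mem (zero_mem_stabExponents n k), card_stabExponents, nsmul_eq_mul,
      Nat.cast_sub Nat.one_le_two_pow]
    push_cast; rfl
  rw [hexp, hsum, mul_add]
  refine add_le_add_right ?_ _
  have hD : (2 : ℝ) ^ n = 2 ^ k * 2 ^ (n - k) := by rw [← pow_add, Nat.add_sub_cancel' hk]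
  have h4 : (4 : ℝ) ^ n = 2 ^ n * 2 ^ n := by rw [← mul_pow]; norm_num
  have hK1 : (1 : ℝ) ≤ 2 ^ k := one_le_pow₀ (by norm_num)
  have hA1 : (1 : ℝ) ≤ 2 ^ (n - k) := one_le_pow₀ (by norm_num)
  have hD2 : (2 : ℝ) ≤ 2 ^ n := by
    calc (2 : ℝ) = 2 ^ 1 := by norm_num
      _ ≤ 2 ^ n := pow_le_pow_right₀ (by norm_num) hn
  have hν : 0 ≤ lenSq v * lenSq w := mul_nonneg (lenSq_nonneg v) (lenSq_nonneg w)
  set g : ℝ := (Fintype.card (Clifford n) : ℝ) with hg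
  have hg0 : 0 ≤ g := Nat.cast_nonneg _
  set ν := lenSq v * lenSq w
  set D : ℝ := 2 ^ n
  set K : ℝ := 2 ^ k
  set A : ℝ := 2 ^ (n - k)
  have hpos : 0 < D * D - 1 := by nlinarith
  rw [h4] at hSeq
  have hS1 : (D * D - 1) * S ≤ g * (D * ν) := by
    have : 0 ≤ g * ‖star v ⬝ᵥ w‖ ^ 2 := by positivity
    linarith
  have hgoal : (A - 1) * S ≤ (A - 1) * (g * (D * ν) / (D * D - 1)) := by
    refine mul_le_mul_of_nonneg_left ?_ (by linarith)
    rw [le_div_iff₀ hpos]; linarith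
  refine hgoal.trans ?_
  rw [← mul_div_assoc, ← mul_div_assoc, div_le_div_iff₀ hpos (by linarith)]
  have hgν : 0 ≤ g * ν := mul_nonneg hg0 hν
  -- Since `D = K A`, the left side equals `D² - D K`.
  have h1 : (A - 1) * (D * K) ≤ D * D - 1 := by
    have : 1 ≤ D * K := by nlinarith
    rw [hD] at this ⊢
    nlinarith
  calc (A - 1) * (g * (D * ν)) * K = (g * ν) * ((A - 1) * (D * K)) := by ring
    _ ≤ (g * ν) * (D * D - 1) := mul_le_mul_of_nonneg_left h1 hgν

/-! ### Basis labels -/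

/-- The number whose binary expansion is a given bit string. -/
def ketIndex (u : Qubits n) : ℕ := Nat.ofBits fun i : Fin n => u i.rev

lemma ketIndex_lt (u : Qubits n) : ketIndex u < 2 ^ n := Nat.ofBits_lt_two_pow _

lemma ket_ketIndex (u : Qubits n) : ket n (ketIndex u) = u := by
  ext q
  rw [ket, ketIndex, Nat.testBit_ofBits_lt _ _ q.rev.isLt]
  exact congrArg u (Fin.rev_rev q)

lemma ketIndex_ket {m : ℕ} (hm : m < 2 ^ n) : ketIndex (ket n m) = m := by
  have : ketIndex (ket n m) = Nat.ofBits fun i : Fin n => m.testBit i := by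
    simp [ketIndex, ket]
  rw [this, Nat.ofBits_testBit, Nat.mod_eq_of_lt hm]

lemma sum_ket {α : Type*} [AddCommMonoid α] (f : Qubits n → α) :
    ∑ m ∈ Finset.range (2 ^ n), f (ket n m) = ∑ u, f u := by
  refine Finset.sum_nbij' (ket n) ketIndex ?_ ?_ ?_ ?_ ?_
  · simp
  · intro u _; simpa using ketIndex_lt u
  · intro m hm; exact ketIndex_ket (by simpa using hm)
  · intro u _; exact ket_ketIndex u
  · intro m _; rfl

lemma isLow_iff {k : ℕ} (hk : k ≤ n) (u : Qubits n) : IsLow k u ↔ ketIndex u < 2 ^ k := by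
  constructor
  · intro h
    refine Nat.lt_pow_two_of_testBit _ fun i hi => ?_
    by_cases hin : i < n
    · rw [ketIndex, Nat.testBit_ofBits_lt _ _ hin]
      exact h _ (by simp [Fin.rev]; omega)
    · rw [ketIndex, Nat.testBit_ofBits_ge _ _ (by omega)]
  · intro h q hq
    have : (ketIndex u).testBit (n - (q + 1)) = u q := by
      rw [ketIndex, Nat.testBit_ofBits_lt _ _ (by omega)]
      congr 1
      ext
      simp [Fin.rev]; omega
    rw [← this]
    exact Nat.testBit_lt_two_pow (h.trans_le (Nat.pow_le_pow_right (by norm_num) (by omega)))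

/-! ### The estimator for one pair of sketches -/

/-- The projection of a vector onto the stabilizer code of a sketch. -/
noncomputable def projVec (k : ℕ) (C : Clifford n) (v : Qubits n → ℂ) : Qubits n → ℂ :=
  C.1ᴴ *ᵥ fun u => if IsLow k u then (C.1 *ᵥ v) u else 0

lemma Clifford.mul_conjTranspose (C : Clifford n) : C.1 * C.1ᴴ = 1 :=
  mul_eq_one_comm.1 C.conjTranspose_mul

lemma Clifford.conjTranspose_unitary (C : Clifford n) : (C.1ᴴ)ᴴ * C.1ᴴ = 1 := by
  rw [Matrix.conjTranspose_conjTranspose, C.mul_conjTranspose]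

lemma dotProduct_projVec (k : ℕ) (C : Clifford n) (v w : Qubits n → ℂ) :
    star v ⬝ᵥ projVec k C w = sketchForm k C v w := by
  have : star v ⬝ᵥ projVec k C w =
      star (C.1 *ᵥ v) ⬝ᵥ fun u => if IsLow k u then (C.1 *ᵥ w) u else 0 := by
    rw [projVec, Matrix.star_mulVec, ← Matrix.dotProduct_mulVec]
  rw [this, sketchForm, dotProduct]
  refine Finset.sum_congr rfl fun u _ => ?_
  split_ifs <;> simp

lemma projVec_dotProduct (k : ℕ) (C : Clifford n) (v w : Qubits n → ℂ) :
    star (projVec k C v) ⬝ᵥ w = sketchForm k C v w := by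
  have : star (projVec k C v) ⬝ᵥ w =
      star (fun u => if IsLow k u then (C.1 *ᵥ v) u else 0) ⬝ᵥ (C.1 *ᵥ w) := by
    rw [projVec, Matrix.star_mulVec, Matrix.conjTranspose_conjTranspose, ← Matrix.dotProduct_mulVec]
  rw [this, sketchForm, dotProduct]
  refine Finset.sum_congr rfl fun u _ => ?_
  simp only [Pi.star_apply]
  split_ifs <;> simp

lemma lenSq_projVec_le (k : ℕ) (C : Clifford n) (v : Qubits n → ℂ) :
    lenSq (projVec k C v) ≤ lenSq v := by
  rw [projVec, lenSq_mulVec_unitary C.conjTranspose_unitary,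
    ← lenSq_mulVec_unitary C.conjTranspose_mul v]
  refine Finset.sum_le_sum fun u _ => ?_
  dsimp only
  split_ifs
  · exact le_rfl
  · simp

lemma projVec_self (C : Clifford n) (v : Qubits n → ℂ) : projVec n C v = v := by
  have : ∀ u : Qubits n, IsLow n u := fun u q hq => by simp at hq
  simp [projVec, this, Matrix.mulVec_mulVec, C.conjTranspose_mul]

/-- The estimate of `⟨ψ|M|ψ⟩` from a pair of sketches with exact amplitudes. -/
noncomputable def pairEstimate (k : ℕ) (M : Matrix (Qubits n) (Qubits n) ℂ) (ψ : Qubits n → ℂ)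
    (C₁ C₂ : Clifford n) : ℂ :=
  (2 ^ (n - k)) ^ 2 * (star (projVec k C₁ ψ) ⬝ᵥ (M *ᵥ projVec k C₂ ψ))

/-- With `k = n` the sketch is complete and the estimate does not depend on the Clifford unitaries.
-/
lemma pairEstimate_self (M : Matrix (Qubits n) (Qubits n) ℂ) (ψ : Qubits n → ℂ)
    (C₁ C₂ : Clifford n) : pairEstimate n M ψ C₁ C₂ = star ψ ⬝ᵥ (M *ᵥ ψ) := by
  simp [pairEstimate, projVec_self]

lemma dotProduct_mulVec_eq (M : Matrix (Qubits n) (Qubits n) ℂ) (v w : Qubits n → ℂ) :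
    star v ⬝ᵥ (M *ᵥ w) = star (Mᴴ *ᵥ v) ⬝ᵥ w := by
  rw [Matrix.star_mulVec, Matrix.conjTranspose_conjTranspose, ← Matrix.dotProduct_mulVec]

/-- Unbiasedness. Each projection enters linearly and independently of the other, so the first
moment is used twice, first for `C₁` with `C₂` fixed. -/
lemma sum_pairEstimate [Fintype (Clifford n)] (k : ℕ) (M : Matrix (Qubits n) (Qubits n) ℂ)
    (ψ : Qubits n → ℂ) :
    ∑ C₁, ∑ C₂, pairEstimate k M ψ C₁ C₂ =
      (Fintype.card (Clifford n) : ℂ) ^ 2 * (star ψ ⬝ᵥ (M *ᵥ ψ)) := by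
  calc _ = ∑ C₂ : Clifford n, 2 ^ (n - k) *
        (2 ^ (n - k) * ∑ C₁, sketchForm k C₁ ψ (M *ᵥ projVec k C₂ ψ)) := by
        rw [Finset.sum_comm]
        refine Finset.sum_congr rfl fun C₂ _ => ?_
        rw [← mul_assoc, Finset.mul_sum]
        refine Finset.sum_congr rfl fun C₁ _ => ?_
        rw [pairEstimate, projVec_dotProduct, sq]
    _ = Fintype.card (Clifford n) *
        (2 ^ (n - k) * ∑ C₂, sketchForm k C₂ (Mᴴ *ᵥ ψ) ψ) := by
        rw [Finset.mul_sum, Finset.mul_sum]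
        refine Finset.sum_congr rfl fun C₂ _ => ?_
        rw [sum_sketchForm, dotProduct_mulVec_eq, dotProduct_projVec]
        ring
    _ = _ := by
        rw [sum_sketchForm, ← dotProduct_mulVec_eq]; ring

/-- The second moment bound is applied to `C₁` with `C₂` fixed and then to `C₂`, once with the
vector `Mψ` and once with every row of `M`. The rows produce the Frobenius norm. -/
lemma sum_norm_pairEstimate_sq_le [Fintype (Clifford n)] {k : ℕ} (hn : 1 ≤ n) (hk : k ≤ n)
    {M : Matrix (Qubits n) (Qubits n) ℂ} (hM : M.IsHermitian) {ψ : Qubits n → ℂ}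
    (hψ : lenSq ψ = 1) :
    ∑ C₁, ∑ C₂, ‖pairEstimate k M ψ C₁ C₂‖ ^ 2 ≤ (Fintype.card (Clifford n) : ℝ) ^ 2 *
      (‖star ψ ⬝ᵥ (M *ᵥ ψ)‖ ^ 2 + 2 * lenSq (M *ᵥ ψ) / 2 ^ k +
        (∑ i, ∑ j, ‖M i j‖ ^ 2) / (2 ^ k) ^ 2) := by
  set g : ℝ := (Fintype.card (Clifford n) : ℝ) with hg
  have hg0 : 0 ≤ g := Nat.cast_nonneg _
  set A : ℝ := 2 ^ (n - k) with hA
  have step1 : ∀ C₂ : Clifford n, ∑ C₁, ‖pairEstimate k M ψ C₁ C₂‖ ^ 2 ≤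
      g * (A ^ 2 * ‖sketchForm k C₂ (M *ᵥ ψ) ψ‖ ^ 2 +
        (∑ i, A ^ 2 * ‖sketchForm k C₂ (star (M i)) ψ‖ ^ 2) / 2 ^ k) := by
    intro C₂
    have h := sum_norm_sketchForm_sq_le hn hk ψ (M *ᵥ projVec k C₂ ψ)
    have e1 : ∑ C₁, ‖pairEstimate k M ψ C₁ C₂‖ ^ 2 =
        A ^ 2 * (A ^ 2 * ∑ C₁, ‖sketchForm k C₁ ψ (M *ᵥ projVec k C₂ ψ)‖ ^ 2) := by
      rw [← mul_assoc, Finset.mul_sum]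
      refine Finset.sum_congr rfl fun C₁ _ => ?_
      rw [pairEstimate, projVec_dotProduct, norm_mul, mul_pow]
      congr 1
      simp [hA]
      ring
    rw [dotProduct_mulVec_eq, hM.eq, dotProduct_projVec, hψ, one_mul] at h
    -- The squared length of `M P₂ ψ` is a sum of squared sketch forms, one per row of `M`.
    have e2 : lenSq (M *ᵥ projVec k C₂ ψ) = ∑ i, ‖sketchForm k C₂ (star (M i)) ψ‖ ^ 2 := by
      refine Finset.sum_congr rfl fun i _ => ?_
      rw [← dotProduct_projVec, star_star]; rfl
    rw [e1, ← Finset.mul_sum, ← e2]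
    calc _ ≤ A ^ 2 * (g * (‖sketchForm k C₂ (M *ᵥ ψ) ψ‖ ^ 2 +
          lenSq (M *ᵥ projVec k C₂ ψ) / 2 ^ k)) :=
          mul_le_mul_of_nonneg_left h (sq_nonneg A)
      _ = _ := by ring
  have step2 : ∀ v : Qubits n → ℂ, ∑ C₂, A ^ 2 * ‖sketchForm k C₂ v ψ‖ ^ 2 ≤
      g * (‖star v ⬝ᵥ ψ‖ ^ 2 + lenSq v / 2 ^ k) := by
    intro v
    have h := sum_norm_sketchForm_sq_le hn hk v ψ
    rw [hψ, mul_one, Finset.mul_sum] at h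
    exact h
  rw [Finset.sum_comm]
  calc _ ≤ ∑ C₂ : Clifford n, g * (A ^ 2 * ‖sketchForm k C₂ (M *ᵥ ψ) ψ‖ ^ 2 +
        (∑ i, A ^ 2 * ‖sketchForm k C₂ (star (M i)) ψ‖ ^ 2) / 2 ^ k) :=
        Finset.sum_le_sum fun C₂ _ => step1 C₂
    _ = g * (∑ C₂, A ^ 2 * ‖sketchForm k C₂ (M *ᵥ ψ) ψ‖ ^ 2 +
        (∑ i, ∑ C₂, A ^ 2 * ‖sketchForm k C₂ (star (M i)) ψ‖ ^ 2) / 2 ^ k) := by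
        rw [← Finset.mul_sum, Finset.sum_add_distrib, ← Finset.sum_div, Finset.sum_comm (s := Finset.univ (α := Clifford n))]
    _ ≤ g * (g * (‖star (M *ᵥ ψ) ⬝ᵥ ψ‖ ^ 2 + lenSq (M *ᵥ ψ) / 2 ^ k) +
        (∑ i, g * (‖M i ⬝ᵥ ψ‖ ^ 2 + (∑ j, ‖M i j‖ ^ 2) / 2 ^ k)) / 2 ^ k) := by
        refine mul_le_mul_of_nonneg_left (add_le_add (step2 _) ?_) hg0
        refine div_le_div_of_nonneg_right (Finset.sum_le_sum fun i _ => ?_) (by positivity)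
        have := step2 (star (M i))
        rw [star_star] at this
        refine this.trans_eq ?_
        congr 3
        exact Finset.sum_congr rfl fun j _ => by rw [Pi.star_apply, norm_star]
    _ = _ := by
        rw [← Finset.mul_sum, Finset.sum_add_distrib, ← Finset.sum_div,
          show ∑ i, ‖M i ⬝ᵥ ψ‖ ^ 2 = lenSq (M *ᵥ ψ) from rfl, dotProduct_mulVec_eq, hM.eq]
        field_simp
        ring

/-- By unbiasedness the cross term cancels the `|⟨ψ|M|ψ⟩|²` of the second moment. -/
lemma sum_norm_pairEstimate_sub_sq_le [Fintype (Clifford n)] {k : ℕ} (hn : 1 ≤ n) (hk : k ≤ n)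
    {M : Matrix (Qubits n) (Qubits n) ℂ} (hM : M.IsHermitian) {ψ : Qubits n → ℂ}
    (hψ : lenSq ψ = 1) :
    ∑ C₁, ∑ C₂, ‖pairEstimate k M ψ C₁ C₂ - star ψ ⬝ᵥ (M *ᵥ ψ)‖ ^ 2 ≤
      (Fintype.card (Clifford n) : ℝ) ^ 2 *
        (2 * lenSq (M *ᵥ ψ) / 2 ^ k + (∑ i, ∑ j, ‖M i j‖ ^ 2) / (2 ^ k) ^ 2) := by
  set μ := star ψ ⬝ᵥ (M *ᵥ ψ) with hμ
  have h1 := sum_norm_pairEstimate_sq_le hn hk hM hψ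
  have h2 := sum_pairEstimate k M ψ
  have e : ∀ z : ℂ, ‖z - μ‖ ^ 2 = ‖z‖ ^ 2 - 2 * (z * star μ).re + ‖μ‖ ^ 2 := by
    intro z
    rw [← Complex.normSq_eq_norm_sq, ← Complex.normSq_eq_norm_sq, ← Complex.normSq_eq_norm_sq,
      Complex.normSq_sub]
    simp only [Complex.star_def]
    ring
  simp only [e, Finset.sum_add_distrib, Finset.sum_sub_distrib, ← Finset.mul_sum, Finset.sum_const,
    Finset.card_univ, nsmul_eq_mul]
  have h3 : ∑ C₁, ∑ C₂, (pairEstimate k M ψ C₁ C₂ * star μ).re =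
      (Fintype.card (Clifford n) : ℝ) ^ 2 * ‖μ‖ ^ 2 := by
    simp only [← Complex.re_sum, ← Finset.sum_mul]
    rw [h2, mul_assoc, ← norm_sq_eq_mul_star]
    norm_cast
  rw [h3]
  rw [← hμ] at h1
  nlinarith [h1]

/-! ### Bounds on the observable -/

lemma norm_sq_toLp (v : Qubits n → ℂ) : ‖WithLp.toLp 2 v‖ ^ 2 = lenSq v := by
  rw [EuclideanSpace.norm_sq_eq]; rfl

lemma norm_sq_ofLp (ψ : EuclideanSpace ℂ (Qubits n)) : lenSq ψ.ofLp = ‖ψ‖ ^ 2 := by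
  rw [EuclideanSpace.norm_sq_eq]; rfl

lemma norm_dotProduct_le (v w : Qubits n → ℂ) :
    ‖star v ⬝ᵥ w‖ ≤ Real.sqrt (lenSq v) * Real.sqrt (lenSq w) := by
  have h := norm_inner_le_norm (𝕜 := ℂ) (WithLp.toLp 2 v) (WithLp.toLp 2 w)
  rw [EuclideanSpace.inner_eq_star_dotProduct, dotProduct_comm] at h
  rwa [← norm_sq_toLp v, ← norm_sq_toLp w, Real.sqrt_sq (norm_nonneg _),
    Real.sqrt_sq (norm_nonneg _)]

lemma lenSq_mulVec_le {M : Matrix (Qubits n) (Qubits n) ℂ}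
    (hM : ‖Matrix.toEuclideanCLM (n := Qubits n) (𝕜 := ℂ) M‖ ≤ 1) (v : Qubits n → ℂ) :
    lenSq (M *ᵥ v) ≤ lenSq v := by
  have h := (Matrix.toEuclideanCLM (n := Qubits n) (𝕜 := ℂ) M).le_of_opNorm_le hM
    (WithLp.toLp 2 v)
  rw [Matrix.toEuclideanCLM_toLp, one_mul] at h
  rw [← norm_sq_toLp, ← norm_sq_toLp]
  exact pow_le_pow_left₀ (norm_nonneg _) h 2

/-- The squared Frobenius norm is the sum of the squared eigenvalues. Each is at most one, and the
number of nonzero ones is the rank. -/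
lemma sum_norm_entries_sq_le {M : Matrix (Qubits n) (Qubits n) ℂ} (hM : M.IsHermitian)
    (hM1 : ‖Matrix.toEuclideanCLM (n := Qubits n) (𝕜 := ℂ) M‖ ≤ 1) :
    ∑ i, ∑ j, ‖M i j‖ ^ 2 ≤ M.rank := by
  have htr : (∑ i, ∑ j, ‖M i j‖ ^ 2 : ℝ) = ∑ i, hM.eigenvalues i ^ 2 := by
    have h1 : ((∑ i, ∑ j, ‖M i j‖ ^ 2 : ℝ) : ℂ) = (M * M).trace := by
      rw [Matrix.trace]
      push_cast
      refine Finset.sum_congr rfl fun i _ => ?_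
      rw [Matrix.diag_apply, Matrix.mul_apply]
      refine Finset.sum_congr rfl fun j _ => ?_
      have h2 := norm_sq_eq_mul_star (M i j)
      push_cast at h2
      rw [h2]
      congr 1
      exact hM.apply j i
    have h2 : (M * M).trace = ((∑ i, hM.eigenvalues i ^ 2 : ℝ) : ℂ) := by
      conv_lhs => rw [hM.spectral_theorem, ← map_mul, Unitary.conjStarAlgAut_apply,
        Matrix.trace_mul_cycle]
      simp [Matrix.trace_diagonal, sq]
    exact_mod_cast h1.trans h2
  rw [htr, hM.rank_eq_card_non_zero_eigs, Fintype.card_subtype, Finset.card_filter]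
  push_cast
  refine Finset.sum_le_sum fun i _ => ?_
  split_ifs with h
  · have h1 := lenSq_mulVec_le hM1 (hM.eigenvectorBasis i).ofLp
    have h2 : lenSq (hM.eigenvectorBasis i).ofLp = 1 := by
      rw [norm_sq_ofLp, hM.eigenvectorBasis.orthonormal.1 i, one_pow]
    rw [hM.mulVec_eigenvectorBasis i] at h1
    have h3 : lenSq (hM.eigenvalues i • (hM.eigenvectorBasis i).ofLp) =
        hM.eigenvalues i ^ 2 * lenSq (hM.eigenvectorBasis i).ofLp := by
      simp only [lenSq, Pi.smul_apply, norm_smul, mul_pow, Finset.mul_sum, Real.norm_eq_abs, sq_abs]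
    rw [h3, h2, mul_one] at h1
    exact h1
  · have : hM.eigenvalues i = 0 := by simpa using h
    rw [this]; norm_num

/-- Perturbation of a matrix element by small perturbations of the vectors. -/
lemma norm_matrixElement_sub_le {M : Matrix (Qubits n) (Qubits n) ℂ}
    (hM1 : ‖Matrix.toEuclideanCLM (n := Qubits n) (𝕜 := ℂ) M‖ ≤ 1) {η : ℝ} (hη : 0 ≤ η)
    (hη1 : η ≤ 1) {v w v' w' : Qubits n → ℂ} (hv : lenSq v ≤ 1) (hw : lenSq w ≤ 1)
    (hv' : lenSq (v' - v) ≤ η ^ 2) (hw' : lenSq (w' - w) ≤ η ^ 2) :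
    ‖star v' ⬝ᵥ (M *ᵥ w') - star v ⬝ᵥ (M *ᵥ w)‖ ≤ 3 * η := by
  have e : star v' ⬝ᵥ (M *ᵥ w') - star v ⬝ᵥ (M *ᵥ w) =
      star (v' - v) ⬝ᵥ (M *ᵥ (w' - w)) + star (v' - v) ⬝ᵥ (M *ᵥ w) +
        star v ⬝ᵥ (M *ᵥ (w' - w)) := by
    rw [star_sub, Matrix.mulVec_sub]
    simp only [sub_dotProduct, dotProduct_sub]
    ring
  have hle : ∀ {x y : Qubits n → ℂ} {a b : ℝ}, 0 ≤ a → 0 ≤ b → lenSq x ≤ a ^ 2 →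
      lenSq y ≤ b ^ 2 → ‖star x ⬝ᵥ (M *ᵥ y)‖ ≤ a * b := by
    intro x y a b ha hb hx hy
    refine (norm_dotProduct_le _ _).trans (mul_le_mul ?_ ?_ (Real.sqrt_nonneg _) ha)
    · exact Real.sqrt_le_iff.2 ⟨ha, hx⟩
    · exact Real.sqrt_le_iff.2 ⟨hb, (lenSq_mulVec_le hM1 y).trans hy⟩
  have hv1 : lenSq v ≤ 1 ^ 2 := by rwa [one_pow]
  have hw1 : lenSq w ≤ 1 ^ 2 := by rwa [one_pow]
  rw [e]
  refine (norm_add₃_le).trans ?_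
  have h1 := hle hη hη hv' hw'
  have h2 := hle hη zero_le_one hv' hw1
  have h3 := hle zero_le_one hη hv1 hw'
  nlinarith

/-! ### Reconstruction from approximate amplitudes -/

/-- The vector `∑ z, amp z |0^(n-k) z⟩`. -/
noncomputable def Sketch.vec {k : ℕ} (S : Sketch n k) : Qubits n → ℂ :=
  fun u => if h : ketIndex u < 2 ^ k then S.amp ⟨ketIndex u, h⟩ else 0

/-- `C†` is an isometry, so the componentwise error, at most `δ²` for each of the real and imaginary
parts, is not amplified. -/
lemma Sketch.lenSq_sub_projVec_le {k : ℕ} (hk : k ≤ n) {S : Sketch n k} {C : Clifford n}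
    {ψ : EuclideanSpace ℂ (Qubits n)} {len : ℕ} {δ : ℝ} (h : S.Describes C ψ len δ) :
    lenSq (C.1ᴴ *ᵥ S.vec - projVec k C ψ.ofLp) ≤ 2 ^ n * (2 * δ ^ 2) := by
  rw [projVec, ← Matrix.mulVec_sub, lenSq_mulVec_unitary C.conjTranspose_unitary]
  calc _ ≤ ∑ _u : Qubits n, 2 * δ ^ 2 := by
        refine Finset.sum_le_sum fun u _ => ?_
        simp only [Pi.sub_apply, Sketch.vec, isLow_iff hk]
        split_ifs with hu
        · obtain ⟨h1, h2⟩ := h.2.2 ⟨ketIndex u, hu⟩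
          have e : amplitude C ψ (ketIndex u) = (C.1 *ᵥ ψ.ofLp) u := by
            rw [amplitude, ket_ketIndex]
          simp only [e] at h1 h2
          rw [← Complex.normSq_eq_norm_sq, Complex.normSq_apply, Complex.sub_re, Complex.sub_im]
          have h3 := sq_le_sq' (abs_le.1 h1).1 (abs_le.1 h1).2
          have h4 := sq_le_sq' (abs_le.1 h2).1 (abs_le.1 h2).2
          nlinarith
        · simp; positivity
    _ = _ := by simp

/-! ### Concentration of the median -/

/-- The number of pairs of sketches for failure probability `p`. -/
noncomputable def pairCount (p : ℝ) : ℕ := ⌈5 * Real.log p⁻¹⌉₊ + 1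

lemma four_fifths_pow_pairCount_le {p : ℝ} (hp : 0 < p) : (4 / 5 : ℝ) ^ pairCount p ≤ p := by
  -- This bound explains the 5 in `pairCount`: `log (5/4) ≥ 1/5`.
  have hlog : (1 / 5 : ℝ) ≤ Real.log (5 / 4) := by
    have := Real.one_sub_inv_le_log_of_pos (show (0 : ℝ) < 5 / 4 by norm_num)
    norm_num at this ⊢
    linarith
  have hL : 5 * Real.log p⁻¹ ≤ pairCount p := by
    rw [pairCount]; push_cast
    linarith [Nat.le_ceil (5 * Real.log p⁻¹)]
  have hpos : (0 : ℝ) < (4 / 5) ^ pairCount p := by positivity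
  rw [← Real.log_le_log_iff hpos hp, Real.log_pow,
    show (4 / 5 : ℝ) = (5 / 4)⁻¹ by norm_num, Real.log_inv]
  rw [Real.log_inv] at hL
  have : (0 : ℝ) ≤ pairCount p := Nat.cast_nonneg _
  nlinarith

/-- The members of the `i`-th pair in a family of even size. -/
def pairFst {α : Type*} {L : ℕ} (C : Fin (L * 2) → α) (i : Fin L) : α := C (finProdFinEquiv (i, 0))

/-- The members of the `i`-th pair in a family of even size. -/
def pairSnd {α : Type*} {L : ℕ} (C : Fin (L * 2) → α) (i : Fin L) : α := C (finProdFinEquiv (i, 1))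

/-- Independence of disjoint pairs: sums over families factorise. -/
lemma sum_prod_pairs {α : Type*} [Fintype α] (L : ℕ) (f : α → α → ℝ) :
    ∑ C : Fin (L * 2) → α, ∏ i, f (pairFst C i) (pairSnd C i) = (∑ a, ∑ b, f a b) ^ L := by
  classical
  let e : (Fin (L * 2) → α) ≃ (Fin L → α × α) :=
    ((Equiv.arrowCongr finProdFinEquiv.symm (Equiv.refl α)).trans
      (Equiv.curry (Fin L) (Fin 2) α)).trans
      (Equiv.arrowCongr (Equiv.refl _) (finTwoArrowEquiv α))
  have h1 : ∑ C : Fin (L * 2) → α, ∏ i, f (pairFst C i) (pairSnd C i) =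
      ∑ D : Fin L → α × α, ∏ i, f (D i).1 (D i).2 := by
    rw [← e.sum_comp]
    refine Finset.sum_congr rfl fun C _ => Finset.prod_congr rfl fun i _ => rfl
  rw [h1, ← Fintype.sum_prod_type' f]
  have h2 := Finset.prod_univ_sum (fun _ : Fin L => (Finset.univ : Finset (α × α)))
    fun _ x => f x.1 x.2
  rw [Fintype.piFinset_univ] at h2
  rw [← h2]
  simp

-- A Chernoff bound with weight 4 for each bad pair. The mean weight is at most `1 + 3/5 = 8/5` per
-- pair, while a family in which at least half of the pairs are bad has weight at least `4^(L/2) =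
-- 2^L`.
open Classical in
lemma card_majority_bad_le {α : Type*} [Fintype α] (L : ℕ) (Bad : α → α → Prop)
    (h : 5 * ∑ a, ∑ b, (if Bad a b then (1 : ℝ) else 0) ≤ (Fintype.card α : ℝ) ^ 2) :
    ((Finset.univ.filter fun C : Fin (L * 2) → α =>
      L ≤ 2 * (Finset.univ.filter fun i => Bad (pairFst C i) (pairSnd C i)).card).card : ℝ) ≤
      (4 / 5) ^ L * (Fintype.card α : ℝ) ^ (L * 2) := by
  set f : α → α → ℝ := fun a b => if Bad a b then 4 else 1 with hf
  have hsum : ∑ a, ∑ b, f a b ≤ 8 / 5 * (Fintype.card α : ℝ) ^ 2 := by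
    have e : ∀ a b, f a b = 3 * (if Bad a b then (1 : ℝ) else 0) + 1 := fun a b => by
      simp only [hf]; split_ifs <;> norm_num
    simp only [e, Finset.sum_add_distrib, ← Finset.mul_sum, Finset.sum_const, Finset.card_univ,
      nsmul_eq_mul, mul_one]
    nlinarith
  have hf0 : ∀ a b, 0 ≤ f a b := fun a b => by simp only [hf]; split_ifs <;> norm_num
  have hprod : ∀ C : Fin (L * 2) → α, ∏ i, f (pairFst C i) (pairSnd C i) =
      4 ^ (Finset.univ.filter fun i => Bad (pairFst C i) (pairSnd C i)).card := fun C => by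
    rw [← Finset.prod_filter_mul_prod_filter_not Finset.univ
      (fun i => Bad (pairFst C i) (pairSnd C i)),
      Finset.prod_congr rfl (g := fun _ => (4 : ℝ)), Finset.prod_const, Finset.prod_eq_one, mul_one]
    · intro i hi; simp [hf, (Finset.mem_filter.1 hi).2]
    · intro i hi; simp [hf, (Finset.mem_filter.1 hi).2]
  have key : ((Finset.univ.filter fun C : Fin (L * 2) → α =>
      L ≤ 2 * (Finset.univ.filter fun i => Bad (pairFst C i) (pairSnd C i)).card).card : ℝ) *
        2 ^ L ≤ (∑ a, ∑ b, f a b) ^ L := by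
    rw [← sum_prod_pairs, ← nsmul_eq_mul]
    refine (Finset.card_nsmul_le_sum _ _ _ fun C hC => ?_).trans
      (Finset.sum_le_univ_sum_of_nonneg fun C => Finset.prod_nonneg fun i _ => hf0 _ _)
    rw [hprod, show (4 : ℝ) = 2 ^ 2 by norm_num, ← pow_mul]
    exact pow_le_pow_right₀ (by norm_num) (Finset.mem_filter.1 hC).2
  have h2 : (∑ a, ∑ b, f a b) ^ L ≤ (8 / 5 * (Fintype.card α : ℝ) ^ 2) ^ L :=
    pow_le_pow_left₀ (Finset.sum_nonneg fun a _ => Finset.sum_nonneg fun b _ => hf0 a b) hsum L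
  have h3 : (8 / 5 * (Fintype.card α : ℝ) ^ 2) ^ L =
      ((4 / 5) ^ L * (Fintype.card α : ℝ) ^ (L * 2)) * 2 ^ L := by
    rw [mul_comm L 2, pow_mul, ← mul_pow, ← mul_pow]; congr 1; ring
  exact le_of_mul_le_mul_right ((key.trans h2).trans_eq h3) (by positivity)

/-! ### From counting families to probabilities of independent random Cliffords. -/

lemma isProbabilityMeasure_uniformOn_clifford (hn : 1 ≤ n) :
    IsProbabilityMeasure (uniformOn (Set.univ : Set (Clifford n))) := by
  have := finite_clifford hn
  exact isProbabilityMeasure_uniformOn Set.finite_univ ⟨⟨1, [], rfl⟩, trivial⟩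

lemma iidCliffords_finset [Fintype (Clifford n)] (N : ℕ) (s : Finset (Fin N → Clifford n)) :
    iidCliffords n N s = s.card / (Fintype.card (Clifford n) : ENNReal) ^ N := by
  have hsingle : ∀ C : Fin N → Clifford n, iidCliffords n N {C} =
      ((Fintype.card (Clifford n) : ENNReal) ^ N)⁻¹ := by
    intro C
    have : ∀ c : Clifford n, uniformOn Set.univ {c} = (Fintype.card (Clifford n) : ENNReal)⁻¹ := by
      intro c
      rw [uniformOn_univ, Measure.count_singleton, one_div]
    rw [iidCliffords, Measure.pi_singleton]
    simp [this, ENNReal.inv_pow]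
  rw [← sum_measure_singleton]
  simp [hsingle, div_eq_mul_inv]

open Classical in
/-- With probability at least `1 - p`, more than half of the pairs are good. -/
lemma iidCliffords_majority_ge (hn : 1 ≤ n) (Bad : Clifford n → Clifford n → Prop)
    (h : ∀ [Fintype (Clifford n)], 5 * ∑ a, ∑ b, (if Bad a b then (1 : ℝ) else 0) ≤
      (Fintype.card (Clifford n) : ℝ) ^ 2) {p : ℝ} (hp : 0 < p) :
    ENNReal.ofReal (1 - p) ≤ iidCliffords n (pairCount p * 2)
      {C | 2 * (Finset.univ.filter fun i => Bad (pairFst C i) (pairSnd C i)).card <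
        pairCount p} := by
  have := finite_clifford hn
  have := Fintype.ofFinite (Clifford n)
  have := isProbabilityMeasure_uniformOn_clifford hn
  have : IsProbabilityMeasure (iidCliffords n (pairCount p * 2)) := by
    rw [iidCliffords]; infer_instance
  set s : Finset (Fin (pairCount p * 2) → Clifford n) := Finset.univ.filter fun C =>
    pairCount p ≤ 2 * (Finset.univ.filter fun i => Bad (pairFst C i) (pairSnd C i)).card with hs
  have hcompl : {C : Fin (pairCount p * 2) → Clifford n |
      2 * (Finset.univ.filter fun i => Bad (pairFst C i) (pairSnd C i)).card < pairCount p} =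
      (s : Set (Fin (pairCount p * 2) → Clifford n))ᶜ := by
    ext C; simp [hs]
  rw [hcompl, prob_compl_eq_one_sub s.measurableSet, ENNReal.ofReal_sub _ hp.le, ENNReal.ofReal_one]
  refine tsub_le_tsub_left ?_ _
  have hg : (0 : ℝ) < Fintype.card (Clifford n) := by
    have : Nonempty (Clifford n) := ⟨⟨1, [], rfl⟩⟩
    exact_mod_cast Fintype.card_pos
  have hcard := card_majority_bad_le (pairCount p) Bad h
  rw [iidCliffords_finset]
  refine ENNReal.div_le_of_le_mul ?_
  have e : ENNReal.ofReal p * (Fintype.card (Clifford n) : ENNReal) ^ (pairCount p * 2) =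
      ENNReal.ofReal (p * (Fintype.card (Clifford n) : ℝ) ^ (pairCount p * 2)) := by
    rw [ENNReal.ofReal_mul hp.le, ENNReal.ofReal_pow hg.le, ENNReal.ofReal_natCast]
  rw [e, ← ENNReal.ofReal_natCast]
  refine ENNReal.ofReal_le_ofReal ?_
  refine (le_trans ?_ hcard).trans
    (mul_le_mul_of_nonneg_right (four_fifths_pow_pairCount_le hp) (by positivity))
  exact le_of_eq rfl

/-! ### Bit arithmetic -/

/-- Setting a clear bit causes no carry. For higher bits the number is split at place `l + 1`, and
the low part stays below `2^(l+1)`. -/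
lemma testBit_add_two_pow {m l : ℕ} (h : m.testBit l = false) (i : ℕ) :
    (m + 2 ^ l).testBit i = if i = l then true else m.testBit i := by
  rw [add_comm]
  rcases lt_trichotomy i l with hi | rfl | hi
  · rw [if_neg hi.ne, Nat.testBit_two_pow_add_gt hi]
  · rw [if_pos rfl, Nat.testBit_two_pow_add_eq, h]; rfl
  · rw [if_neg hi.ne']
    have hlo : m % 2 ^ (l + 1) < 2 ^ (l + 1) := Nat.mod_lt _ (by positivity)
    have hlo' : m % 2 ^ (l + 1) < 2 ^ l := by
      by_contra! hge
      have h1 := Nat.testBit_of_two_pow_le_and_two_pow_add_one_gt hge hlo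
      rw [Nat.testBit_mod_two_pow] at h1
      simp [h] at h1
    have hm : m = 2 ^ (l + 1) * (m / 2 ^ (l + 1)) + m % 2 ^ (l + 1) := (Nat.div_add_mod _ _).symm
    have h2 : 2 ^ l + m = 2 ^ (l + 1) * (m / 2 ^ (l + 1)) + (2 ^ l + m % 2 ^ (l + 1)) := by omega
    have h3 : 2 ^ l + m % 2 ^ (l + 1) < 2 ^ (l + 1) := by
      have := pow_succ 2 l
      omega
    rw [h2, Nat.testBit_two_pow_mul_add _ h3, if_neg (by omega)]
    conv_rhs => rw [hm]
    rw [Nat.testBit_two_pow_mul_add _ hlo, if_neg (by omega)]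

/-- The place of a qubit in the binary expansion of a basis label. -/
def bitPlace (q : Fin n) : ℕ := n - (q + 1)

lemma bitPlace_lt (q : Fin n) : bitPlace q < n := by
  have := q.isLt; rw [bitPlace]; omega

lemma ket_apply (m : ℕ) (q : Fin n) : ket n m q = m.testBit (bitPlace q) := by
  rw [ket, Fin.val_rev, bitPlace]

lemma bitPlace_inj {q q' : Fin n} (h : bitPlace q = bitPlace q') : q = q' := by
  rw [bitPlace, bitPlace] at h
  ext; omega

lemma add_two_pow_lt {m l : ℕ} (hm : m < 2 ^ n) (hl : l < n) (h : m.testBit l = false) :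
    m + 2 ^ l < 2 ^ n := by
  refine Nat.lt_pow_two_of_testBit _ fun i hi => ?_
  rw [testBit_add_two_pow h, if_neg (by omega)]
  exact Nat.testBit_lt_two_pow (hm.trans_le (Nat.pow_le_pow_right (by norm_num) hi))

lemma ket_add {m : ℕ} {q : Fin n} (h : ket n m q = false) :
    ket n (m + 2 ^ bitPlace q) = Function.update (ket n m) q true := by
  rw [ket_apply] at h
  ext q'
  rw [ket_apply, testBit_add_two_pow h]
  by_cases hq : q' = q
  · subst hq; simp
  · rw [Function.update_of_ne hq, if_neg fun h => hq (bitPlace_inj h), ket_apply]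

lemma two_pow_le_of_ket {m : ℕ} {q : Fin n} (h : ket n m q = true) : 2 ^ bitPlace q ≤ m := by
  rw [ket_apply] at h
  exact Nat.ge_two_pow_of_testBit h

lemma ket_sub {m : ℕ} {q : Fin n} (h : ket n m q = true) :
    ket n (m - 2 ^ bitPlace q) = Function.update (ket n m) q false := by
  have hle := two_pow_le_of_ket h
  have h0 : ket n (m - 2 ^ bitPlace q) q = false := by
    rw [ket_apply] at h ⊢
    have := Nat.testBit_two_pow_add_eq (m - 2 ^ bitPlace q) (bitPlace q)
    rw [Nat.add_sub_cancel' hle, h] at this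
    simpa using this
  have h1 := ket_add h0
  rw [Nat.sub_add_cancel hle] at h1
  rw [h1, Function.update_idem, ← h0, Function.update_eq_self]

/-! ### Reasoning about programs -/

/-- The program halts after at most `T` operations, in a memory that satisfies `Q`. -/
def Runs (P : Program) (s : Memory) (T : ℕ) (Q : Memory → Prop) : Prop :=
  ∃ t s', Exec P s t s' ∧ t ≤ T ∧ Q s'

/-- Overwrite a natural number in the memory. -/
def Memory.setNat (s : Memory) (a i j v : ℕ) : Memory :=
  { s with nat := overwrite s.nat a i j v }

/-- Overwrite a real number in the memory. -/
def Memory.setReal (s : Memory) (a i j : ℕ) (v : ℝ) : Memory :=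
  { s with real := overwrite s.real a i j v }

@[simp] lemma Memory.setNat_real (s : Memory) (a i j v : ℕ) :
    (s.setNat a i j v).real = s.real := rfl

@[simp] lemma Memory.setReal_nat (s : Memory) (a i j : ℕ) (v : ℝ) :
    (s.setReal a i j v).nat = s.nat := rfl

lemma Memory.setNat_nat (s : Memory) (a i j v a' i' j' : ℕ) :
    (s.setNat a i j v).nat a' i' j' = if a' = a ∧ i' = i ∧ j' = j then v else s.nat a' i' j' := rfl

lemma Memory.setReal_real (s : Memory) (a i j : ℕ) (v : ℝ) (a' i' j' : ℕ) :
    (s.setReal a i j v).real a' i' j' = if a' = a ∧ i' = i ∧ j' = j then v else s.real a' i' j' :=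
  rfl

lemma Memory.setNat_nat_of_ne (s : Memory) {a a' : ℕ} (i j v : ℕ) (h : a' ≠ a) :
    (s.setNat a i j v).nat a' = s.nat a' := by
  funext i' j'; simp [Memory.setNat_nat, h]

lemma Memory.setReal_real_of_ne (s : Memory) {a a' : ℕ} (i j : ℕ) (v : ℝ) (h : a' ≠ a) :
    (s.setReal a i j v).real a' = s.real a' := by
  funext i' j'; simp [Memory.setReal_real, h]

lemma Runs.mono {P : Program} {s : Memory} {T T' : ℕ} {Q Q' : Memory → Prop} (h : Runs P s T Q)
    (hT : T ≤ T') (hQ : ∀ s', Q s' → Q' s') : Runs P s T' Q' := by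
  obtain ⟨t, s', he, ht, hs⟩ := h
  exact ⟨t, s', he, ht.trans hT, hQ s' hs⟩

lemma Runs.seq {P P' : Program} {s : Memory} {T T' : ℕ} {Q Q' : Memory → Prop} (h : Runs P s T Q)
    (h' : ∀ s', Q s' → Runs P' s' T' Q') : Runs (.seq P P') s (T + T') Q' := by
  obtain ⟨t, s', he, ht, hs⟩ := h
  obtain ⟨t', s'', he', ht', hs'⟩ := h' s' hs
  exact ⟨t + t', s'', he.seq he', add_le_add ht ht', hs'⟩

lemma Runs.skip {s : Memory} {Q : Memory → Prop} (h : Q s) : Runs .skip s 1 Q :=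
  ⟨1, s, .skip s, le_rfl, h⟩

lemma Runs.writeNat {a : ℕ} {i j e : NatExpr} {s : Memory} {Q : Memory → Prop}
    (h : Q (s.setNat a (i.eval s) (j.eval s) (e.eval s))) :
    Runs (.writeNat a i j e) s (i.cost + j.cost + e.cost + 1) Q :=
  ⟨_, _, .writeNat a i j e s, le_rfl, h⟩

lemma Runs.writeReal {a : ℕ} {i j : NatExpr} {e : RealExpr} {s : Memory} {Q : Memory → Prop}
    (h : Q (s.setReal a (i.eval s) (j.eval s) (e.eval s))) :
    Runs (.writeReal a i j e) s (i.cost + j.cost + e.cost + 1) Q :=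
  ⟨_, _, .writeReal a i j e s, le_rfl, h⟩

lemma Runs.branch {b : Test} {P P' : Program} {s : Memory} {T : ℕ} {Q : Memory → Prop}
    (h : b.Holds s → Runs P s T Q) (h' : ¬ b.Holds s → Runs P' s T Q) :
    Runs (.branch b P P') s (b.cost + T + 1) Q := by
  by_cases hb : b.Holds s
  · obtain ⟨t, s', he, ht, hs⟩ := h hb
    exact ⟨_, s', .branchTrue hb he, by omega, hs⟩
  · obtain ⟨t, s', he, ht, hs⟩ := h' hb
    exact ⟨_, s', .branchFalse hb he, by omega, hs⟩

/-- The invariant is indexed by the number of completed rounds. The extra `b.cost + 1` pays for the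
final failing test. -/
lemma Runs.loop {b : Test} {P : Program} {s : Memory} {T m : ℕ} (Inv : ℕ → Memory → Prop)
    (h0 : Inv 0 s)
    (hstep : ∀ i < m, ∀ s', Inv i s' → b.Holds s' ∧ Runs P s' T (Inv (i + 1)))
    (hend : ∀ s', Inv m s' → ¬ b.Holds s') :
    Runs (.loop b P) s (m * (T + b.cost + 1) + (b.cost + 1)) (Inv m) := by
  have key : ∀ d i s, i + d = m → Inv i s →
      Runs (.loop b P) s (d * (T + b.cost + 1) + (b.cost + 1)) (Inv m) := by
    intro d
    induction d with
    | zero =>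
      intro i s hi hs
      rw [add_zero] at hi
      subst hi
      exact ⟨_, s, .loopFalse (hend s hs), by simp, hs⟩
    | succ d ih =>
      intro i s hi hs
      obtain ⟨hb, t, s', he, ht, hs'⟩ := hstep i (by omega) s hs
      obtain ⟨t', s'', he', ht', hs''⟩ := ih (i + 1) s' (by omega) hs'
      refine ⟨_, s'', .loopTrue hb he he', ?_, hs''⟩
      rw [add_mul, one_mul]; omega
  exact key m 0 s (by omega) h0

/-- `s'` agrees with `s` outside of the arrays of natural numbers in `ns` and the arrays of real
numbers in `rs`. -/
structure Frame (ns rs : List ℕ) (s s' : Memory) : Prop where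
  nat : ∀ a, a ∉ ns → s'.nat a = s.nat a
  real : ∀ a, a ∉ rs → s'.real a = s.real a

lemma Frame.refl (ns rs : List ℕ) (s : Memory) : Frame ns rs s s := ⟨fun _ _ => rfl, fun _ _ => rfl⟩

lemma Frame.trans {ns rs : List ℕ} {s s' s'' : Memory} (h : Frame ns rs s s')
    (h' : Frame ns rs s' s'') : Frame ns rs s s'' :=
  ⟨fun a ha => (h'.nat a ha).trans (h.nat a ha), fun a ha => (h'.real a ha).trans (h.real a ha)⟩

lemma Frame.mono {ns rs ns' rs' : List ℕ} {s s' : Memory} (h : Frame ns rs s s') (hn : ns ⊆ ns')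
    (hr : rs ⊆ rs') : Frame ns' rs' s s' :=
  ⟨fun a ha => h.nat a fun h' => ha (hn h'), fun a ha => h.real a fun h' => ha (hr h')⟩

lemma Frame.setNat {ns rs : List ℕ} {s s' : Memory} (h : Frame ns rs s s') {a : ℕ} (ha : a ∈ ns)
    (i j v : ℕ) : Frame ns rs s (s'.setNat a i j v) :=
  ⟨fun b hb => by
    have hne : b ≠ a := by rintro rfl; exact hb ha
    rw [Memory.setNat_nat_of_ne _ _ _ _ hne, h.nat b hb], h.real⟩

lemma Frame.setReal {ns rs : List ℕ} {s s' : Memory} (h : Frame ns rs s s') {a : ℕ} (ha : a ∈ rs)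
    (i j : ℕ) (v : ℝ) : Frame ns rs s (s'.setReal a i j v) :=
  ⟨h.nat, fun b hb => by
    have hne : b ≠ a := by rintro rfl; exact hb ha
    rw [Memory.setReal_real_of_ne _ _ _ _ hne, h.real b hb]⟩

/-- The scalar variable in cell `(0, 0)` of an array. -/
def NatExpr.var (a : ℕ) : NatExpr := .read a (.const 0) (.const 0)

/-- The scalar variable in cell `(0, 0)` of an array. -/
def RealExpr.var (a : ℕ) : RealExpr := .read a (.const 0) (.const 0)

@[simp] lemma NatExpr.eval_var (s : Memory) (a : ℕ) : (NatExpr.var a).eval s = s.nat a 0 0 := rfl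

@[simp] lemma RealExpr.eval_var (s : Memory) (a : ℕ) : (RealExpr.var a).eval s = s.real a 0 0 := rfl

/-- Repetition of `body` for the values `0, 1, …` of the variable `x`, as long as
`c * (x + 1) ≤ bound`. -/
def Program.forLoop (x c : ℕ) (bound : NatExpr) (body : Program) : Program :=
  .seq (.writeNat x (.const 0) (.const 0) (.const 0))
    (.loop (.natLE (.mul (.const c) (.add (.var x) (.const 1))) bound)
      (.seq body (.writeNat x (.const 0) (.const 0) (.add (.var x) (.const 1)))))

/-- The invariant must not depend on the counter (`hI`) and the body must not write to it (`hx`). A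
step `c = 2` lets a bound of `2L` give `L` rounds without division. The constant 40 covers the
handling of the counter. -/
lemma Runs.forLoop {x c : ℕ} {bound : NatExpr} {body : Program} {s : Memory} {m T : ℕ}
    {ns rs : List ℕ} (hc : 0 < c) (hx : x ∉ ns) (I : ℕ → Memory → Prop)
    (hI : ∀ i s' v, I i s' → I i (s'.setNat x 0 0 v))
    (hbound : ∀ s', Frame (x :: ns) rs s s' → bound.eval s' = c * m)
    (h0 : I 0 s)
    (hstep : ∀ i < m, ∀ s', Frame (x :: ns) rs s s' → s'.nat x 0 0 = i → I i s' →
      Runs body s' T fun s'' => Frame ns rs s' s'' ∧ I (i + 1) s'') :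
    Runs (.forLoop x c bound body) s ((m + 1) * (T + bound.cost + 40)) fun s' =>
      Frame (x :: ns) rs s s' ∧ I m s' := by
  set Inv : ℕ → Memory → Prop := fun i s' => (Frame (x :: ns) rs s s' ∧ I i s') ∧ s'.nat x 0 0 = i
    with hInv
  set b : Test := .natLE (.mul (.const c) (.add (.var x) (.const 1))) bound with hb
  have hbc : b.cost = 8 + bound.cost := by
    simp only [hb, Test.cost, NatExpr.cost, NatExpr.var]; omega
  have hholds : ∀ i s', Inv i s' → (b.Holds s' ↔ i < m) := by
    rintro i s' ⟨⟨hF, -⟩, hx'⟩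
    simp only [hb, Test.Holds, NatExpr.eval, NatExpr.eval_var, hbound s' hF, hx']
    rw [mul_le_mul_iff_right₀ hc]; rfl
  have hwrite : ∀ i s', Frame (x :: ns) rs s s' → I i s' → Inv i (s'.setNat x 0 0 i) := by
    intro i s' hF hIs
    exact ⟨⟨hF.setNat (List.mem_cons_self) _ _ _, hI i s' i hIs⟩, by simp [Memory.setNat_nat]⟩
  have hloop : ∀ s', Inv 0 s' → Runs (.loop b (.seq body
      (.writeNat x (.const 0) (.const 0) (.add (.var x) (.const 1))))) s'
      (m * ((T + 8) + b.cost + 1) + (b.cost + 1)) (Inv m) := by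
    intro s' hs'
    refine Runs.loop Inv hs' ?_ fun s'' hs'' => by rw [hholds m s'' hs'']; exact lt_irrefl m
    intro i hi s'' hs''
    refine ⟨(hholds i s'' hs'').2 hi, ?_⟩
    obtain ⟨⟨hF, hIs⟩, hx'⟩ := hs''
    refine Runs.seq (hstep i hi s'' hF hx' hIs) ?_
    rintro s₃ ⟨hF₃, hI₃⟩
    refine Runs.writeNat (e := .add (.var x) (.const 1)) ?_
    have hx₃ : s₃.nat x 0 0 = i := by rw [hF₃.nat x hx, hx']
    simp only [NatExpr.eval, NatExpr.eval_var, hx₃]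
    exact hwrite (i + 1) s₃ (hF.trans (hF₃.mono (List.subset_cons_self _ _) (List.Subset.refl _)))
      hI₃
  refine ((Runs.writeNat (Q := Inv 0) ?_).seq hloop).mono ?_ fun s' hs' => hs'.1
  · exact hwrite 0 s (Frame.refl _ _ _) h0
  · simp only [NatExpr.cost, hbc]
    have : (m + 1) * (T + bound.cost + 40) = m * (T + bound.cost + 40) + (T + bound.cost + 40) := by
      ring
    have h2 : m * (T + 8 + (8 + bound.cost) + 1) ≤ m * (T + bound.cost + 40) :=
      Nat.mul_le_mul_left _ (by omega)
    omega

/-! ### Tables of powers of two and of binary digits -/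

open NatExpr in
/-- Natural number array 6 holds the powers of two. -/
def powersProgram : Program :=
  .seq (.writeNat 6 (const 0) (const 0) (const 1))
    (.forLoop 10 1 (var 0) (.writeNat 6 (add (var 10) (const 1)) (const 0)
      (add (read 6 (var 10) (const 0)) (read 6 (var 10) (const 0)))))

/-- The dimension `2 ^ n`, read from the table of powers. -/
def dimExpr : NatExpr := .read 6 (.var 0) (.const 0)

open NatExpr in
/-- Natural number array 5 holds the binary digits. -/
def digitsProgram : Program :=
  .forLoop 10 1 (var 0) (.forLoop 11 1 dimExpr
    (.writeNat 5 (add (var 11) (read 6 (var 10) (const 0))) (var 10)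
      (sub (const 1) (read 5 (var 11) (var 10)))))

/-- Array 6 holds the powers of two. -/
def HasPowers (n : ℕ) (s : Memory) : Prop := s.nat 0 0 0 = n ∧ ∀ l ≤ n, s.nat 6 l 0 = 2 ^ l

/-- Array 5 holds the binary digits. -/
def HasDigits (n : ℕ) (s : Memory) : Prop :=
  ∀ m < 2 ^ n, ∀ l < n, s.nat 5 m l = (m.testBit l).toNat

lemma HasPowers.eval_dimExpr {s : Memory} (h : HasPowers n s) : dimExpr.eval s = 2 ^ n := by
  simp [dimExpr, NatExpr.eval, h.1, h.2 n le_rfl]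

lemma HasPowers.of_frame {ns rs : List ℕ} {s s' : Memory} (h : HasPowers n s)
    (hF : Frame ns rs s s') (h0 : 0 ∉ ns) (h6 : 6 ∉ ns) : HasPowers n s' := by
  rw [HasPowers, hF.nat 0 h0, hF.nat 6 h6]; exact h

lemma HasDigits.of_frame {ns rs : List ℕ} {s s' : Memory} (h : HasDigits n s)
    (hF : Frame ns rs s s') (h5 : 5 ∉ ns) : HasDigits n s' := by
  rw [HasDigits, hF.nat 5 h5]; exact h

lemma runs_powersProgram {s : Memory} (hn : s.nat 0 0 0 = n) :
    Runs powersProgram s ((n + 1) * 100) fun s' => Frame [6, 10] [] s s' ∧ HasPowers n s' := by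
  have h1 : Runs (.writeNat 6 (.const 0) (.const 0) (.const 1)) s 4 fun s' =>
      Frame [6, 10] [] s s' ∧ s'.nat 6 0 0 = 1 :=
    (Runs.writeNat (Q := fun s' => Frame [6, 10] [] s s' ∧ s'.nat 6 0 0 = 1)
      ⟨(Frame.refl _ _ s).setNat (by simp) _ _ _, by simp [Memory.setNat_nat, NatExpr.eval]⟩).mono
      (by decide) fun _ h => h
  refine (h1.seq (T' := (n + 1) * 96) (Q' := fun s' => Frame [6, 10] [] s s' ∧ HasPowers n s')
    ?_).mono (by omega) fun _ h => h
  rintro s₁ ⟨hF₁, h₁⟩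
  have hn₁ : s₁.nat 0 0 0 = n := by rw [hF₁.nat 0 (by simp), hn]
  refine (Runs.forLoop (m := n) (T := 20) (ns := [6]) (rs := []) one_pos (by simp)
    (fun i s' => ∀ l ≤ i, s'.nat 6 l 0 = 2 ^ l) ?_ ?_ ?_ ?_).mono ?_ ?_
  · intro i s' v h l hl
    rw [Memory.setNat_nat_of_ne _ _ _ _ (by simp)]; exact h l hl
  · intro s' hF
    simp [hF.nat 0 (by simp), hn₁]
  · intro l hl
    obtain rfl : l = 0 := by omega
    simpa using h₁
  · intro i hi s' hF hx hI
    refine (Runs.writeNat ?_).mono (by decide) fun _ h => h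
    simp only [NatExpr.eval, NatExpr.eval_var, hx]
    refine ⟨(Frame.refl _ _ s').setNat (by simp) _ _ _, fun l hl => ?_⟩
    rw [Memory.setNat_nat]
    split_ifs with h
    · rw [hI i le_rfl, h.2.1, pow_succ]; ring
    · refine hI l ?_
      have : l ≠ i + 1 := fun h' => h ⟨rfl, h', rfl⟩
      omega
  · refine Nat.mul_le_mul_left _ (by decide)
  · rintro s' ⟨hF, hI⟩
    refine ⟨hF₁.trans (hF.mono (by simp) (by simp)), ?_, hI⟩
    rw [hF.nat 0 (by simp), hn₁]

/-- Bit `l` of `m + 2^l` is the complement of bit `l` of `m`, and the zero initial memory is already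
right for `m < 2^l`. Entries beyond `2^n` are written too, harmlessly. -/
lemma runs_digitsProgram {s : Memory} (hp : HasPowers n s) (h5 : ∀ i j, s.nat 5 i j = 0) :
    Runs digitsProgram s ((n + 1) * ((2 ^ n + 1) * 100 + 100)) fun s' =>
      Frame [5, 10, 11] [] s s' ∧ HasDigits n s' := by
  refine (Runs.forLoop (m := n) (T := (2 ^ n + 1) * 100) (ns := [5, 11]) (rs := []) one_pos
    (by simp) (fun l s' => (∀ l' < l, ∀ i < 2 ^ n, s'.nat 5 i l' = (i.testBit l').toNat) ∧
      ∀ l', l ≤ l' → ∀ i, s'.nat 5 i l' = 0) ?_ ?_ ?_ ?_).mono ?_ ?_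
  · intro i s' v h
    rw [Memory.setNat_nat_of_ne _ _ _ _ (by simp)]; exact h
  · intro s' hF
    simp [hF.nat 0 (by simp), hp.1]
  · exact ⟨by simp, fun l' _ i => h5 i l'⟩
  · intro l hl s₁ hF₁ hx₁ hI₁
    have hp₁ := hp.of_frame hF₁ (by simp) (by simp)
    refine (Runs.forLoop (m := 2 ^ n) (T := 25) (ns := [5]) (rs := []) one_pos
      (by simp) (fun m s' => (∀ i < m + 2 ^ l, s'.nat 5 i l = (i.testBit l).toNat) ∧
        ∀ l', l' ≠ l → ∀ i, s'.nat 5 i l' = s₁.nat 5 i l') ?_ ?_ ?_ ?_).mono ?_ ?_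
    · intro i s' v h
      rw [Memory.setNat_nat_of_ne _ _ _ _ (by simp)]; exact h
    · intro s' hF
      rw [(hp₁.of_frame hF (by simp) (by simp)).eval_dimExpr, one_mul]
    · refine ⟨fun i hi => ?_, fun _ _ _ => rfl⟩
      rw [hI₁.2 l le_rfl, Nat.testBit_lt_two_pow (by omega)]; rfl
    · intro m hm s₂ hF₂ hx₂ hI₂
      refine (Runs.writeNat ?_).mono (by decide) fun _ h => h
      have hl₂ : s₂.nat 10 0 0 = l := by rw [hF₂.nat 10 (by simp), hx₁]
      have hpow : s₂.nat 6 l 0 = 2 ^ l := (hp₁.of_frame hF₂ (by simp) (by simp)).2 l hl.le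
      simp only [NatExpr.eval, NatExpr.eval_var, hx₂, hl₂, hpow]
      refine ⟨(Frame.refl _ _ s₂).setNat (by simp) _ _ _, fun i hi => ?_, fun l' hl' i => ?_⟩
      · rw [Memory.setNat_nat]
        split_ifs with h
        · have hlt : m < m + 2 ^ l := Nat.lt_add_of_pos_right (by positivity)
          rw [hI₂.1 m hlt, h.2.1, add_comm m, Nat.testBit_two_pow_add_eq]
          cases m.testBit l <;> rfl
        · refine hI₂.1 i ?_
          have : i ≠ m + 2 ^ l := fun h' => h ⟨rfl, h', rfl⟩
          omega
      · rw [Memory.setNat_nat, if_neg fun h => hl' h.2.2]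
        exact hI₂.2 l' hl' i
    · refine Nat.mul_le_mul_left _ (by decide)
    · rintro s' ⟨hF, hI⟩
      refine ⟨hF.mono (by simp) (by simp), fun l' hl' i hi => ?_, fun l' hl' i => ?_⟩
      · rcases Nat.lt_succ_iff_lt_or_eq.1 hl' with h | rfl
        · rw [hI.2 l' h.ne]; exact hI₁.1 l' h i hi
        · exact hI.1 i (Nat.lt_add_right _ hi)
      · rw [hI.2 l' (by omega)]; exact hI₁.2 l' (by omega) i
  · refine Nat.mul_le_mul_left _ ?_
    have : (NatExpr.var 0).cost = 3 := by decide
    omega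
  · rintro s' ⟨hF, hI⟩
    exact ⟨hF.mono (by simp) (by simp), fun m hm l hl => hI.1 l hl m hm⟩

/-! ### The size of the sketches -/

open RealExpr in
/-- The test whether `2 ^ (k + 1)` is at most the bound on the size of the sketches. -/
def sizeTest : Test :=
  .and (.natLE (.add (.var 7) (.const 1)) (.var 0))
    (.neg (.and
      (.neg (.realLE (cast (.read 6 (.add (.var 7) (.const 1)) (.const 0)))
        (div (cast (.const 24)) (mul (var 0) (var 0)))))
      (.neg (.realLE (cast (.read 6 (.add (.var 7) (.const 1)) (.const 0)))
        (div (mul (cast (.const 24)) (sqrt (cast (.read 0 (.const 0) (.const 1))))) (var 0))))))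

/-- The variable 7 becomes the number `k` such that the sketches have size `2 ^ k`. -/
def sizeProgram : Program :=
  .seq (.writeNat 7 (.const 0) (.const 0) (.const 0))
    (.loop sizeTest (.writeNat 7 (.const 0) (.const 0) (.add (.var 7) (.const 1))))

/-- Tests have only negation and conjunction, so the disjunction that expresses a bound by a `max`
is encoded by De Morgan. -/
lemma sizeTest_holds {s : Memory} (hp : HasPowers n s) {r l : ℕ} {ε : ℝ}
    (hr : s.nat 0 0 1 = r) (he : s.real 0 0 0 = ε) (hl : s.nat 7 0 0 = l) :
    sizeTest.Holds s ↔ l + 1 ≤ n ∧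
      (2 : ℝ) ^ (l + 1) ≤ 24 * max ((ε ^ 2)⁻¹) (Real.sqrt r * ε⁻¹) := by
  simp only [sizeTest, Test.Holds, NatExpr.eval, NatExpr.eval_var, RealExpr.eval,
    RealExpr.eval_var, hl, hr, he, hp.1]
  refine and_congr_right fun h => ?_
  rw [hp.2 (l + 1) h, not_and_or, not_not, not_not, mul_max_of_nonneg _ _ (by norm_num),
    le_max_iff]
  push_cast
  rw [sq, div_eq_mul_inv, div_eq_mul_inv, mul_assoc 24]

/-- The admissible exponents are closed downwards, so the first failing test occurs exactly at the
greatest one. -/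
lemma runs_sizeProgram {s : Memory} (hp : HasPowers n s) {r k : ℕ} {ε : ℝ}
    (hr : s.nat 0 0 1 = r) (he : s.real 0 0 0 = ε)
    (hk : IsGreatest {l : ℕ | l ≤ n ∧
          (2 : ℝ) ^ l ≤ 24 * max ((ε ^ 2)⁻¹) (Real.sqrt r * ε⁻¹)} k) :
    Runs sizeProgram s ((n + 1) * 200) fun s' => Frame [7] [] s s' ∧ s'.nat 7 0 0 = k := by
  have hcost : sizeTest.cost ≤ 60 := by decide
  refine ((Runs.writeNat (Q := fun s' => Frame [7] [] s s' ∧ s'.nat 7 0 0 = 0)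
    ⟨(Frame.refl _ _ s).setNat (by simp) _ _ _, by simp [Memory.setNat_nat, NatExpr.eval]⟩).seq
    (T' := k * (20 + sizeTest.cost + 1) + (sizeTest.cost + 1))
    (Q' := fun s' => Frame [7] [] s s' ∧ s'.nat 7 0 0 = k) ?_).mono ?_ fun _ h => h
  · intro s₁ hs₁
    have hgen : ∀ i s', Frame [7] [] s s' ∧ s'.nat 7 0 0 = i → (sizeTest.Holds s' ↔ i + 1 ≤ n ∧
        (2 : ℝ) ^ (i + 1) ≤ 24 * max ((ε ^ 2)⁻¹) (Real.sqrt r * ε⁻¹)) := by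
      rintro i s' ⟨hF, hi⟩
      exact sizeTest_holds (hp.of_frame hF (by simp) (by simp))
        (by rw [hF.nat 0 (by simp), hr]) (by rw [hF.real 0 (by simp), he]) hi
    refine Runs.loop (fun i s' => Frame [7] [] s s' ∧ s'.nat 7 0 0 = i) hs₁ ?_ ?_
    · intro i hi s' hs'
      refine ⟨(hgen i s' hs').2 ⟨by have := hk.1.1; omega, le_trans ?_ hk.1.2⟩, ?_⟩
      · exact pow_le_pow_right₀ (by norm_num) hi
      · refine (Runs.writeNat ?_).mono (by decide) fun _ h => h
        exact ⟨hs'.1.setNat (by simp) _ _ _, by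
          simp [Memory.setNat_nat, NatExpr.eval, hs'.2]⟩
    · intro s' hs' hh
      have := hk.2 ((hgen k s' hs').1 hh)
      omega
  · have := hk.1.1
    have h1 : k * (20 + sizeTest.cost + 1) ≤ n * 100 :=
      Nat.mul_le_mul this (by omega)
    simp only [NatExpr.cost]
    omega

/-! ### Inverse gates on vectors -/

lemma onQubit_mulVec (q : Fin n) (A : Matrix Bool Bool ℂ) (v : Qubits n → ℂ) (u : Qubits n) :
    (onQubit q A *ᵥ v) u = A (u q) false * v (Function.update u q false) +
      A (u q) true * v (Function.update u q true) := by
  have hinj : Function.Injective fun b : Bool => Function.update u q b :=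
    Function.update_injective u q
  rw [Matrix.mulVec, dotProduct,
    ← Finset.sum_subset (Finset.subset_univ (Finset.univ.map ⟨_, hinj⟩)), Finset.sum_map,
    Fintype.sum_bool, add_comm]
  · have h : ∀ b : Bool, onQubit q A u (Function.update u q b) = A (u q) b := fun b => by
      rw [onQubit, Matrix.of_apply, if_pos fun l hl => by rw [Function.update_of_ne hl],
        Function.update_self]
    simp [h]
  · intro z _ hz
    rw [onQubit, Matrix.of_apply, if_neg, zero_mul]
    intro hxz
    apply hz
    simp only [Finset.mem_map, Finset.mem_univ, Function.Embedding.coeFn_mk, true_and]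
    exact ⟨z q, eq_of_agree (q := q) (fun l hl => by rw [Function.update_of_ne hl, hxz l hl])
      (by simp)⟩

lemma hadamard_conjTranspose_mulVec (q : Fin n) (v : Qubits n → ℂ) (u : Qubits n) :
    ((Gate.hadamard q).matrixᴴ *ᵥ v) u = ((1 / Real.sqrt 2 : ℝ) : ℂ) *
      (v (Function.update u q false) + sgn (u q) * v (Function.update u q true)) := by
  rw [hadamard_eq, onQubit_conjTranspose, hadamardMatrix_conjTranspose, onQubit_mulVec]
  simp only [hadamardMatrix, Matrix.of_apply, Bool.false_eq_true, and_false, if_false, and_true]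
  cases u q <;> simp <;> ring

lemma phase_conjTranspose_mulVec (q : Fin n) (v : Qubits n → ℂ) (u : Qubits n) :
    ((Gate.phase q).matrixᴴ *ᵥ v) u = if u q = true then -Complex.I * v u else v u := by
  rw [Gate.matrix, Matrix.diagonal_conjTranspose, Matrix.mulVec_diagonal]
  split_ifs with h <;> simp [h]

lemma cnot_conjTranspose_mulVec {c t : Fin n} (h : c ≠ t) (v : Qubits n → ℂ) (u : Qubits n) :
    ((Gate.cnot c t h).matrixᴴ *ᵥ v) u = v (cnotBits c t u) := by
  rw [cnot_conjTranspose, Matrix.mulVec, dotProduct]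
  simp [cnot_apply, eq_cnotBits_iff h u]

/-! ### Vectors in memory -/

/-- Rows `i` of the arrays `a` and `a'` hold the real and imaginary parts of a vector. -/
def HasVec (s : Memory) (a a' i : ℕ) (v : Qubits n → ℂ) : Prop :=
  ∀ m < 2 ^ n, s.real a i m = (v (ket n m)).re ∧ s.real a' i m = (v (ket n m)).im

lemma HasVec.of_frame {ns rs : List ℕ} {s s' : Memory} {a a' i : ℕ} {v : Qubits n → ℂ}
    (h : HasVec s a a' i v) (hF : Frame ns rs s s') (ha : a ∉ rs) (ha' : a' ∉ rs) :
    HasVec s' a a' i v := by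
  rw [HasVec, hF.real a ha, hF.real a' ha']; exact h

open RealExpr in
/-- Copy a vector. -/
def copyProgram (a a' : ℕ) (i : NatExpr) (b b' : ℕ) (j : NatExpr) : Program :=
  .forLoop 11 1 dimExpr
    (.seq (.writeReal a i (.var 11) (read b j (.var 11)))
      (.writeReal a' i (.var 11) (read b' j (.var 11))))

lemma runs_copyProgram {s : Memory} {a a' b b' i₀ j₀ : ℕ} {i j : NatExpr} {v : Qubits n → ℂ}
    (hp : HasPowers n s) (ha : a ≠ a') (hb : b ∉ [a, a']) (hb' : b' ∉ [a, a'])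
    (hi : ∀ s', Frame [11] [a, a'] s s' → i.eval s' = i₀)
    (hj : ∀ s', Frame [11] [a, a'] s s' → j.eval s' = j₀)
    (hic : i.cost ≤ 5) (hjc : j.cost ≤ 5) (hv : HasVec s b b' j₀ v) :
    Runs (copyProgram a a' i b b' j) s ((2 ^ n + 1) * 100) fun s' =>
      Frame [11] [a, a'] s s' ∧ HasVec s' a a' i₀ v ∧
        ∀ i', i' ≠ i₀ → s'.real a i' = s.real a i' ∧ s'.real a' i' = s.real a' i' := by
  refine (Runs.forLoop (m := 2 ^ n) (T := 40) (ns := []) (rs := [a, a']) one_pos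
    (by simp) (fun m s' => (∀ l < m, s'.real a i₀ l = (v (ket n l)).re ∧
      s'.real a' i₀ l = (v (ket n l)).im) ∧
      ∀ i', i' ≠ i₀ → s'.real a i' = s.real a i' ∧ s'.real a' i' = s.real a' i') ?_ ?_ ?_ ?_).mono
      ?_ ?_
  · intro m s' x h; exact h
  · intro s' hF
    rw [(hp.of_frame hF (by simp) (by simp)).eval_dimExpr, one_mul]
  · simp
  · intro m hm s₁ hF₁ hx₁ hI₁
    have hb₁ : s₁.real b = s.real b := hF₁.real b hb
    have hb₁' : s₁.real b' = s.real b' := hF₁.real b' hb'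
    have hi₁ := hi s₁ hF₁
    have hj₁ := hj s₁ hF₁
    have hF₂ : Frame [11] [a, a'] s (s₁.setReal a i₀ m (v (ket n m)).re) :=
      hF₁.setReal (by simp) _ _ _
    have hi₂ := hi _ hF₂
    have hj₂ := hj _ hF₂
    simp only [List.mem_cons, List.not_mem_nil, or_false, not_or] at hb hb'
    refine ((Runs.writeReal (Q := fun s' => s' = s₁.setReal a i₀ m (v (ket n m)).re) ?_).seq
      (T' := 20) (Q' := fun s' => s' = (s₁.setReal a i₀ m (v (ket n m)).re).setReal a' i₀ m
        (v (ket n m)).im) ?_).mono ?_ ?_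
    · simp only [NatExpr.eval_var, RealExpr.eval, hx₁, hi₁, hj₁, hb₁, (hv m hm).1]
    · rintro s₂ rfl
      refine (Runs.writeReal ?_).mono ?_ fun _ h => h
      · simp only [NatExpr.eval_var, RealExpr.eval, Memory.setReal_nat, hx₁, hi₂, hj₂,
          Memory.setReal_real_of_ne _ _ _ _ hb'.1, hb₁', (hv m hm).2]
      · simp only [RealExpr.cost, NatExpr.cost, NatExpr.var]; omega
    · simp only [RealExpr.cost, NatExpr.cost, NatExpr.var]; omega
    · rintro s' rfl
      refine ⟨((Frame.refl _ _ _).setReal (by simp) _ _ _).setReal (by simp) _ _ _,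
        fun l hl => ?_, fun i' hi' => ?_⟩
      · by_cases hlm : l = m
        · subst hlm
          simp [Memory.setReal_real, ha]
        · have := hI₁.1 l (by omega)
          simp [Memory.setReal_real, hlm, this]
      · have := hI₁.2 i' hi'
        rw [← this.1, ← this.2]
        constructor <;> (funext l; simp [Memory.setReal_real, hi'])
  · refine Nat.mul_le_mul_left _ (by decide)
  · rintro s' ⟨hF, hI⟩
    exact ⟨hF, hI.1, hI.2⟩

/-! ### Application of the inverse of a gate -/

open NatExpr in
/-- The number of the gate that is treated in the current step. -/
def gateIndexExpr : NatExpr := sub (read 1 (var 12) (const 0)) (add (var 13) (const 1))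

open NatExpr in
/-- The place of a qubit of the current gate; `a = 3` or `a = 4`. -/
def placeExpr (a : ℕ) : NatExpr := sub (var 0) (add (read a (var 12) gateIndexExpr) (const 1))

open NatExpr in
/-- The binary digit of the current index at a qubit of the current gate. -/
def digitExpr (a : ℕ) : NatExpr := read 5 (var 11) (placeExpr a)

open NatExpr in
/-- The power of two that belongs to a qubit of the current gate. -/
def powerExpr (a : ℕ) : NatExpr := read 6 (placeExpr a) (const 0)

/-- Write the current component of the next vector. -/
def writeNext (e e' : RealExpr) : Program :=
  .seq (.writeReal 6 (.add (.var 13) (.const 1)) (.var 11) e)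
    (.writeReal 7 (.add (.var 13) (.const 1)) (.var 11) e')

open RealExpr in
/-- A component of the Hadamard transform. -/
def hadamardExpr (a : ℕ) : RealExpr :=
  mul (div (cast (.const 1)) (sqrt (cast (.const 2))))
    (add (read a (.var 13) (.sub (.var 11) (.mul (digitExpr 3) (powerExpr 3))))
      (mul (sub (cast (.const 1)) (cast (.mul (.const 2) (digitExpr 3))))
        (read a (.var 13) (.add (.var 11) (.mul (.sub (.const 1) (digitExpr 3)) (powerExpr 3))))))

open RealExpr in
/-- The real part of a component after an inverse phase gate. -/
def phaseReExpr : RealExpr :=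
  add (mul (cast (.sub (.const 1) (digitExpr 3))) (read 6 (.var 13) (.var 11)))
    (mul (cast (digitExpr 3)) (read 7 (.var 13) (.var 11)))

open RealExpr in
/-- The imaginary part of a component after an inverse phase gate. -/
def phaseImExpr : RealExpr :=
  sub (mul (cast (.sub (.const 1) (digitExpr 3))) (read 7 (.var 13) (.var 11)))
    (mul (cast (digitExpr 3)) (read 6 (.var 13) (.var 11)))

open NatExpr in
/-- The index from which a controlled NOT gate moves a component to the current index. -/
def cnotIndexExpr : NatExpr :=
  sub (add (var 11) (mul (digitExpr 3) (mul (sub (const 1) (digitExpr 4)) (powerExpr 4))))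
    (mul (digitExpr 3) (mul (digitExpr 4) (powerExpr 4)))

/-- Compute one component of the vector after the inverse of the current gate. -/
def gateProgram : Program :=
  .branch (.natLE (.read 2 (.var 12) gateIndexExpr) (.const 0))
    (writeNext (hadamardExpr 6) (hadamardExpr 7))
    (.branch (.natLE (.read 2 (.var 12) gateIndexExpr) (.const 1))
      (writeNext phaseReExpr phaseImExpr)
      (writeNext (.read 6 (.var 13) cnotIndexExpr) (.read 7 (.var 13) cnotIndexExpr)))

/-- The state of memory in the treatment of one component in one step. -/
structure AtGate (s : Memory) (G : Gate n) (st m : ℕ) (v : Qubits n → ℂ) : Prop where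
  powers : HasPowers n s
  digits : HasDigits n s
  index : s.nat 11 0 0 = m
  step : s.nat 13 0 0 = st
  lt : m < 2 ^ n
  code : s.nat 2 (s.nat 12 0 0) (gateIndexExpr.eval s) = G.code.1
  fst : s.nat 3 (s.nat 12 0 0) (gateIndexExpr.eval s) = G.code.2.1
  snd : s.nat 4 (s.nat 12 0 0) (gateIndexExpr.eval s) = G.code.2.2
  vec : HasVec s 6 7 st v

lemma eval_placeExpr {s : Memory} {a : ℕ} {q : Fin n} (hn : s.nat 0 0 0 = n)
    (h : s.nat a (s.nat 12 0 0) (gateIndexExpr.eval s) = q) : (placeExpr a).eval s = bitPlace q := by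
  simp [placeExpr, NatExpr.eval, h, hn, bitPlace]

lemma eval_digitExpr {s : Memory} {a m : ℕ} {q : Fin n} (hp : HasPowers n s) (hd : HasDigits n s)
    (hm : s.nat 11 0 0 = m) (hlt : m < 2 ^ n)
    (h : s.nat a (s.nat 12 0 0) (gateIndexExpr.eval s) = q) :
    (digitExpr a).eval s = (ket n m q).toNat := by
  simp [digitExpr, NatExpr.eval, hm, eval_placeExpr hp.1 h, hd m hlt _ (bitPlace_lt q), ket_apply]

lemma eval_powerExpr {s : Memory} {a : ℕ} {q : Fin n} (hp : HasPowers n s)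
    (h : s.nat a (s.nat 12 0 0) (gateIndexExpr.eval s) = q) :
    (powerExpr a).eval s = 2 ^ bitPlace q := by
  simp [powerExpr, NatExpr.eval, eval_placeExpr hp.1 h, hp.2 _ (bitPlace_lt q).le]

lemma eval_setReal (s : Memory) (a i j : ℕ) (x : ℝ) (e : NatExpr) :
    e.eval (s.setReal a i j x) = e.eval s := by
  induction e with
  | const m => rfl
  | read b e f he hf => simp [NatExpr.eval, he, hf]
  | add e f he hf => simp [NatExpr.eval, he, hf]
  | sub e f he hf => simp [NatExpr.eval, he, hf]
  | mul e f he hf => simp [NatExpr.eval, he, hf]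

/-- The imaginary part is evaluated after the real part has been stored. In the uses below this does
no harm: values are read from row `st` and written to row `st + 1`. -/
lemma runs_writeNext {s : Memory} {st m : ℕ} {e e' : RealExpr} {z : ℂ} (hm : s.nat 11 0 0 = m)
    (hst : s.nat 13 0 0 = st) (he : e.eval s = z.re)
    (he' : e'.eval (s.setReal 6 (st + 1) m z.re) = z.im) :
    Runs (writeNext e e') s (e.cost + e'.cost + 20) fun s' =>
      s' = (s.setReal 6 (st + 1) m z.re).setReal 7 (st + 1) m z.im := by
  refine ((Runs.writeReal (Q := fun s' => s' = s.setReal 6 (st + 1) m z.re) ?_).seq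
    (T' := e'.cost + 10) (Q' := fun s' => s' = (s.setReal 6 (st + 1) m z.re).setReal 7 (st + 1) m
      z.im) ?_).mono ?_ fun _ h => h
  · simp only [NatExpr.eval, NatExpr.eval_var, he, hm, hst]
  · rintro s' rfl
    refine (Runs.writeReal ?_).mono ?_ fun _ h => h
    · simp only [NatExpr.eval, NatExpr.eval_var, Memory.setReal_nat, he', hm, hst]
    · simp only [NatExpr.cost, NatExpr.var]; omega
  · simp only [NatExpr.cost, NatExpr.var]; omega

/-- The labels with bit `q` cleared or set are obtained from `m` by subtracting or adding a digit
times a power of two, and the sign is `1 - 2 · digit`. -/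
lemma runs_hadamard {s : Memory} {q : Fin n} {st m : ℕ} {v : Qubits n → ℂ}
    (h : AtGate s (.hadamard q) st m v) :
    Runs (writeNext (hadamardExpr 6) (hadamardExpr 7)) s 600 fun s' =>
      s' = (s.setReal 6 (st + 1) m (((Gate.hadamard q).matrixᴴ *ᵥ v) (ket n m)).re).setReal 7
        (st + 1) m (((Gate.hadamard q).matrixᴴ *ᵥ v) (ket n m)).im := by
  have hdig := eval_digitExpr h.powers h.digits h.index h.lt h.fst
  have hpow := eval_powerExpr h.powers h.fst
  have hidx : NatExpr.eval s (.sub (.var 11) (.mul (digitExpr 3) (powerExpr 3))) < 2 ^ n ∧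
      ket n (NatExpr.eval s (.sub (.var 11) (.mul (digitExpr 3) (powerExpr 3)))) =
        Function.update (ket n m) q false := by
    simp only [NatExpr.eval, NatExpr.eval_var, h.index, hdig, hpow]
    cases hb : ket n m q
    · simp only [Bool.toNat_false, zero_mul, Nat.sub_zero]
      exact ⟨h.lt, by rw [← hb, Function.update_eq_self]⟩
    · simp only [Bool.toNat_true, one_mul]
      exact ⟨(Nat.sub_le _ _).trans_lt h.lt, ket_sub hb⟩
  have hidx' : NatExpr.eval s
      (.add (.var 11) (.mul (.sub (.const 1) (digitExpr 3)) (powerExpr 3))) < 2 ^ n ∧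
      ket n (NatExpr.eval s
        (.add (.var 11) (.mul (.sub (.const 1) (digitExpr 3)) (powerExpr 3)))) =
        Function.update (ket n m) q true := by
    simp only [NatExpr.eval, NatExpr.eval_var, h.index, hdig, hpow]
    cases hb : ket n m q
    · simp only [Bool.toNat_false, Nat.sub_zero, one_mul]
      refine ⟨add_two_pow_lt h.lt (bitPlace_lt q) ?_, ket_add hb⟩
      rw [← ket_apply, hb]
    · simp only [Bool.toNat_true, Nat.sub_self, zero_mul, add_zero]
      exact ⟨h.lt, by rw [← hb, Function.update_eq_self]⟩
  have hsgn : sgn (ket n m q) = ((1 - ((2 * (ket n m q).toNat : ℕ) : ℝ) : ℝ) : ℂ) := by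
    cases ket n m q <;> norm_num
  refine (runs_writeNext h.index h.step ?_ ?_).mono (by decide) fun _ h => h
  · rw [hadamard_conjTranspose_mulVec, hsgn, Complex.re_ofReal_mul, Complex.add_re,
      Complex.re_ofReal_mul, ← hidx.2, ← hidx'.2, ← (h.vec _ hidx.1).1, ← (h.vec _ hidx'.1).1]
    rw [hadamardExpr]
    simp only [RealExpr.eval, NatExpr.eval_var, h.step]
    simp [NatExpr.eval, hdig]
  · rw [hadamard_conjTranspose_mulVec, hsgn, Complex.im_ofReal_mul, Complex.add_im,
      Complex.im_ofReal_mul, ← hidx.2, ← hidx'.2, ← (h.vec _ hidx.1).2, ← (h.vec _ hidx'.1).2]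
    rw [hadamardExpr]
    simp only [RealExpr.eval, eval_setReal, NatExpr.eval_var, h.step, Memory.setReal_nat,
      Memory.setReal_real_of_ne _ _ _ _ (show 7 ≠ 6 by norm_num)]
    simp [NatExpr.eval, hdig]

lemma runs_phase {s : Memory} {q : Fin n} {st m : ℕ} {v : Qubits n → ℂ}
    (h : AtGate s (.phase q) st m v) :
    Runs (writeNext phaseReExpr phaseImExpr) s 300 fun s' =>
      s' = (s.setReal 6 (st + 1) m (((Gate.phase q).matrixᴴ *ᵥ v) (ket n m)).re).setReal 7
        (st + 1) m (((Gate.phase q).matrixᴴ *ᵥ v) (ket n m)).im := by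
  have hdig := eval_digitExpr h.powers h.digits h.index h.lt h.fst
  have hv := h.vec m h.lt
  refine (runs_writeNext h.index h.step ?_ ?_).mono (by decide) fun _ h => h
  · rw [phase_conjTranspose_mulVec]
    simp only [phaseReExpr, RealExpr.eval, NatExpr.eval, NatExpr.eval_var, h.step, h.index, hdig,
      hv.1, hv.2]
    cases ket n m q <;> simp
  · rw [phase_conjTranspose_mulVec]
    simp only [phaseImExpr, RealExpr.eval, Memory.setReal_nat, NatExpr.eval, eval_setReal, NatExpr.eval_var, h.step,
      h.index, hdig, Memory.setReal_real]
    rw [if_neg (by omega), if_neg (by omega), hv.1, hv.2]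
    cases ket n m q <;> simp

lemma runs_cnot {s : Memory} {c t : Fin n} (hct : c ≠ t) {st m : ℕ} {v : Qubits n → ℂ}
    (h : AtGate s (.cnot c t hct) st m v) :
    Runs (writeNext (.read 6 (.var 13) cnotIndexExpr) (.read 7 (.var 13) cnotIndexExpr)) s 500
      fun s' => s' = (s.setReal 6 (st + 1) m
        (((Gate.cnot c t hct).matrixᴴ *ᵥ v) (ket n m)).re).setReal 7 (st + 1) m
        (((Gate.cnot c t hct).matrixᴴ *ᵥ v) (ket n m)).im := by
  have hdc := eval_digitExpr h.powers h.digits h.index h.lt h.fst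
  have hdt := eval_digitExpr h.powers h.digits h.index h.lt h.snd
  have hpow := eval_powerExpr h.powers h.snd
  have hidx : cnotIndexExpr.eval s < 2 ^ n ∧
      ket n (cnotIndexExpr.eval s) = cnotBits c t (ket n m) := by
    simp only [cnotIndexExpr, NatExpr.eval, NatExpr.eval_var, h.index, hdc, hdt, hpow, cnotBits]
    cases hb : ket n m c
    · simp only [Bool.toNat_false, zero_mul, Nat.sub_zero, add_zero, Bool.xor_false,
        Function.update_eq_self]
      exact ⟨h.lt, trivial⟩
    · cases hb' : ket n m t
      · simp only [Bool.toNat_true, Bool.toNat_false, one_mul, zero_mul, Nat.sub_zero,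
          Bool.xor_true, Bool.not_false]
        refine ⟨add_two_pow_lt h.lt (bitPlace_lt t) ?_, ket_add hb'⟩
        rw [← ket_apply, hb']
      · simp only [Bool.toNat_true, one_mul, Nat.sub_self, zero_mul, add_zero,
          Bool.xor_true, Bool.not_true]
        exact ⟨(Nat.sub_le _ _).trans_lt h.lt, ket_sub hb'⟩
  have hv := h.vec _ hidx.1
  refine (runs_writeNext h.index h.step ?_ ?_).mono (by decide) fun _ h => h
  · rw [cnot_conjTranspose_mulVec, ← hidx.2, ← hv.1]
    simp only [RealExpr.eval, NatExpr.eval_var, h.step]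
  · rw [cnot_conjTranspose_mulVec, ← hidx.2, ← hv.2]
    simp only [RealExpr.eval, eval_setReal, NatExpr.eval_var, h.step, Memory.setReal_nat,
      Memory.setReal_real_of_ne _ _ _ _ (show 7 ≠ 6 by norm_num)]

lemma runs_gateProgram {s : Memory} {G : Gate n} {st m : ℕ} {v : Qubits n → ℂ}
    (h : AtGate s G st m v) :
    Runs gateProgram s 800 fun s' =>
      s' = (s.setReal 6 (st + 1) m ((G.matrixᴴ *ᵥ v) (ket n m)).re).setReal 7
        (st + 1) m ((G.matrixᴴ *ᵥ v) (ket n m)).im := by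
  refine (Runs.branch (T := 700) (fun hb => ?_) fun hb => (Runs.branch (T := 600) (fun hb' => ?_)
    fun hb' => ?_).mono (by decide) fun _ h => h).mono (by decide) fun _ h => h
  all_goals
    simp only [Test.Holds, NatExpr.eval, NatExpr.eval_var, h.code] at hb
    try simp only [Test.Holds, NatExpr.eval, NatExpr.eval_var, h.code] at hb'
    cases G
  -- Each branch fixes the type code, which excludes all but one kind of gate.
  all_goals try (exfalso; simp only [Gate.code] at hb; omega)
  all_goals try (exfalso; simp only [Gate.code] at hb'; omega)
  · exact (runs_hadamard h).mono (by norm_num) fun _ h => h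
  · exact (runs_phase h).mono (by norm_num) fun _ h => h
  · exact (runs_cnot _ h).mono (by norm_num) fun _ h => h

/-! ### Reconstruction of the projected vectors -/

/-- Apply the inverse of the current gate. -/
def stepProgram : Program := .forLoop 11 1 dimExpr gateProgram

/-- Apply the inverse of the current circuit. -/
def undoProgram : Program := .forLoop 13 1 (.read 1 (.var 12) (.const 0)) stepProgram

/-- Apply the inverse circuit of the current sketch to its amplitudes. -/
def sketchProgram : Program :=
  .seq (copyProgram 6 7 (.const 0) 3 4 (.var 12))
    (.seq undoProgram (copyProgram 8 9 (.var 12) 6 7 (.read 1 (.var 12) (.const 0))))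

/-- Treat all sketches. -/
def sketchesProgram : Program :=
  .forLoop 12 1 (.read 0 (.const 0) (.const 2)) sketchProgram

/-- The memory contains a sketch. -/
structure HasSketch {k : ℕ} (s : Memory) (j : ℕ) (S : Sketch n k) : Prop where
  len : s.nat 1 j 0 = S.circuit.length
  code : ∀ (i : ℕ) (h : i < S.circuit.length), s.nat 2 j i = S.circuit[i].code.1 ∧
    s.nat 3 j i = S.circuit[i].code.2.1 ∧ s.nat 4 j i = S.circuit[i].code.2.2
  amp : HasVec s 3 4 j S.vec

lemma HasSketch.of_frame {k : ℕ} {ns rs : List ℕ} {s s' : Memory} {j : ℕ} {S : Sketch n k}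
    (h : HasSketch s j S) (hF : Frame ns rs s s') (hns : ∀ a ∈ [1, 2, 3, 4], a ∉ ns)
    (hrs : ∀ a ∈ [3, 4], a ∉ rs) : HasSketch s' j S := by
  refine ⟨?_, ?_, h.amp.of_frame hF (hrs 3 (by simp)) (hrs 4 (by simp))⟩
  · rw [hF.nat 1 (hns 1 (by simp)), h.len]
  · rw [hF.nat 2 (hns 2 (by simp)), hF.nat 3 (hns 3 (by simp)), hF.nat 4 (hns 4 (by simp))]
    exact h.code

lemma runs_stepProgram {s : Memory} {G : Gate n} {st : ℕ} {v : Qubits n → ℂ}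
    (hp : HasPowers n s) (hd : HasDigits n s) (hst : s.nat 13 0 0 = st)
    (hcode : s.nat 2 (s.nat 12 0 0) (gateIndexExpr.eval s) = G.code.1 ∧
      s.nat 3 (s.nat 12 0 0) (gateIndexExpr.eval s) = G.code.2.1 ∧
      s.nat 4 (s.nat 12 0 0) (gateIndexExpr.eval s) = G.code.2.2) (hv : HasVec s 6 7 st v) :
    Runs stepProgram s ((2 ^ n + 1) * 900) fun s' =>
      Frame [11] [6, 7] s s' ∧ HasVec s' 6 7 (st + 1) (G.matrixᴴ *ᵥ v) := by
  refine (Runs.forLoop (m := 2 ^ n) (T := 800) (ns := []) (rs := [6, 7]) one_pos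
    (by simp) (fun m s' => HasVec s' 6 7 st v ∧ ∀ l < m,
      s'.real 6 (st + 1) l = ((G.matrixᴴ *ᵥ v) (ket n l)).re ∧
      s'.real 7 (st + 1) l = ((G.matrixᴴ *ᵥ v) (ket n l)).im) ?_ ?_ ?_ ?_).mono
      ?_ ?_
  · intro m s' x h; exact h
  · intro s' hF
    rw [(hp.of_frame hF (by simp) (by simp)).eval_dimExpr, one_mul]
  · exact ⟨hv, by simp⟩
  · intro m hm s₁ hF₁ hx₁ hI₁
    have hgi : gateIndexExpr.eval s₁ = gateIndexExpr.eval s := by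
      simp only [gateIndexExpr, NatExpr.eval, NatExpr.eval_var, hF₁.nat 1 (by simp),
        hF₁.nat 12 (by simp), hF₁.nat 13 (by simp)]
    have hat : AtGate s₁ G st m v :=
      { powers := hp.of_frame hF₁ (by simp) (by simp)
        digits := hd.of_frame hF₁ (by simp)
        index := hx₁
        step := by rw [hF₁.nat 13 (by simp), hst]
        lt := hm
        code := by rw [hgi, hF₁.nat 12 (by simp), hF₁.nat 2 (by simp), hcode.1]
        fst := by rw [hgi, hF₁.nat 12 (by simp), hF₁.nat 3 (by simp), hcode.2.1]
        snd := by rw [hgi, hF₁.nat 12 (by simp), hF₁.nat 4 (by simp), hcode.2.2]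
        vec := hI₁.1 }
    refine (runs_gateProgram hat).mono le_rfl ?_
    rintro s' rfl
    refine ⟨((Frame.refl _ _ _).setReal (by simp) _ _ _).setReal (by simp) _ _ _, fun l hl => ?_,
      fun l hl => ?_⟩
    · have := hI₁.1 l hl
      simp [Memory.setReal_real, this]
    · by_cases hlm : l = m
      · subst hlm
        simp [Memory.setReal_real]
      · have := hI₁.2 l (by omega)
        simp [Memory.setReal_real, hlm, this]
  · refine Nat.mul_le_mul_left _ (by decide)
  · rintro s' ⟨hF, hI⟩
    exact ⟨hF, hI.2⟩

/-- Gates are undone from the last to the first. Row `st` keeps the vector after `st` of them, so no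
row is overwritten while it is being read. -/
lemma runs_undoProgram {s : Memory} {j k : ℕ} {S : Sketch n k} {v : Qubits n → ℂ}
    (hp : HasPowers n s) (hd : HasDigits n s) (hj : s.nat 12 0 0 = j) (hS : HasSketch s j S)
    (hv : HasVec s 6 7 0 v) :
    Runs undoProgram s ((S.circuit.length + 1) * ((2 ^ n + 1) * 900 + 100)) fun s' =>
      Frame [11, 13] [6, 7] s s' ∧
        HasVec s' 6 7 S.circuit.length ((circuitMatrix S.circuit)ᴴ *ᵥ v) := by
  set len := S.circuit.length with hlen
  refine (Runs.forLoop (m := len) (T := (2 ^ n + 1) * 900) (ns := [11]) (rs := [6, 7]) one_pos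
    (by simp) (fun st s' => HasVec s' 6 7 st
      ((circuitMatrix (S.circuit.drop (len - st)))ᴴ *ᵥ v)) ?_ ?_ ?_ ?_).mono ?_ ?_
  · intro m s' x h; exact h
  · intro s' hF
    simp only [NatExpr.eval, NatExpr.eval_var, hF.nat 1 (by simp), hF.nat 12 (by simp), hj, hS.len,
      one_mul, hlen]
  · simpa [hlen, circuitMatrix] using hv
  · intro st hst s₁ hF₁ hx₁ hI₁
    have hlt : len - (st + 1) < S.circuit.length := by omega
    have hS₁ := hS.of_frame hF₁ (by simp) (by simp)
    have hj₁ : s₁.nat 12 0 0 = j := by rw [hF₁.nat 12 (by simp), hj]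
    have hgi : gateIndexExpr.eval s₁ = len - (st + 1) := by
      simp only [gateIndexExpr, NatExpr.eval, NatExpr.eval_var, hj₁, hx₁, hS₁.len, hlen]
    have hc := hS₁.code _ hlt
    refine (runs_stepProgram (G := S.circuit[len - (st + 1)]) (hp.of_frame hF₁ (by simp) (by simp))
      (hd.of_frame hF₁ (by simp)) hx₁ ?_ hI₁).mono le_rfl ?_
    · rw [hgi, hj₁]; exact hc
    · rintro s' ⟨hF, hI⟩
      refine ⟨hF, ?_⟩
      rw [List.drop_eq_getElem_cons hlt, show len - (st + 1) + 1 = len - st by omega,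
        circuitMatrix, Matrix.conjTranspose_mul, ← Matrix.mulVec_mulVec]
      exact hI
  · refine Nat.mul_le_mul_left _ ?_
    have : (NatExpr.read 1 (NatExpr.var 12) (NatExpr.const 0)).cost = 5 := by decide
    omega
  · rintro s' ⟨hF, hI⟩
    refine ⟨hF.mono (by simp) (by simp), ?_⟩
    rwa [Nat.sub_self, List.drop_zero] at hI

/-- Bound on the running time of the treatment of one sketch. -/
def sketchTime (n ℓ : ℕ) : ℕ := (2 ^ n + 1) * 200 + (ℓ + 1) * ((2 ^ n + 1) * 900 + 100)

lemma runs_sketchProgram {s : Memory} {j k ℓ : ℕ} {S : Sketch n k}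
    (hp : HasPowers n s) (hd : HasDigits n s) (hj : s.nat 12 0 0 = j) (hS : HasSketch s j S)
    (hℓ : S.circuit.length ≤ ℓ) :
    Runs sketchProgram s (sketchTime n ℓ) fun s' =>
      Frame [11, 13] [6, 7, 8, 9] s s' ∧
        HasVec s' 8 9 j ((circuitMatrix S.circuit)ᴴ *ᵥ S.vec) ∧
        ∀ j', j' ≠ j → s'.real 8 j' = s.real 8 j' ∧ s'.real 9 j' = s.real 9 j' := by
  refine ((runs_copyProgram (v := S.vec) (i₀ := 0) (j₀ := j) hp (by norm_num) (by simp) (by simp)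
    (fun _ _ => rfl) ?_ (by decide) (by decide) hS.amp).seq
    (T' := (ℓ + 1) * ((2 ^ n + 1) * 900 + 100) + (2 ^ n + 1) * 100) ?_).mono ?_ fun _ h => h
  · intro s' hF
    rw [NatExpr.eval_var, hF.nat 12 (by simp), hj]
  · rintro s₁ ⟨hF₁, hv₁, -⟩
    have hj₁ : s₁.nat 12 0 0 = j := by rw [hF₁.nat 12 (by simp), hj]
    refine (((runs_undoProgram (hp.of_frame hF₁ (by simp) (by simp)) (hd.of_frame hF₁ (by simp))
      hj₁ (hS.of_frame hF₁ (by simp) (by simp)) hv₁).mono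
      (Nat.mul_le_mul_right _ (Nat.succ_le_succ hℓ)) fun _ h => h).seq ?_)
    rintro s₂ ⟨hF₂, hv₂⟩
    have hF₂' : Frame [11, 13] [6, 7, 8, 9] s s₂ :=
      (hF₁.mono (by simp) (by simp)).trans (hF₂.mono (by simp) (by simp))
    have h8 : s₂.real 8 = s.real 8 := by rw [hF₂.real 8 (by simp), hF₁.real 8 (by simp)]
    have h9 : s₂.real 9 = s.real 9 := by rw [hF₂.real 9 (by simp), hF₁.real 9 (by simp)]
    have hj₂ : s₂.nat 12 0 0 = j := by rw [hF₂'.nat 12 (by simp), hj]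
    have hS₂ := hS.of_frame hF₂' (by simp) (by simp)
    refine (runs_copyProgram (i₀ := j) (j₀ := S.circuit.length)
      (hp.of_frame hF₂' (by simp) (by simp)) (by norm_num) (by simp) (by simp)
      (fun s' hF => by rw [NatExpr.eval_var, hF.nat 12 (by simp), hj₂]) (fun s' hF => by
        simp only [NatExpr.eval, NatExpr.eval_var, hF.nat 12 (by simp), hF.nat 1 (by simp), hj₂,
          hS₂.len])
      (by decide) (by decide) hv₂).mono le_rfl ?_
    rintro s₃ ⟨hF₃, hv₃, hrest⟩
    refine ⟨hF₂'.trans (hF₃.mono (by simp) (by simp)), hv₃, fun j' hj' => ?_⟩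
    rw [(hrest j' hj').1, (hrest j' hj').2, h8, h9]
    exact ⟨rfl, rfl⟩
  · rw [sketchTime]; omega

lemma runs_sketchesProgram {s : Memory} {N k ℓ : ℕ} {S : Fin N → Sketch n k}
    (hp : HasPowers n s) (hd : HasDigits n s) (hN : s.nat 0 0 2 = N)
    (hS : ∀ j : Fin N, HasSketch s j (S j)) (hℓ : ∀ j, (S j).circuit.length ≤ ℓ) :
    Runs sketchesProgram s ((N + 1) * (sketchTime n ℓ + 100)) fun s' =>
      Frame [11, 12, 13] [6, 7, 8, 9] s s' ∧
        ∀ j : Fin N, HasVec s' 8 9 j ((circuitMatrix (S j).circuit)ᴴ *ᵥ (S j).vec) := by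
  refine (Runs.forLoop (m := N) (T := sketchTime n ℓ) (ns := [11, 13]) (rs := [6, 7, 8, 9]) one_pos
    (by simp) (fun i s' => ∀ j : Fin N, (j : ℕ) < i →
      HasVec s' 8 9 j ((circuitMatrix (S j).circuit)ᴴ *ᵥ (S j).vec)) ?_ ?_ ?_ ?_).mono ?_ ?_
  · intro m s' x h; exact h
  · intro s' hF
    simp only [NatExpr.eval, hF.nat 0 (by simp), hN, one_mul]
  · simp
  · intro i hi s₁ hF₁ hx₁ hI₁
    refine (runs_sketchProgram (S := S ⟨i, hi⟩) (hp.of_frame hF₁ (by simp) (by simp))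
      (hd.of_frame hF₁ (by simp)) hx₁ ((hS ⟨i, hi⟩).of_frame hF₁ (by simp) (by simp))
      (hℓ _)).mono le_rfl ?_
    rintro s' ⟨hF, hv, hrest⟩
    refine ⟨hF, fun j hj => ?_⟩
    rcases Nat.lt_succ_iff_lt_or_eq.1 hj with h | h
    · have := hI₁ j h
      rw [HasVec, (hrest j h.ne).1, (hrest j h.ne).2]
      exact this
    · subst h; exact hv
  · refine Nat.mul_le_mul_left _ ?_
    have : (NatExpr.read 0 (NatExpr.const 0) (NatExpr.const 2)).cost = 3 := by decide
    omega
  · rintro s' ⟨hF, hI⟩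
    exact ⟨hF.mono (by simp) (by simp), fun j => hI j j.isLt⟩

/-! ### The estimates from the pairs of sketches -/

open RealExpr in
/-- One term of the matrix element of the observable between the vectors of a pair. -/
def termExpr : RealExpr :=
  sub
    (mul (read 1 (.var 14) (.var 15))
      (add (mul (read 8 (.mul (.const 2) (.var 16)) (.var 14))
          (read 8 (.add (.const 1) (.mul (.const 2) (.var 16))) (.var 15)))
        (mul (read 9 (.mul (.const 2) (.var 16)) (.var 14))
          (read 9 (.add (.const 1) (.mul (.const 2) (.var 16))) (.var 15)))))
    (mul (read 2 (.var 14) (.var 15))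
      (sub (mul (read 8 (.mul (.const 2) (.var 16)) (.var 14))
          (read 9 (.add (.const 1) (.mul (.const 2) (.var 16))) (.var 15)))
        (mul (read 9 (.mul (.const 2) (.var 16)) (.var 14))
          (read 8 (.add (.const 1) (.mul (.const 2) (.var 16))) (.var 15)))))

open RealExpr in
/-- The ratio of the dimension and the size of the sketches. -/
def ratioExpr : RealExpr := div (cast dimExpr) (cast (.read 6 (.var 7) (.const 0)))

open RealExpr in
/-- Compute the estimate from one pair of sketches. -/
def pairProgram : Program :=
  .seq (.writeReal 10 (.var 16) (.const 0) (cast (.const 0)))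
    (.seq (.forLoop 14 1 dimExpr (.forLoop 15 1 dimExpr
        (.writeReal 10 (.var 16) (.const 0) (add (read 10 (.var 16) (.const 0)) termExpr))))
      (.writeReal 10 (.var 16) (.const 0)
        (mul (mul ratioExpr ratioExpr) (read 10 (.var 16) (.const 0)))))

/-- Compute the estimates from all pairs of sketches. -/
def pairsProgram : Program := .forLoop 16 2 (.read 0 (.const 0) (.const 2)) pairProgram

/-- The memory contains the observable. -/
def HasMatrix (s : Memory) (M : Matrix (Qubits n) (Qubits n) ℂ) : Prop :=
  ∀ a < 2 ^ n, ∀ b < 2 ^ n, s.real 1 a b = (M (ket n a) (ket n b)).re ∧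
    s.real 2 a b = (M (ket n a) (ket n b)).im

lemma HasMatrix.of_frame {ns rs : List ℕ} {s s' : Memory} {M : Matrix (Qubits n) (Qubits n) ℂ}
    (h : HasMatrix s M) (hF : Frame ns rs s s') (h1 : 1 ∉ rs) (h2 : 2 ∉ rs) : HasMatrix s' M := by
  rw [HasMatrix, hF.real 1 h1, hF.real 2 h2]; exact h

lemma sum_ket_eq_dotProduct (M : Matrix (Qubits n) (Qubits n) ℂ) (u w : Qubits n → ℂ) :
    ∑ a ∈ Finset.range (2 ^ n), ∑ b ∈ Finset.range (2 ^ n),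
      (star (u (ket n a)) * (M (ket n a) (ket n b) * w (ket n b))).re =
      (star u ⬝ᵥ (M *ᵥ w)).re := by
  rw [sum_ket fun x => ∑ b ∈ Finset.range (2 ^ n), (star (u x) * (M x (ket n b) * w (ket n b))).re]
  have h : ∀ x, ∑ b ∈ Finset.range (2 ^ n), (star (u x) * (M x (ket n b) * w (ket n b))).re =
      ∑ y, (star (u x) * (M x y * w y)).re :=
    fun x => sum_ket fun y => (star (u x) * (M x y * w y)).re
  simp only [h]
  simp only [dotProduct, Matrix.mulVec, Complex.re_sum, Finset.mul_sum, Pi.star_apply]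

/-- The estimate from a pair of vectors. -/
noncomputable def vecEstimate (k : ℕ) (M : Matrix (Qubits n) (Qubits n) ℂ) (u w : Qubits n → ℂ) :
    ℝ :=
  ((2 ^ (n - k)) ^ 2 * (star u ⬝ᵥ (M *ᵥ w))).re

/-- Only real parts are accumulated. For Hermitian `M` the expectation value is real, so discarding
the imaginary part cannot increase the error. -/
lemma runs_pairProgram {s : Memory} {k i : ℕ} {M : Matrix (Qubits n) (Qubits n) ℂ}
    {u w : Qubits n → ℂ} (hp : HasPowers n s) (hk : s.nat 7 0 0 = k) (hkn : k ≤ n)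
    (hi : s.nat 16 0 0 = i) (hM : HasMatrix s M) (hu : HasVec s 8 9 (2 * i) u)
    (hw : HasVec s 8 9 (1 + 2 * i) w) :
    Runs pairProgram s ((2 ^ n + 1) * ((2 ^ n + 1) * 300 + 100) + 100) fun s' =>
      Frame [14, 15] [10] s s' ∧ s'.real 10 i 0 = vecEstimate k M u w ∧
        ∀ i', i' ≠ i → s'.real 10 i' = s.real 10 i' := by
  set t : ℕ → ℕ → ℝ := fun a b =>
    (star (u (ket n a)) * (M (ket n a) (ket n b) * w (ket n b))).re with ht
  have hterm : ∀ s' a b, Frame [14, 15] [10] s s' → s'.nat 14 0 0 = a → s'.nat 15 0 0 = b →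
      a < 2 ^ n → b < 2 ^ n → termExpr.eval s' = t a b := by
    intro s' a b hF ha hb ha' hb'
    have hi' : s'.nat 16 0 0 = i := by rw [hF.nat 16 (by simp), hi]
    have h1 := hM a ha' b hb'
    have h2 := hu a ha'
    have h3 := hw b hb'
    simp only [termExpr, RealExpr.eval, NatExpr.eval, NatExpr.eval_var, ha, hb, hi',
      hF.real 1 (by simp), hF.real 2 (by simp), hF.real 8 (by simp), hF.real 9 (by simp),
      h1.1, h1.2, h2.1, h2.2, h3.1, h3.2, ht, Complex.star_def, Complex.mul_re, Complex.mul_im,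
      Complex.conj_re, Complex.conj_im]
    ring
  have hstep1 : Runs (.writeReal 10 (.var 16) (.const 0) (.cast (.const 0))) s 10 fun s' =>
      Frame [14, 15] [10] s s' ∧ s'.real 10 i 0 = 0 ∧
        ∀ i', i' ≠ i → s'.real 10 i' = s.real 10 i' := by
    refine (Runs.writeReal ?_).mono (by decide) fun _ h => h
    simp only [NatExpr.eval, NatExpr.eval_var, RealExpr.eval, hi]
    refine ⟨(Frame.refl _ _ _).setReal (by simp) _ _ _, by simp [Memory.setReal_real],
      fun i' hi' => ?_⟩
    funext l; simp [Memory.setReal_real, hi']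
  refine (hstep1.seq (T' := (2 ^ n + 1) * ((2 ^ n + 1) * 300 + 100) + 60)
    (Q' := fun s' => Frame [14, 15] [10] s s' ∧ s'.real 10 i 0 = vecEstimate k M u w ∧
        ∀ i', i' ≠ i → s'.real 10 i' = s.real 10 i') ?_).mono (by omega) fun _ h => h
  rintro s₁ ⟨hF₁, h₁, hrest₁⟩
  have hstep2 : Runs (.forLoop 14 1 dimExpr (.forLoop 15 1 dimExpr
      (.writeReal 10 (.var 16) (.const 0)
        (.add (.read 10 (.var 16) (.const 0)) termExpr)))) s₁
      ((2 ^ n + 1) * ((2 ^ n + 1) * 300 + 100)) fun s' =>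
      Frame [14, 15] [10] s₁ s' ∧
        (s'.real 10 i 0 = ∑ a ∈ Finset.range (2 ^ n), ∑ b ∈ Finset.range (2 ^ n), t a b) ∧
        ∀ i', i' ≠ i → s'.real 10 i' = s₁.real 10 i' := by
    refine (Runs.forLoop (m := 2 ^ n) (T := (2 ^ n + 1) * 300) (ns := [15]) (rs := [10]) one_pos
      (by simp) (fun A s' =>
        (s'.real 10 i 0 = ∑ a ∈ Finset.range A, ∑ b ∈ Finset.range (2 ^ n), t a b) ∧
        ∀ i', i' ≠ i → s'.real 10 i' = s₁.real 10 i') ?_ ?_ ?_ ?_).mono ?_ ?_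
    · intro m s' x h; exact h
    · intro s' hF
      rw [(hp.of_frame (hF₁.trans (hF.mono (by simp) (by simp))) (by simp) (by simp)).eval_dimExpr,
        one_mul]
    · exact ⟨by simpa using h₁, fun _ _ => rfl⟩
    · intro A hA s₂ hF₂ hx₂ hI₂
      have hF₂' : Frame [14, 15] [10] s s₂ := hF₁.trans (hF₂.mono (by simp) (by simp))
      refine (Runs.forLoop (m := 2 ^ n) (T := 200) (ns := []) (rs := [10]) one_pos
        (by simp) (fun B s' =>
          (s'.real 10 i 0 = ∑ a ∈ Finset.range A, ∑ b ∈ Finset.range (2 ^ n), t a b +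
            ∑ b ∈ Finset.range B, t A b) ∧
          ∀ i', i' ≠ i → s'.real 10 i' = s₁.real 10 i') ?_ ?_ ?_ ?_).mono ?_ ?_
      · intro m s' x h; exact h
      · intro s' hF
        rw [(hp.of_frame (hF₂'.trans (hF.mono (by simp) (by simp))) (by simp)
          (by simp)).eval_dimExpr, one_mul]
      · exact ⟨by simpa using hI₂.1, hI₂.2⟩
      · intro B hB s₃ hF₃ hx₃ hI₃
        have hF₃' : Frame [14, 15] [10] s s₃ := hF₂'.trans (hF₃.mono (by simp) (by simp))
        have h14 : s₃.nat 14 0 0 = A := by rw [hF₃.nat 14 (by simp), hx₂]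
        refine (Runs.writeReal ?_).mono (by decide) fun _ h => h
        simp only [NatExpr.eval, NatExpr.eval_var, RealExpr.eval,
          hterm s₃ A B hF₃' h14 hx₃ hA hB, hF₃'.nat 16 (by simp), hi]
        refine ⟨(Frame.refl _ _ _).setReal (by simp) _ _ _, ?_, fun i' hi' => ?_⟩
        · simp [Memory.setReal_real, hI₃.1, Finset.sum_range_succ, add_assoc]
        · rw [← hI₃.2 i' hi']
          funext l; simp [Memory.setReal_real, hi']
      · refine Nat.mul_le_mul_left _ (by decide)
      · rintro s' ⟨hF, hI⟩
        exact ⟨hF, by rw [hI.1, Finset.sum_range_succ], hI.2⟩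
    · refine Nat.mul_le_mul_left _ ?_
      have : dimExpr.cost = 5 := by decide
      omega
    · rintro s' ⟨hF, hI⟩
      exact ⟨hF.mono (by simp) (by simp), hI.1, hI.2⟩
  refine (hstep2.seq (T' := 60) ?_)
  rintro s₂ ⟨hF₂, h₂, hrest₂⟩
  have hF₂' : Frame [14, 15] [10] s s₂ := hF₁.trans hF₂
  have hp₂ := hp.of_frame hF₂' (by simp) (by simp)
  refine (Runs.writeReal ?_).mono (by decide) fun _ h => h
  have hk₂ : s₂.nat 7 0 0 = k := by rw [hF₂'.nat 7 (by simp), hk]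
  have hi₂ : s₂.nat 16 0 0 = i := by rw [hF₂'.nat 16 (by simp), hi]
  have hratio : ratioExpr.eval s₂ = 2 ^ (n - k) := by
    simp only [ratioExpr, RealExpr.eval, hp₂.eval_dimExpr, NatExpr.eval, NatExpr.eval_var, hk₂,
      hp₂.2 k hkn]
    push_cast
    rw [pow_sub₀ _ (by norm_num) hkn, div_eq_mul_inv]
  simp only [NatExpr.eval, NatExpr.eval_var, RealExpr.eval, hi₂, hratio, h₂]
  refine ⟨hF₂'.setReal (by simp) _ _ _, ?_, fun i' hi' => ?_⟩
  · rw [Memory.setReal_real, if_pos ⟨rfl, rfl, rfl⟩, ht, sum_ket_eq_dotProduct, vecEstimate]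
    have : (2 ^ (n - k) : ℂ) ^ 2 = ((2 ^ (n - k) * 2 ^ (n - k) : ℝ) : ℂ) := by push_cast; ring
    rw [this, Complex.re_ofReal_mul]
  · rw [← hrest₁ i' hi', ← hrest₂ i' hi']
    funext l; simp [Memory.setReal_real, hi']

/-- Bound on the running time of the treatment of one pair of sketches. -/
def pairTime (n : ℕ) : ℕ := (2 ^ n + 1) * ((2 ^ n + 1) * 300 + 100) + 100

lemma runs_pairsProgram {s : Memory} {k L : ℕ} {M : Matrix (Qubits n) (Qubits n) ℂ}
    {V : Fin (L * 2) → Qubits n → ℂ} (hp : HasPowers n s) (hk : s.nat 7 0 0 = k) (hkn : k ≤ n)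
    (hN : s.nat 0 0 2 = L * 2) (hM : HasMatrix s M) (hV : ∀ j : Fin (L * 2), HasVec s 8 9 j (V j)) :
    Runs pairsProgram s ((L + 1) * (pairTime n + 100)) fun s' =>
      Frame [14, 15, 16] [10] s s' ∧
        ∀ i : Fin L, s'.real 10 i 0 = vecEstimate k M (pairFst V i) (pairSnd V i) := by
  refine (Runs.forLoop (m := L) (T := pairTime n) (ns := [14, 15]) (rs := [10]) two_pos
    (by simp) (fun i s' => ∀ l : Fin L, (l : ℕ) < i →
      s'.real 10 l 0 = vecEstimate k M (pairFst V l) (pairSnd V l)) ?_ ?_ ?_ ?_).mono ?_ ?_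
  · intro m s' x h; exact h
  · intro s' hF
    simp only [NatExpr.eval, hF.nat 0 (by simp), hN]; ring
  · simp
  · intro i hi s₁ hF₁ hx₁ hI₁
    have hv1 := (hV (finProdFinEquiv (⟨i, hi⟩, 0))).of_frame hF₁ (by simp) (by simp)
    have hv2 := (hV (finProdFinEquiv (⟨i, hi⟩, 1))).of_frame hF₁ (by simp) (by simp)
    -- Pair `i` consists of the sketches `2i` and `2i + 1`, which is the numbering used by
    -- `finProdFinEquiv`.
    have e1 : ((finProdFinEquiv ((⟨i, hi⟩ : Fin L), (0 : Fin 2)) : Fin (L * 2)) : ℕ) = 2 * i := by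
      simp [finProdFinEquiv]
    have e2 : ((finProdFinEquiv ((⟨i, hi⟩ : Fin L), (1 : Fin 2)) : Fin (L * 2)) : ℕ) =
        1 + 2 * i := by
      simp [finProdFinEquiv]
    rw [e1] at hv1
    rw [e2] at hv2
    refine (runs_pairProgram (hp.of_frame hF₁ (by simp) (by simp))
      (by rw [hF₁.nat 7 (by simp), hk]) hkn hx₁ (hM.of_frame hF₁ (by simp) (by simp)) hv1
      hv2).mono le_rfl ?_
    rintro s' ⟨hF, hv, hrest⟩
    refine ⟨hF, fun l hl => ?_⟩
    rcases Nat.lt_succ_iff_lt_or_eq.1 hl with h | h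
    · rw [hrest l h.ne]; exact hI₁ l h
    · subst h; exact hv
  · refine Nat.mul_le_mul_left _ ?_
    have : (NatExpr.read 0 (NatExpr.const 0) (NatExpr.const 2)).cost = 3 := by decide
    omega
  · rintro s' ⟨hF, hI⟩
    exact ⟨hF.mono (by simp) (by simp), fun j => hI j j.isLt⟩

/-! ### Bisection for the median -/

open RealExpr in
/-- The middle of the current interval. -/
def midExpr : RealExpr := div (add (var 11) (var 12)) (cast (.const 2))

/-- Count the estimates below the middle of the current interval. -/
def countProgram : Program :=
  .seq (.writeNat 8 (.const 0) (.const 0) (.const 0))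
    (.forLoop 16 2 (.read 0 (.const 0) (.const 2))
      (.branch (.realLE (.read 10 (.var 16) (.const 0)) midExpr)
        (.writeNat 8 (.const 0) (.const 0) (.add (.var 8) (.const 1))) .skip))

/-- One step of the bisection. -/
def bisectStep : Program :=
  .seq countProgram
    (.branch (.natLE (.read 0 (.const 0) (.const 2)) (.mul (.const 4) (.var 8)))
      (.writeReal 12 (.const 0) (.const 0) midExpr) (.writeReal 11 (.const 0) (.const 0) midExpr))

open RealExpr in
/-- Bisection for the median of the estimates. -/
def bisectProgram : Program :=
  .seq (.writeReal 11 (.const 0) (.const 0) (sub (cast (.const 0)) (cast (.const 2))))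
    (.seq (.writeReal 12 (.const 0) (.const 0) (cast (.const 2)))
      (.forLoop 17 1 (.add (.var 0) (.const 10)) bisectStep))

open Classical in
lemma runs_countProgram {s : Memory} {L : ℕ} (hN : s.nat 0 0 2 = L * 2) :
    Runs countProgram s ((L + 1) * 100 + 10) fun s' =>
      Frame [8, 16] [] s s' ∧ s'.nat 8 0 0 =
        ((Finset.range L).filter fun i => s.real 10 i 0 ≤ midExpr.eval s).card := by
  refine ((Runs.writeNat (Q := fun s' => Frame [8, 16] [] s s' ∧ s'.nat 8 0 0 = 0) ?_).seq
    (T' := (L + 1) * 100) (Q' := fun s' => Frame [8, 16] [] s s' ∧ s'.nat 8 0 0 =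
        ((Finset.range L).filter fun i => s.real 10 i 0 ≤ midExpr.eval s).card) ?_).mono ?_
      fun _ h => h
  · exact ⟨(Frame.refl _ _ _).setNat (by simp) _ _ _, by simp [Memory.setNat_nat, NatExpr.eval]⟩
  · rintro s₁ ⟨hF₁, h₁⟩
    refine (Runs.forLoop (m := L) (T := 40) (ns := [8]) (rs := []) two_pos
      (by simp) (fun i s' => s'.nat 8 0 0 =
        ((Finset.range i).filter fun i => s.real 10 i 0 ≤ midExpr.eval s).card) ?_ ?_ ?_ ?_).mono
        ?_ ?_
    · intro m s' x h
      rw [Memory.setNat_nat_of_ne _ _ _ _ (by simp)]; exact h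
    · intro s' hF
      simp only [NatExpr.eval, hF.nat 0 (by simp), hF₁.nat 0 (by simp), hN]; ring
    · simpa using h₁
    · intro i hi s₂ hF₂ hx₂ hI₂
      have hreal : s₂.real = s.real := by
        funext a; rw [hF₂.real a (by simp), hF₁.real a (by simp)]
      have hmid : midExpr.eval s₂ = midExpr.eval s := by
        simp only [midExpr, RealExpr.eval, RealExpr.eval_var, hreal, NatExpr.eval]
      have hhold : (Test.realLE (.read 10 (.var 16) (.const 0)) midExpr).Holds s₂ ↔
          s.real 10 i 0 ≤ midExpr.eval s := by
        simp only [Test.Holds, RealExpr.eval, hmid, hreal, NatExpr.eval, NatExpr.eval_var, hx₂]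
      refine (Runs.branch (T := 20) (fun hb => ?_) fun hb => ?_).mono (by decide) fun _ h => h
      · refine (Runs.writeNat ?_).mono (by decide) fun _ h => h
        refine ⟨(Frame.refl _ _ _).setNat (by simp) _ _ _, ?_⟩
        rw [Finset.range_add_one, Finset.filter_insert, if_pos (hhold.1 hb),
          Finset.card_insert_of_notMem (by simp), ← hI₂]
        simp [Memory.setNat_nat, NatExpr.eval]
      · refine (Runs.skip ?_).mono (by norm_num) fun _ h => h
        refine ⟨Frame.refl _ _ _, ?_⟩
        rw [Finset.range_add_one, Finset.filter_insert, if_neg fun h => hb (hhold.2 h), hI₂]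
    · refine Nat.mul_le_mul_left _ (by decide)
    · rintro s' ⟨hF, hI⟩
      exact ⟨hF₁.trans (hF.mono (by simp) (by simp)), hI⟩
  · simp only [NatExpr.cost]; omega

-- The invariant says that, if a strict majority of the estimates is within `δ` of `μ`, the upper
-- end is at least `μ - δ` and the lower end at most `μ + δ`. The interval itself need not contain
-- `μ`.
open Classical in
lemma runs_bisectStep {s : Memory} {L : ℕ} (hN : s.nat 0 0 2 = L * 2) {μ δ : ℝ}
    (hgood : L < 2 * ((Finset.range L).filter fun i => |s.real 10 i 0 - μ| ≤ δ).card →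
      μ - δ ≤ s.real 12 0 0 ∧ s.real 11 0 0 ≤ μ + δ) :
    Runs bisectStep s ((L + 1) * 100 + 50) fun s' =>
      Frame [8, 16] [11, 12] s s' ∧
        (s'.real 12 0 0 - s'.real 11 0 0 = (s.real 12 0 0 - s.real 11 0 0) / 2) ∧
        (L < 2 * ((Finset.range L).filter fun i => |s.real 10 i 0 - μ| ≤ δ).card →
          μ - δ ≤ s'.real 12 0 0 ∧ s'.real 11 0 0 ≤ μ + δ) := by
  refine ((runs_countProgram hN).seq (T' := 40) ?_).mono (by omega) fun _ h => h
  rintro s₁ ⟨hF₁, h₁⟩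
  have hreal : s₁.real = s.real := by funext a; rw [hF₁.real a (by simp)]
  have hmid : midExpr.eval s₁ = (s.real 11 0 0 + s.real 12 0 0) / 2 := by
    simp [midExpr, RealExpr.eval, hreal, NatExpr.eval]
  have hmid' : midExpr.eval s = (s.real 11 0 0 + s.real 12 0 0) / 2 := by
    simp [midExpr, RealExpr.eval, NatExpr.eval]
  rw [hmid'] at h₁
  set x := (s.real 11 0 0 + s.real 12 0 0) / 2 with hx
  have hhold : (Test.natLE (.read 0 (.const 0) (.const 2)) (.mul (.const 4) (.var 8))).Holds s₁ ↔
      L ≤ 2 * ((Finset.range L).filter fun i => s.real 10 i 0 ≤ x).card := by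
    simp only [Test.Holds, NatExpr.eval, NatExpr.eval_var, hF₁.nat 0 (by simp), hN, h₁]
    omega
  refine (Runs.branch (T := 20) (fun hb => ?_) fun hb => ?_).mono (by decide) fun _ h => h
  · refine (Runs.writeReal ?_).mono (by decide) fun _ h => h
    refine ⟨(hF₁.mono (by simp) (by simp)).setReal (by simp) _ _ _, ?_, fun hg => ⟨?_, ?_⟩⟩
    · simp only [NatExpr.eval, hmid]
      simp [Memory.setReal_real, hreal]
      rw [hx]; ring
    · simp only [NatExpr.eval, hmid]
      rw [Memory.setReal_real, if_pos ⟨rfl, rfl, rfl⟩]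
      -- If `x < μ - δ`, the estimates below `x` and the good ones are disjoint: at least half plus
      -- more than half of `L`.
      by_contra! hlt
      have hdisj : Disjoint ((Finset.range L).filter fun i => s.real 10 i 0 ≤ x)
          ((Finset.range L).filter fun i => |s.real 10 i 0 - μ| ≤ δ) := by
        refine Finset.disjoint_filter.2 fun i _ h1 h2 => ?_
        have := (abs_le.1 h2).1
        linarith
      have hcard := Finset.card_le_card (Finset.union_subset
        (Finset.filter_subset (fun i => s.real 10 i 0 ≤ x) (Finset.range L))
        (Finset.filter_subset (fun i => |s.real 10 i 0 - μ| ≤ δ) (Finset.range L)))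
      rw [Finset.card_union_of_disjoint hdisj, Finset.card_range] at hcard
      have := hhold.1 hb
      omega
    · have := (hgood hg).2
      simp only [NatExpr.eval]
      rw [Memory.setReal_real, if_neg (by simp), hreal]
      exact this
  · refine (Runs.writeReal ?_).mono (by decide) fun _ h => h
    refine ⟨(hF₁.mono (by simp) (by simp)).setReal (by simp) _ _ _, ?_, fun hg => ⟨?_, ?_⟩⟩
    · simp only [NatExpr.eval, hmid]
      simp [Memory.setReal_real, hreal]
      rw [hx]; ring
    · have := (hgood hg).1
      simp only [NatExpr.eval]
      rw [Memory.setReal_real, if_neg (by simp), hreal]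
      exact this
    · simp only [NatExpr.eval, hmid]
      rw [Memory.setReal_real, if_pos ⟨rfl, rfl, rfl⟩]
      -- If `μ + δ < x`, every good estimate is at most `x`, so the count would have passed the
      -- test.
      by_contra! hlt
      have hsub : ((Finset.range L).filter fun i => |s.real 10 i 0 - μ| ≤ δ) ⊆
          (Finset.range L).filter fun i => s.real 10 i 0 ≤ x := by
        refine Finset.monotone_filter_right _ fun i _ h2 => ?_
        have := (abs_le.1 h2).2
        linarith
      have hcard := Finset.card_le_card hsub
      exact hb (hhold.2 (by omega))

-- The invariant holds for `[-2, 2]` because `|μ| ≤ 1`, and every step halves the width. At the end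
-- the upper end is at least `μ - δ` and exceeds `μ + δ` by at most the width.
open Classical in
lemma runs_bisectProgram {s : Memory} {L : ℕ} (hn : s.nat 0 0 0 = n) (hN : s.nat 0 0 2 = L * 2)
    {μ δ : ℝ} (hμ : |μ| ≤ 1) (hδ : 0 ≤ δ) :
    Runs bisectProgram s ((n + 11) * ((L + 1) * 100 + 200) + 50) fun s' =>
      Frame [8, 16, 17] [11, 12] s s' ∧
        (L < 2 * ((Finset.range L).filter fun i => |s.real 10 i 0 - μ| ≤ δ).card →
          |s'.real 12 0 0 - μ| ≤ δ + 4 / 2 ^ (n + 10)) := by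
  have hμ' := abs_le.1 hμ
  have h1 : Runs (.writeReal 11 (.const 0) (.const 0)
      (.sub (.cast (.const 0)) (.cast (.const 2)))) s 10 fun s' =>
      Frame [8, 16, 17] [11, 12] s s' ∧ s'.real 11 0 0 = -2 := by
    refine (Runs.writeReal ?_).mono (by decide) fun _ h => h
    exact ⟨(Frame.refl _ _ _).setReal (by simp) _ _ _, by
      simp [Memory.setReal_real, NatExpr.eval, RealExpr.eval]⟩
  refine (h1.seq (T' := (n + 11) * ((L + 1) * 100 + 200) + 40) (Q' := fun s' =>
      Frame [8, 16, 17] [11, 12] s s' ∧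
        (L < 2 * ((Finset.range L).filter fun i => |s.real 10 i 0 - μ| ≤ δ).card →
          |s'.real 12 0 0 - μ| ≤ δ + 4 / 2 ^ (n + 10))) ?_).mono (by omega) fun _ h => h
  rintro s₁ ⟨hF₁, hlo⟩
  have h2 : Runs (.writeReal 12 (.const 0) (.const 0) (.cast (.const 2))) s₁ 10 fun s' =>
      Frame [8, 16, 17] [11, 12] s s' ∧ s'.real 11 0 0 = -2 ∧ s'.real 12 0 0 = 2 := by
    refine (Runs.writeReal ?_).mono (by decide) fun _ h => h
    refine ⟨hF₁.setReal (by simp) _ _ _, ?_, ?_⟩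
    · rw [Memory.setReal_real, if_neg (by simp), hlo]
    · simp [Memory.setReal_real, NatExpr.eval, RealExpr.eval]
  refine (h2.seq (T' := (n + 11) * ((L + 1) * 100 + 200)) ?_).mono (by omega) fun _ h => h
  rintro s₂ ⟨hF₂, hlo₂, hhi₂⟩
  refine (Runs.forLoop (m := n + 10) (T := (L + 1) * 100 + 50) (ns := [8, 16]) (rs := [11, 12])
    one_pos (by simp) (fun t s' => s'.real 12 0 0 - s'.real 11 0 0 = 4 / 2 ^ t ∧
      (L < 2 * ((Finset.range L).filter fun i => |s.real 10 i 0 - μ| ≤ δ).card →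
          μ - δ ≤ s'.real 12 0 0 ∧ s'.real 11 0 0 ≤ μ + δ)) ?_ ?_ ?_ ?_).mono ?_ ?_
  · intro m s' x h; exact h
  · intro s' hF
    simp only [NatExpr.eval, NatExpr.eval_var, hF.nat 0 (by simp), hF₂.nat 0 (by simp), hn, one_mul]
  · rw [hlo₂, hhi₂]
    exact ⟨by norm_num, fun _ => ⟨by linarith, by linarith⟩⟩
  · intro t ht s₃ hF₃ hx₃ hI₃
    have h10 : s₃.real 10 = s.real 10 := by rw [hF₃.real 10 (by simp), hF₂.real 10 (by simp)]
    have hN₃ : s₃.nat 0 0 2 = L * 2 := by rw [hF₃.nat 0 (by simp), hF₂.nat 0 (by simp), hN]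
    rw [← h10] at hI₃ ⊢
    refine (runs_bisectStep hN₃ hI₃.2).mono le_rfl ?_
    rintro s' ⟨hF, hw, hg⟩
    refine ⟨hF, ?_, hg⟩
    rw [hw, hI₃.1, pow_succ]; field_simp
  · refine Nat.mul_le_mul (by omega) ?_
    have : (NatExpr.add (NatExpr.var 0) (NatExpr.const 10)).cost = 5 := by decide
    omega
  · rintro s' ⟨hF, hw, hI⟩
    refine ⟨hF₂.trans (hF.mono (by simp) (by simp)), fun hg => ?_⟩
    obtain ⟨h3, h4⟩ := hI hg
    have h5 : (0 : ℝ) < 4 / 2 ^ (n + 10) := by positivity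
    rw [abs_le]
    constructor <;> linarith

/-! ### The complete program -/

/-- Write the result: the first estimate if the sketches are complete, otherwise the result of the
bisection. -/
def outputProgram : Program :=
  .branch (.natLE (.var 0) (.var 7))
    (.writeReal 5 (.const 0) (.const 0) (.read 10 (.const 0) (.const 0)))
    (.writeReal 5 (.const 0) (.const 0) (.var 12))

/-- The program for the estimation of expectation values from stabilizer sketches. -/
def mainProgram : Program :=
  .seq powersProgram (.seq digitsProgram (.seq sizeProgram (.seq sketchesProgram
    (.seq pairsProgram (.seq bisectProgram outputProgram)))))

/-- Bound on the running time of the program. -/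
def mainTime (n ℓ L : ℕ) : ℕ :=
  (n + 1) * 100 + ((n + 1) * ((2 ^ n + 1) * 100 + 100) + ((n + 1) * 200 +
    ((L * 2 + 1) * (sketchTime n ℓ + 100) + ((L + 1) * (pairTime n + 100) +
      ((n + 11) * ((L + 1) * 100 + 200) + 50 + 30)))))

/-- The approximation of the projected state vector that is computed from a sketch. -/
noncomputable def Sketch.state {k : ℕ} (S : Sketch n k) : Qubits n → ℂ :=
  (circuitMatrix S.circuit)ᴴ *ᵥ S.vec

/-- The estimate from the pair of sketches number `i`. -/
noncomputable def sketchEstimate {k L : ℕ} (M : Matrix (Qubits n) (Qubits n) ℂ)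
    (S : Fin (L * 2) → Sketch n k) (i : Fin L) : ℝ :=
  vecEstimate k M (pairFst S i).state (pairSnd S i).state

-- The case `k = n` needs its own output: there `ε` may be far below `2^(-n)`, out of reach of `n +
-- 10` bisection steps, but the first estimate is already accurate.
open Classical in
lemma runs_mainProgram {s : Memory} {r k L ℓ : ℕ} {ε : ℝ} {M : Matrix (Qubits n) (Qubits n) ℂ}
    {S : Fin (L * 2) → Sketch n k} (hL : 0 < L) (hn : s.nat 0 0 0 = n) (hr : s.nat 0 0 1 = r)
    (hN : s.nat 0 0 2 = L * 2) (h5 : ∀ i j, s.nat 5 i j = 0) (he : s.real 0 0 0 = ε)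
    (hS : ∀ j : Fin (L * 2), HasSketch s j (S j)) (hM : HasMatrix s M)
    (hℓ : ∀ j, (S j).circuit.length ≤ ℓ)
    (hk : IsGreatest {l : ℕ | l ≤ n ∧
          (2 : ℝ) ^ l ≤ 24 * max ((ε ^ 2)⁻¹) (Real.sqrt r * ε⁻¹)} k)
    {μ δ : ℝ} (hμ : |μ| ≤ 1) (hδ : 0 ≤ δ) :
    Runs mainProgram s (mainTime n ℓ L) fun s' =>
      (k = n → s'.real 5 0 0 = sketchEstimate M S ⟨0, hL⟩) ∧
      (k < n → L < 2 * (Finset.univ.filter fun i => |sketchEstimate M S i - μ| ≤ δ).card →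
        |s'.real 5 0 0 - μ| ≤ δ + 4 / 2 ^ (n + 10)) := by
  have hkn : k ≤ n := hk.1.1
  refine (runs_powersProgram hn).seq ?_
  rintro s₁ ⟨hF₁, hp₁⟩
  refine (runs_digitsProgram hp₁ fun i j => by rw [hF₁.nat 5 (by simp), h5]).seq ?_
  rintro s₂ ⟨hF₂, hd₂⟩
  have hp₂ := hp₁.of_frame hF₂ (by simp) (by simp)
  have hG₂ : Frame [5, 6, 10, 11] [] s s₂ :=
    (hF₁.mono (by simp) (by simp)).trans (hF₂.mono (by simp) (by simp))
  refine (runs_sizeProgram hp₂ (by rw [hG₂.nat 0 (by simp), hr])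
    (by rw [hG₂.real 0 (by simp), he]) hk).seq ?_
  rintro s₃ ⟨hF₃, hk₃⟩
  have hp₃ := hp₂.of_frame hF₃ (by simp) (by simp)
  have hd₃ := hd₂.of_frame hF₃ (by simp)
  have hG₃ : Frame [5, 6, 7, 10, 11] [] s s₃ :=
    (hG₂.mono (by simp) (by simp)).trans (hF₃.mono (by simp) (by simp))
  refine (runs_sketchesProgram hp₃ hd₃ (by rw [hG₃.nat 0 (by simp), hN])
    (fun j => (hS j).of_frame hG₃ (by simp) (by simp)) hℓ).seq ?_
  rintro s₄ ⟨hF₄, hV₄⟩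
  have hp₄ := hp₃.of_frame hF₄ (by simp) (by simp)
  have hG₄ : Frame [5, 6, 7, 10, 11, 12, 13] [6, 7, 8, 9] s s₄ :=
    (hG₃.mono (by simp) (by simp)).trans (hF₄.mono (by simp) (by simp))
  refine (runs_pairsProgram hp₄ (by rw [hF₄.nat 7 (by simp), hk₃]) hkn
    (by rw [hG₄.nat 0 (by simp), hN]) (hM.of_frame hG₄ (by simp) (by simp)) hV₄).seq ?_
  rintro s₅ ⟨hF₅, hest⟩
  have hG₅ : Frame [5, 6, 7, 10, 11, 12, 13, 14, 15, 16] [6, 7, 8, 9, 10] s s₅ :=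
    (hG₄.mono (by simp) (by simp)).trans (hF₅.mono (by simp) (by simp))
  refine (runs_bisectProgram (by rw [hG₅.nat 0 (by simp), hn])
    (by rw [hG₅.nat 0 (by simp), hN]) hμ hδ).seq ?_
  rintro s₆ ⟨hF₆, hbis⟩
  have hn₆ : s₆.nat 0 0 0 = n := by rw [hF₆.nat 0 (by simp), hG₅.nat 0 (by simp), hn]
  have hk₆ : s₆.nat 7 0 0 = k := by
    rw [hF₆.nat 7 (by simp), hF₅.nat 7 (by simp), hF₄.nat 7 (by simp), hk₃]
  have hcard : ((Finset.range L).filter fun i => |s₅.real 10 i 0 - μ| ≤ δ).card =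
      (Finset.univ.filter fun i => |sketchEstimate M S i - μ| ≤ δ).card := by
    rw [Finset.card_filter, Finset.card_filter,
      ← Fin.sum_univ_eq_sum_range fun i => if |s₅.real 10 i 0 - μ| ≤ δ then 1 else 0]
    exact Finset.sum_congr rfl fun i _ => by rw [hest i]; rfl
  rw [hcard] at hbis
  refine (Runs.branch (T := 10) (fun hb => ?_) fun hb => ?_).mono (by decide) fun _ h => h
  · refine (Runs.writeReal ?_).mono (by decide) fun _ h => h
    simp only [Test.Holds, NatExpr.eval_var, hn₆, hk₆] at hb
    refine ⟨fun _ => ?_, fun h => absurd hb (by omega)⟩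
    simp only [NatExpr.eval, RealExpr.eval, Memory.setReal_real, and_self, if_true]
    rw [hF₆.real 10 (by simp)]
    exact hest ⟨0, hL⟩
  · refine (Runs.writeReal ?_).mono (by decide) fun _ h => h
    simp only [Test.Holds, NatExpr.eval_var, hn₆, hk₆] at hb
    refine ⟨fun h => absurd h.ge hb, fun _ hg => ?_⟩
    simp only [NatExpr.eval, RealExpr.eval_var, Memory.setReal_real, and_self, if_true]
    exact hbis hg

/-! ### The input -/

lemma hasSketch_inputMemory {k N : ℕ} (r : ℕ) (ε p : ℝ) (M : Matrix (Qubits n) (Qubits n) ℂ)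
    (S : Fin N → Sketch n k) (hk : k ≤ n) (j : Fin N) :
    HasSketch (inputMemory r ε p M S) j (S j) where
  len := by simp [inputMemory]
  code i h := by simp [inputMemory, h]
  amp m hm := by
    have h2 : 2 ^ k ≤ 2 ^ n := Nat.pow_le_pow_right two_pos hk
    by_cases hmk : m < 2 ^ k
    · simp [inputMemory, hmk, Sketch.vec, ketIndex_ket hm]
    · simp [inputMemory, hmk, Sketch.vec, ketIndex_ket hm]

lemma hasMatrix_inputMemory {k N : ℕ} (r : ℕ) (ε p : ℝ) (M : Matrix (Qubits n) (Qubits n) ℂ)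
    (S : Fin N → Sketch n k) : HasMatrix (inputMemory r ε p M S) M := by
  intro a ha b hb
  simp [inputMemory, ha, hb]

open Classical in
lemma runs_mainProgram_inputMemory {r k L ℓ : ℕ} {ε p : ℝ} {M : Matrix (Qubits n) (Qubits n) ℂ}
    {S : Fin (L * 2) → Sketch n k} (hL : 0 < L) (hℓ : ∀ j, (S j).circuit.length ≤ ℓ)
    (hk : IsGreatest {l : ℕ | l ≤ n ∧
          (2 : ℝ) ^ l ≤ 24 * max ((ε ^ 2)⁻¹) (Real.sqrt r * ε⁻¹)} k)
    {μ δ : ℝ} (hμ : |μ| ≤ 1) (hδ : 0 ≤ δ) :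
    Runs mainProgram (inputMemory r ε p M S) (mainTime n ℓ L) fun s' =>
      (k = n → s'.real 5 0 0 = sketchEstimate M S ⟨0, hL⟩) ∧
      (k < n → L < 2 * (Finset.univ.filter fun i => |sketchEstimate M S i - μ| ≤ δ).card →
        |s'.real 5 0 0 - μ| ≤ δ + 4 / 2 ^ (n + 10)) :=
  runs_mainProgram hL (by simp [inputMemory]) (by simp [inputMemory]) (by simp [inputMemory])
    (by simp [inputMemory]) (by simp [inputMemory])
    (hasSketch_inputMemory r ε p M S hk.1.1) (hasMatrix_inputMemory r ε p M S) hℓ hk hμ hδ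

/-! ### Accuracy of the estimates -/

/-- The number of bits of precision of the amplitudes. -/
noncomputable def precision (n : ℕ) (ε : ℝ) : ℕ := 3 * n + 10 + ⌈2 * Real.log ε⁻¹⌉₊

/-- Since `2 log 2 > 1`, `2 log ε⁻¹` bits account for `ε⁻¹`. The factor `(2^n)³` pays for the
prefactor `4^(n-k)` and for the growth of the error with the number of components. -/
lemma two_pow_precision_ge (n : ℕ) {ε : ℝ} (h0 : 0 < ε) (h1 : ε < 1) :
    1024 * (2 ^ n) ^ 3 * ε⁻¹ ≤ (2 : ℝ) ^ precision n ε := by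
  have hlog : 0 ≤ Real.log ε⁻¹ := Real.log_nonneg (one_le_inv_iff₀.2 ⟨h0, h1.le⟩)
  have h2 : ε⁻¹ ≤ (2 : ℝ) ^ ⌈2 * Real.log ε⁻¹⌉₊ := by
    rw [← Real.log_le_log_iff (by positivity) (by positivity), Real.log_pow]
    have h3 := Nat.le_ceil (2 * Real.log ε⁻¹)
    have h4 := Real.log_two_gt_d9
    nlinarith
  have e : (2 : ℝ) ^ precision n ε = 1024 * (2 ^ n) ^ 3 * 2 ^ ⌈2 * Real.log ε⁻¹⌉₊ := by
    rw [precision, pow_add, pow_add, mul_comm 3 n, pow_mul]; norm_num; ring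
  rw [e]
  exact mul_le_mul_of_nonneg_left h2 (by positivity)

lemma expectation_im {M : Matrix (Qubits n) (Qubits n) ℂ} (hM : M.IsHermitian)
    (ψ : EuclideanSpace ℂ (Qubits n)) : (expectation M ψ).im = 0 :=
  hM.im_star_dotProduct_mulVec_self _

lemma norm_expectation_le {M : Matrix (Qubits n) (Qubits n) ℂ}
    (hM : ‖Matrix.toEuclideanCLM (n := Qubits n) (𝕜 := ℂ) M‖ ≤ 1)
    {ψ : EuclideanSpace ℂ (Qubits n)} (hψ : ‖ψ‖ = 1) : ‖expectation M ψ‖ ≤ 1 := by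
  have h1 : lenSq ψ.ofLp = 1 := by rw [norm_sq_ofLp, hψ, one_pow]
  have h2 := lenSq_mulVec_le hM ψ.ofLp
  refine (norm_dotProduct_le _ _).trans ?_
  rw [h1, Real.sqrt_one, one_mul]
  exact Real.sqrt_le_one.2 (h2.trans_eq h1)

lemma norm_ofReal_sub_expectation {M : Matrix (Qubits n) (Qubits n) ℂ} (hM : M.IsHermitian)
    (ψ : EuclideanSpace ℂ (Qubits n)) (E : ℝ) :
    ‖(E : ℂ) - expectation M ψ‖ = |E - (expectation M ψ).re| := by
  have : expectation M ψ = ((expectation M ψ).re : ℂ) :=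
    Complex.ext rfl (by rw [expectation_im hM, Complex.ofReal_im])
  rw [this, ← Complex.ofReal_sub, Complex.norm_real, Complex.ofReal_re, Real.norm_eq_abs]

lemma abs_vecEstimate_sub_le {k len : ℕ} (hk : k ≤ n) {ε : ℝ} (h0 : 0 < ε) (h1 : ε < 1)
    {M : Matrix (Qubits n) (Qubits n) ℂ}
    (hM : ‖Matrix.toEuclideanCLM (n := Qubits n) (𝕜 := ℂ) M‖ ≤ 1)
    {ψ : EuclideanSpace ℂ (Qubits n)} (hψ : ‖ψ‖ = 1) {S S' : Sketch n k} {C C' : Clifford n}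
    (hS : S.Describes C ψ len (1 / 2 ^ precision n ε))
    (hS' : S'.Describes C' ψ len (1 / 2 ^ precision n ε)) :
    |vecEstimate k M S.state S'.state - (pairEstimate k M ψ.ofLp C C').re| ≤ ε / 100 := by
  have hlen : lenSq ψ.ofLp = 1 := by rw [norm_sq_ofLp, hψ, one_pow]
  set δ : ℝ := 1 / 2 ^ precision n ε with hδ
  have hδ0 : 0 ≤ δ := by positivity
  set X : ℝ := 2 ^ n with hX
  have hX1 : 1 ≤ X := one_le_pow₀ one_le_two
  have hδ1 : 1024 * X ^ 3 * δ ≤ ε := by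
    have h := two_pow_precision_ge n h0 h1
    rw [hδ, mul_one_div, div_le_iff₀ (by positivity)]
    have h2 := mul_le_mul_of_nonneg_left h h0.le
    rw [← hX] at h2
    calc 1024 * X ^ 3 = ε * (1024 * X ^ 3 * ε⁻¹) := by field_simp
      _ ≤ _ := h2
  have hX3 : X ≤ X ^ 3 := le_self_pow₀ hX1 (by norm_num)
  have hη1 : X * 2 * δ ≤ 1 := by nlinarith
  -- The true factor `√(2 · 2^n)` is replaced by the cruder `2 · 2^n`, to avoid a square root.
  have hsq : ∀ {T : Sketch n k} {D : Clifford n},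
      T.Describes D ψ len δ → lenSq (T.state - projVec k D ψ.ofLp) ≤ (X * 2 * δ) ^ 2 := by
    intro T D hT
    rw [Sketch.state, hT.1]
    refine (Sketch.lenSq_sub_projVec_le hk hT).trans ?_
    rw [← hX]
    nlinarith [sq_nonneg δ, mul_nonneg (sub_nonneg.2 hX1) (sq_nonneg δ)]
  have hproj : ∀ D : Clifford n, lenSq (projVec k D ψ.ofLp) ≤ 1 := fun D =>
    (lenSq_projVec_le k D _).trans_eq hlen
  have h := norm_matrixElement_sub_le hM (by positivity) hη1 (hproj C) (hproj C') (hsq hS)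
    (hsq hS')
  rw [vecEstimate, pairEstimate, ← Complex.sub_re, ← mul_sub]
  refine (Complex.abs_re_le_norm _).trans ?_
  rw [norm_mul, norm_pow, norm_pow, Complex.norm_ofNat]
  have h2 : (2 : ℝ) ^ (n - k) ≤ X := pow_le_pow_right₀ one_le_two (Nat.sub_le _ _)
  have h3 : ((2 : ℝ) ^ (n - k)) ^ 2 ≤ X ^ 2 := pow_le_pow_left₀ (by positivity) h2 2
  refine (mul_le_mul h3 h (norm_nonneg _) (by positivity)).trans ?_
  -- The error is at most `X² · 3 · 2Xδ = 6X³δ ≤ 6ε/1024`.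
  nlinarith

/-- As `k + 1 ≤ n`, maximality means that `2^(k+1)` exceeds the size bound; halving turns 24 into
12. -/
lemma twelve_mul_max_lt {r k : ℕ} {ε : ℝ} (hkn : k < n)
    (hk : IsGreatest {l : ℕ | l ≤ n ∧
          (2 : ℝ) ^ l ≤ 24 * max ((ε ^ 2)⁻¹) (Real.sqrt r * ε⁻¹)} k) :
    12 * max ((ε ^ 2)⁻¹) (Real.sqrt r * ε⁻¹) < 2 ^ k := by
  by_contra! h
  have h2 : k + 1 ≤ k := hk.2 ⟨hkn, by rw [pow_succ]; linarith⟩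
  omega

-- Chebyshev. The two lower bounds on `2^k` give a variance of at most `(24 + 1)/144 · ε²`, and
-- `25/144 < (1/5) · 0.95²`.
open Classical in
lemma five_mul_bad_pairs_le [Fintype (Clifford n)] {r k : ℕ} {ε : ℝ} (hn : 1 ≤ n) (h0 : 0 < ε)
    (hkn : k < n)
    (hk : IsGreatest {l : ℕ | l ≤ n ∧
          (2 : ℝ) ^ l ≤ 24 * max ((ε ^ 2)⁻¹) (Real.sqrt r * ε⁻¹)} k)
    {M : Matrix (Qubits n) (Qubits n) ℂ} (hM : M.IsHermitian)
    (hM1 : ‖Matrix.toEuclideanCLM (n := Qubits n) (𝕜 := ℂ) M‖ ≤ 1) (hr : M.rank ≤ r)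
    {ψ : EuclideanSpace ℂ (Qubits n)} (hψ : ‖ψ‖ = 1) :
    5 * ∑ C₁, ∑ C₂, (if 95 / 100 * ε < ‖pairEstimate k M ψ.ofLp C₁ C₂ - expectation M ψ‖
      then (1 : ℝ) else 0) ≤ (Fintype.card (Clifford n) : ℝ) ^ 2 := by
  have hlen : lenSq ψ.ofLp = 1 := by rw [norm_sq_ofLp, hψ, one_pow]
  have hmax := twelve_mul_max_lt hkn hk
  set K : ℝ := 2 ^ k with hK
  have hK0 : 0 < K := by positivity
  have hr0 : (0 : ℝ) ≤ r := r.cast_nonneg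
  have hvar : 2 * lenSq (M *ᵥ ψ.ofLp) / K + (∑ i, ∑ j, ‖M i j‖ ^ 2) / K ^ 2 ≤
      25 / 144 * ε ^ 2 := by
    have e1 : 12 * (ε ^ 2)⁻¹ ≤ K :=
      (mul_le_mul_of_nonneg_left (le_max_left _ _) (by norm_num)).trans hmax.le
    have e2 : 12 * (Real.sqrt r * ε⁻¹) ≤ K :=
      (mul_le_mul_of_nonneg_left (le_max_right _ _) (by norm_num)).trans hmax.le
    have f1 : 12 ≤ K * ε ^ 2 := by
      have := mul_le_mul_of_nonneg_right e1 (sq_nonneg ε)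
      rwa [mul_assoc, inv_mul_cancel₀ (by positivity), mul_one] at this
    have f2 : 144 * r ≤ K ^ 2 * ε ^ 2 := by
      have h := mul_le_mul_of_nonneg_right e2 h0.le
      rw [mul_assoc, mul_assoc, inv_mul_cancel₀ h0.ne', mul_one] at h
      have h' := pow_le_pow_left₀ (by positivity) h 2
      rw [mul_pow, Real.sq_sqrt hr0, mul_pow] at h'
      linarith
    have g1 : 2 * lenSq (M *ᵥ ψ.ofLp) / K ≤ 24 / 144 * ε ^ 2 := by
      rw [div_le_iff₀ hK0]
      have := (lenSq_mulVec_le hM1 ψ.ofLp).trans_eq hlen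
      linarith
    have g2 : (∑ i, ∑ j, ‖M i j‖ ^ 2) / K ^ 2 ≤ 1 / 144 * ε ^ 2 := by
      rw [div_le_iff₀ (by positivity)]
      have h := (sum_norm_entries_sq_le hM hM1).trans (Nat.cast_le.2 hr)
      linarith
    linarith
  have hsum := sum_norm_pairEstimate_sub_sq_le hn hkn.le hM hlen
  have hcard : (0 : ℝ) ≤ (Fintype.card (Clifford n) : ℝ) ^ 2 := by positivity
  have hle : (95 / 100 * ε) ^ 2 * ∑ C₁, ∑ C₂,
      (if 95 / 100 * ε < ‖pairEstimate k M ψ.ofLp C₁ C₂ - expectation M ψ‖ then (1 : ℝ) else 0) ≤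
      (Fintype.card (Clifford n) : ℝ) ^ 2 * (25 / 144 * ε ^ 2) := by
    refine (le_trans ?_ hsum).trans (mul_le_mul_of_nonneg_left hvar hcard)
    rw [Finset.mul_sum]
    refine Finset.sum_le_sum fun C₁ _ => ?_
    rw [Finset.mul_sum]
    refine Finset.sum_le_sum fun C₂ _ => ?_
    split_ifs with h
    · rw [mul_one]
      exact pow_le_pow_left₀ (by positivity) h.le 2
    · rw [mul_zero]; positivity
  have hε2 : 0 < ε ^ 2 := by positivity
  refine le_of_mul_le_mul_right ?_ hε2
  nlinarith [mul_nonneg hcard hε2.le]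

/-! ### Existence of sketches -/

lemma norm_amplitude_le_one {ψ : EuclideanSpace ℂ (Qubits n)} (hψ : ‖ψ‖ = 1) (C : Clifford n)
    (z : ℕ) : ‖amplitude C ψ z‖ ≤ 1 := by
  have h1 : lenSq (C.1 *ᵥ ψ.ofLp) = 1 := by
    rw [lenSq_mulVec_unitary C.conjTranspose_mul, norm_sq_ofLp, hψ, one_pow]
  have h2 : ‖amplitude C ψ z‖ ^ 2 ≤ lenSq (C.1 *ᵥ ψ.ofLp) :=
    Finset.single_le_sum (f := fun u => ‖(C.1 *ᵥ ψ.ofLp) u‖ ^ 2) (fun _ _ => by positivity)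
      (Finset.mem_univ (ket n z))
  exact (sq_le_one_iff₀ (norm_nonneg _)).1 (h2.trans_eq h1)

lemma exists_dyadic_approx (b : ℕ) {x : ℝ} (hx : |x| ≤ 1) :
    ∃ u : ℤ, |u| ≤ 2 ^ b ∧ |(u : ℝ) / 2 ^ b - x| ≤ 1 / 2 ^ b := by
  have hB : (0 : ℝ) < 2 ^ b := by positivity
  obtain ⟨h1, h2⟩ := abs_le.1 hx
  refine ⟨⌊x * 2 ^ b⌋, abs_le.2 ⟨Int.le_floor.2 ?_, ?_⟩, ?_⟩
  · push_cast; nlinarith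
  · have h3 := Int.floor_le (x * 2 ^ b)
    have h4 : ((⌊x * 2 ^ b⌋ : ℤ) : ℝ) ≤ ((2 ^ b : ℤ) : ℝ) := by push_cast; nlinarith
    exact_mod_cast h4
  · have h3 := Int.floor_le (x * 2 ^ b)
    have h4 := Int.lt_floor_add_one (x * 2 ^ b)
    have e : (⌊x * 2 ^ b⌋ : ℝ) / 2 ^ b - x = (⌊x * 2 ^ b⌋ - x * 2 ^ b) / 2 ^ b := by
      field_simp
    rw [e, abs_div, abs_of_pos hB]
    exact div_le_div_of_nonneg_right (abs_le.2 ⟨by linarith, by linarith⟩) hB.le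

lemma exists_sketch {k : ℕ} (hn : 1 ≤ n) (b : ℕ) (C : Clifford n)
    {ψ : EuclideanSpace ℂ (Qubits n)} (hψ : ‖ψ‖ = 1) :
    ∃ S : Sketch n k, S.Describes C ψ (81 * n ^ 2) (1 / 2 ^ b) ∧ S.HasBits b := by
  obtain ⟨w, hw⟩ := C.2
  obtain ⟨w', hlen, hw'⟩ := exists_short_circuit hn w
  have hamp := norm_amplitude_le_one hψ C
  choose u hu hu' using fun z : Fin (2 ^ k) =>
    exists_dyadic_approx b ((Complex.abs_re_le_norm _).trans (hamp z))
  choose v hv hv' using fun z : Fin (2 ^ k) =>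
    exists_dyadic_approx b ((Complex.abs_im_le_norm _).trans (hamp z))
  exact ⟨⟨w', fun z => ⟨u z / 2 ^ b, v z / 2 ^ b⟩⟩, ⟨hw'.trans hw, hlen, fun z => ⟨hu' z, hv' z⟩⟩,
    fun z => ⟨u z, v z, hu z, hv z, rfl, rfl⟩⟩

/-! ### Numerical bounds -/

lemma pairCount_le {p : ℝ} (h0 : 0 < p) (h1 : p < 1) :
    (pairCount p : ℝ) ≤ 5 * (1 + Real.log p⁻¹) := by
  have hlog : 0 ≤ Real.log p⁻¹ := Real.log_nonneg (one_le_inv_iff₀.2 ⟨h0, h1.le⟩)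
  have := Nat.ceil_lt_add_one (a := 5 * Real.log p⁻¹) (by positivity)
  rw [pairCount]
  push_cast
  linarith

lemma precision_le (hn : 1 ≤ n) {ε : ℝ} (h0 : 0 < ε) (h1 : ε < 1) :
    (precision n ε : ℝ) ≤ 14 * (n + Real.log ε⁻¹) := by
  have hlog : 0 ≤ Real.log ε⁻¹ := Real.log_nonneg (one_le_inv_iff₀.2 ⟨h0, h1.le⟩)
  have := Nat.ceil_lt_add_one (a := 2 * Real.log ε⁻¹) (by positivity)
  have hn' : (1 : ℝ) ≤ n := by exact_mod_cast hn
  rw [precision]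
  push_cast
  linarith

/-- Bounding `n` crudely by `2^n`, both the `n² 2^n` operations for a sketch and the `4^n` for a
pair are absorbed in `8^n`. -/
lemma mainTime_le (hn : 1 ≤ n) {L : ℕ} (hL : 1 ≤ L) :
    mainTime n (81 * n ^ 2) L ≤ 2 ^ 22 * (2 ^ n) ^ 3 * L := by
  have hX : n + 1 ≤ 2 ^ n := Nat.lt_two_pow_self
  set X := 2 ^ n with hXdef
  have hX2 : 2 ≤ X := by omega
  have h1 : 81 * n ^ 2 + 1 ≤ 81 * X ^ 2 := by nlinarith
  have hs : sketchTime n (81 * n ^ 2) ≤ 121800 * X ^ 3 := by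
    rw [sketchTime, ← hXdef]
    calc _ ≤ (X + 1) * 200 + 81 * X ^ 2 * ((X + 1) * 900 + 100) :=
          Nat.add_le_add_left (Nat.mul_le_mul_right _ h1) _
      _ ≤ _ := by nlinarith [Nat.mul_le_mul_left (X ^ 2) hX2, Nat.mul_le_mul_left X hX2]
  have hp : pairTime n ≤ 1000 * X ^ 3 := by
    rw [pairTime, ← hXdef]
    nlinarith [Nat.mul_le_mul_left (X ^ 2) hX2, Nat.mul_le_mul_left X hX2]
  have hX3 : X ≤ X ^ 3 := Nat.le_self_pow (by norm_num) X
  have hX23 : X ^ 2 ≤ X ^ 3 := Nat.pow_le_pow_right (by omega) (by norm_num)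
  have ha : (n + 1) * 100 + ((n + 1) * ((X + 1) * 100 + 100) + (n + 1) * 200) ≤ 800 * X ^ 3 := by
    nlinarith [Nat.mul_le_mul hX (le_refl X)]
  have hb : (L * 2 + 1) * (sketchTime n (81 * n ^ 2) + 100) ≤ 3 * L * (121900 * X ^ 3) :=
    Nat.mul_le_mul (by omega) (by nlinarith)
  have hc : (L + 1) * (pairTime n + 100) ≤ 2 * L * (1100 * X ^ 3) :=
    Nat.mul_le_mul (by omega) (by nlinarith)
  have hd : (n + 11) * ((L + 1) * 100 + 200) ≤ 11 * X ^ 3 * (400 * L) :=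
    Nat.mul_le_mul (by nlinarith) (by omega)
  have hXL : X ^ 3 ≤ X ^ 3 * L := Nat.le_mul_of_pos_right _ hL
  have h8 : 1 ≤ X ^ 3 := Nat.one_le_pow _ _ (by omega)
  rw [mainTime, ← hXdef]
  nlinarith

/-- When `ε⁻¹ > √(2^n)` the term `ε⁻²` dominates the maximum, but then `2^k ≤ 2^n = √(2^n)·√(2^n)`
suffices. -/
lemma two_pow_le_sqrt_mul {k : ℕ} {ε : ℝ} (h0 : 0 < ε)
    (hk : k ≤ n ∧ (2 : ℝ) ^ k ≤ 24 * max ((ε ^ 2)⁻¹) (Real.sqrt (2 ^ n) * ε⁻¹)) :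
    (2 : ℝ) ^ k ≤ 24 * (Real.sqrt (2 ^ n) * ε⁻¹) := by
  have hs := Real.sqrt_nonneg ((2 : ℝ) ^ n)
  have hi : 0 < ε⁻¹ := inv_pos.2 h0
  rcases le_total ε⁻¹ (Real.sqrt (2 ^ n)) with h | h
  · refine hk.2.trans (mul_le_mul_of_nonneg_left (max_le ?_ le_rfl) (by norm_num))
    rw [← inv_pow, sq]
    exact mul_le_mul_of_nonneg_right h hi.le
  · have h1 : (2 : ℝ) ^ k ≤ 2 ^ n := pow_le_pow_right₀ one_le_two hk.1
    have h2 : Real.sqrt ((2 : ℝ) ^ n) * Real.sqrt (2 ^ n) = 2 ^ n :=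
      Real.mul_self_sqrt (by positivity)
    nlinarith [mul_le_mul_of_nonneg_left h hs, mul_nonneg hs hi.le]

lemma sketchBits_le {k : ℕ} (hn : 1 ≤ n) {ε : ℝ} (h0 : 0 < ε) (h1 : ε < 1)
    (hk : k ≤ n ∧ (2 : ℝ) ^ k ≤ 24 * max ((ε ^ 2)⁻¹) (Real.sqrt (2 ^ n) * ε⁻¹)) :
    (sketchBits n k (81 * n ^ 2) (precision n ε) : ℝ) ≤
      1200 * (n + Real.log ε⁻¹) ^ 3 * (Real.sqrt (2 ^ n) * ε⁻¹) := by
  have hlog : 0 ≤ Real.log ε⁻¹ := Real.log_nonneg (one_le_inv_iff₀.2 ⟨h0, h1.le⟩)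
  have hn' : (1 : ℝ) ≤ n := by exact_mod_cast hn
  have hb := precision_le hn h0 h1
  have hK := two_pow_le_sqrt_mul h0 hk
  have hsize : (Nat.size n : ℝ) ≤ n := by
    exact_mod_cast Nat.size_le.2 Nat.lt_two_pow_self
  set y : ℝ := n + Real.log ε⁻¹ with hy
  have hny : (n : ℝ) ≤ y := by linarith
  have hy1 : 1 ≤ y := by linarith
  set Y : ℝ := Real.sqrt (2 ^ n) * ε⁻¹ with hY
  have hY1 : 1 ≤ Y := by
    have := Real.one_le_sqrt.2 (one_le_pow₀ (one_le_two (α := ℝ)) (n := n))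
    exact one_le_mul_of_one_le_of_one_le this (one_le_inv_iff₀.2 ⟨h0, h1.le⟩)
  have hy13 : y ≤ y ^ 3 := le_self_pow₀ hy1 (by norm_num)
  have a1 : (81 * (n : ℝ) ^ 2 + 1) ≤ 82 * y ^ 2 := by nlinarith
  have a2 : 2 + 2 * (Nat.size n : ℝ) ≤ 4 * y := by linarith
  have a3 : (81 * (n : ℝ) ^ 2 + 1) * (2 + 2 * (Nat.size n : ℝ)) ≤ 82 * y ^ 2 * (4 * y) :=
    mul_le_mul a1 a2 (by positivity) (by positivity)
  have a4 : (2 : ℝ) ^ k * (2 * ((precision n ε : ℝ) + 2)) ≤ 24 * Y * (32 * y) :=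
    mul_le_mul hK (by linarith) (by positivity) (by positivity)
  have a5 : y ^ 3 ≤ y ^ 3 * Y := le_mul_of_one_le_right (by positivity) hY1
  have a6 : y * Y ≤ y ^ 3 * Y := mul_le_mul_of_nonneg_right hy13 (by positivity)
  rw [sketchBits]
  push_cast
  nlinarith

/-! ### Running time, accuracy and success probability of the program. -/

lemma exists_outputs_of_runs {P : Program} {s : Memory} {T : ℕ} {Q : Memory → Prop}
    (h : Runs P s T Q) : ∃ (t : ℕ) (E : ℝ), P.Outputs s t E ∧ t ≤ T ∧
      ∃ s', Q s' ∧ s'.real 5 0 0 = E := by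
  obtain ⟨t, s', h1, h2, h3⟩ := h
  exact ⟨t, s'.real 5 0 0, ⟨s', h1, rfl⟩, h2, s', h3, rfl⟩

lemma pairCount_pos (p : ℝ) : 0 < pairCount p := Nat.succ_pos _

lemma outputs_time {r k : ℕ} {ε p : ℝ} {M : Matrix (Qubits n) (Qubits n) ℂ} (hn : 1 ≤ n)
    (hp0 : 0 < p) (hp1 : p < 1)
    (hk : IsGreatest {l : ℕ | l ≤ n ∧
          (2 : ℝ) ^ l ≤ 24 * max ((ε ^ 2)⁻¹) (Real.sqrt r * ε⁻¹)} k)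
    (S : Fin (pairCount p * 2) → Sketch n k) (hS : ∀ j, (S j).circuit.length ≤ 81 * n ^ 2) :
    ∃ (t : ℕ) (E : ℝ), mainProgram.Outputs (inputMemory r ε p M S) t E ∧
      (t : ℝ) ≤ 2 ^ (30 * n) * (1 + Real.log p⁻¹) := by
  classical
  -- Only the time bound is used here, so the accuracy parameters `μ` and `δ` are arbitrary.
  have h := exists_outputs_of_runs (runs_mainProgram_inputMemory (p := p) (M := M)
    (pairCount_pos p) hS hk (μ := 0) (δ := 0) (by simp) le_rfl)
  obtain ⟨t, E, h1, h2, -⟩ := h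
  refine ⟨t, E, h1, ?_⟩
  have hlog : 0 ≤ Real.log p⁻¹ := Real.log_nonneg (one_le_inv_iff₀.2 ⟨hp0, hp1.le⟩)
  have h3 : (t : ℝ) ≤ 2 ^ 22 * (2 ^ n) ^ 3 * pairCount p := by
    exact_mod_cast h2.trans (mainTime_le hn (pairCount_pos p))
  have h4 : (2 : ℝ) ^ 25 ≤ (2 ^ n) ^ 27 := by
    rw [← pow_mul]; exact pow_le_pow_right₀ one_le_two (by omega)
  have e : (2 : ℝ) ^ (30 * n) = (2 ^ n) ^ 3 * (2 ^ n) ^ 27 := by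
    rw [← pow_add, ← pow_mul, mul_comm]
  refine h3.trans ?_
  rw [e]
  calc (2 : ℝ) ^ 22 * (2 ^ n) ^ 3 * pairCount p
      ≤ 2 ^ 22 * (2 ^ n) ^ 3 * (5 * (1 + Real.log p⁻¹)) :=
        mul_le_mul_of_nonneg_left (pairCount_le hp0 hp1) (by positivity)
    _ = (2 ^ n) ^ 3 * (2 ^ 22 * 5) * (1 + Real.log p⁻¹) := by ring
    _ ≤ (2 ^ n) ^ 3 * (2 ^ n) ^ 27 * (1 + Real.log p⁻¹) := by
        refine mul_le_mul_of_nonneg_right ?_ (by positivity)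
        exact mul_le_mul_of_nonneg_left (le_trans (by norm_num) h4) (by positivity)

/-- For `k < n` one has `12 ε⁻² < 2^k ≤ 2^n`, so `n` halvings already resolve `ε`. -/
lemma four_div_two_pow_le {r k : ℕ} {ε : ℝ} (h0 : 0 < ε) (h1 : ε < 1) (hkn : k < n)
    (hk : IsGreatest {l : ℕ | l ≤ n ∧
          (2 : ℝ) ^ l ≤ 24 * max ((ε ^ 2)⁻¹) (Real.sqrt r * ε⁻¹)} k) :
    4 / (2 : ℝ) ^ (n + 10) ≤ ε / 256 := by
  have h2 := twelve_mul_max_lt hkn hk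
  have h3 : (2 : ℝ) ^ k ≤ 2 ^ n := pow_le_pow_right₀ one_le_two hkn.le
  have h4 : ε⁻¹ ≤ (ε ^ 2)⁻¹ := inv_anti₀ (by positivity) (by nlinarith)
  have h5 : ε⁻¹ ≤ 2 ^ n := by
    have h6 := le_max_left ((ε ^ 2)⁻¹) (Real.sqrt r * ε⁻¹)
    have h7 : 0 < ε⁻¹ := inv_pos.2 h0
    linarith
  have h8 : 1 ≤ 2 ^ n * ε := by
    have := mul_le_mul_of_nonneg_right h5 h0.le
    rwa [inv_mul_cancel₀ h0.ne'] at this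
  rw [pow_add, div_le_iff₀ (by positivity)]
  linarith

-- For `k < n` the error budget is `0.95 ε` for the random deviation, `0.01 ε` for the precision of
-- the amplitudes and `ε/256` for the bisection.
open Classical in
lemma outputs_accuracy {r k : ℕ} {ε p : ℝ} {M : Matrix (Qubits n) (Qubits n) ℂ}
    {ψ : EuclideanSpace ℂ (Qubits n)} (h0 : 0 < ε) (h1 : ε < 1) (hM : M.IsHermitian)
    (hM1 : ‖Matrix.toEuclideanCLM (n := Qubits n) (𝕜 := ℂ) M‖ ≤ 1) (hψ : ‖ψ‖ = 1)
    (hk : IsGreatest {l : ℕ | l ≤ n ∧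
          (2 : ℝ) ^ l ≤ 24 * max ((ε ^ 2)⁻¹) (Real.sqrt r * ε⁻¹)} k) {len L : ℕ} (hL : 0 < L)
    {C : Fin (L * 2) → Clifford n} {S : Fin (L * 2) → Sketch n k}
    (hS : ∀ j, (S j).Describes (C j) ψ len (1 / 2 ^ precision n ε))
    (hC : k < n → 2 * (Finset.univ.filter fun i => 95 / 100 * ε <
      ‖pairEstimate k M ψ.ofLp (pairFst C i) (pairSnd C i) - expectation M ψ‖).card < L) :
    ∃ (t : ℕ) (E : ℝ), mainProgram.Outputs (inputMemory r ε p M S) t E ∧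
      ‖(E : ℂ) - expectation M ψ‖ ≤ ε := by
  set μ := (expectation M ψ).re with hμ
  have hμ1 : |μ| ≤ 1 := (Complex.abs_re_le_norm _).trans (norm_expectation_le hM1 hψ)
  obtain ⟨t, E, hE, -, s', hs', hEs⟩ := exists_outputs_of_runs
    (runs_mainProgram_inputMemory (p := p) (M := M) hL (fun j => (hS j).2.1) hk hμ1
      (δ := 96 / 100 * ε) (by positivity))
  refine ⟨t, E, hE, ?_⟩
  rw [norm_ofReal_sub_expectation hM, ← hEs]
  have happrox : ∀ i : Fin L, |sketchEstimate M S i -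
      (pairEstimate k M ψ.ofLp (pairFst C i) (pairSnd C i)).re| ≤ ε / 100 := fun i =>
    abs_vecEstimate_sub_le hk.1.1 h0 h1 hM1 hψ (hS _) (hS _)
  rcases hk.1.1.eq_or_lt with hkn | hkn
  · rw [hs'.1 hkn]
    have h := happrox ⟨0, hL⟩
    subst hkn
    rw [pairEstimate_self] at h
    exact h.trans (by linarith)
  · have hgood : L < 2 *
        (Finset.univ.filter fun i => |sketchEstimate M S i - μ| ≤ 96 / 100 * ε).card := by
      have hsub : (Finset.univ.filter fun i : Fin L => ¬ (95 / 100 * ε <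
          ‖pairEstimate k M ψ.ofLp (pairFst C i) (pairSnd C i) - expectation M ψ‖)) ⊆
          Finset.univ.filter fun i => |sketchEstimate M S i - μ| ≤ 96 / 100 * ε := by
        intro i hi
        simp only [Finset.mem_filter, Finset.mem_univ, true_and, not_lt] at hi ⊢
        have h2 := (Complex.abs_re_le_norm _).trans hi
        rw [Complex.sub_re, ← hμ] at h2
        have h3 := abs_sub_le (sketchEstimate M S i)
          (pairEstimate k M ψ.ofLp (pairFst C i) (pairSnd C i)).re μ
        linarith [happrox i]
      have h2 := Finset.card_le_card hsub
      have h3 := Finset.card_filter_add_card_filter_not (s := (Finset.univ : Finset (Fin L)))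
        fun i => 95 / 100 * ε <
          ‖pairEstimate k M ψ.ofLp (pairFst C i) (pairSnd C i) - expectation M ψ‖
      rw [Finset.card_univ, Fintype.card_fin] at h3
      have h4 := hC hkn
      omega
    have h2 := hs'.2 hkn hgood
    have h3 := four_div_two_pow_le h0 h1 hkn hk
    linarith

lemma outputs_probability {r k : ℕ} {ε p : ℝ} {M : Matrix (Qubits n) (Qubits n) ℂ}
    {ψ : EuclideanSpace ℂ (Qubits n)} (hn : 1 ≤ n) (h0 : 0 < ε) (h1 : ε < 1) (hp : 0 < p)
    (hM : M.IsHermitian) (hM1 : ‖Matrix.toEuclideanCLM (n := Qubits n) (𝕜 := ℂ) M‖ ≤ 1)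
    (hr : M.rank ≤ r) (hψ : ‖ψ‖ = 1)
    (hk : IsGreatest {l : ℕ | l ≤ n ∧
          (2 : ℝ) ^ l ≤ 24 * max ((ε ^ 2)⁻¹) (Real.sqrt r * ε⁻¹)} k) (len : ℕ) :
    ENNReal.ofReal (1 - p) ≤ iidCliffords n (pairCount p * 2)
      {C | ∀ S : Fin (pairCount p * 2) → Sketch n k,
        (∀ j, (S j).Describes (C j) ψ len (1 / 2 ^ precision n ε)) →
        ∃ (t : ℕ) (E : ℝ), mainProgram.Outputs (inputMemory r ε p M S) t E ∧
          ‖(E : ℂ) - expectation M ψ‖ ≤ ε} := by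
  classical
  -- Including `k < n` in the bad event leaves no bad pair when `k = n`, so both cases are treated
  -- at once.
  have h := iidCliffords_majority_ge hn (fun C₁ C₂ => k < n ∧ 95 / 100 * ε <
    ‖pairEstimate k M ψ.ofLp C₁ C₂ - expectation M ψ‖) ?_ hp
  · refine h.trans (measure_mono fun C hC S hS => ?_)
    refine outputs_accuracy h0 h1 hM hM1 hψ hk (pairCount_pos p) hS fun hkn => ?_
    simpa only [Set.mem_ofPred_eq, hkn, true_and] using hC
  · intro _
    by_cases hkn : k < n
    · simpa only [hkn, true_and] using five_mul_bad_pairs_le hn h0 hkn hk hM hM1 hr hψ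
    · simp [hkn]

theorem lemma1 :
    ∃ (P : Program) (N : ℝ → ℕ) (b : ℕ → ℝ → ℕ) (g c : ℕ),
      -- the number of sketches is `O(log(1/p))`
      (∀ p : ℝ, 0 < p → p < 1 → (N p : ℝ) ≤ c * (1 + Real.log p⁻¹)) ∧
      -- the number of bits of precision is polynomial in `n` and `log(1/ε)`
      (∀ (n : ℕ) (ε : ℝ), 1 ≤ n → 0 < ε → ε < 1 →
        (b n ε : ℝ) ≤ c * (n + Real.log ε⁻¹) ^ c) ∧
      -- every Clifford unitary and every state have sketches with `O(n^2)` gates, to `b` bits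
      (∀ (n k b' : ℕ) (C : Clifford n) (ψ : EuclideanSpace ℂ (Qubits n)),
        1 ≤ n → k ≤ n → ‖ψ‖ = 1 →
        ∃ S : Sketch n k, S.Describes C ψ (g * n ^ 2) (1 / 2 ^ b') ∧ S.HasBits b') ∧
      -- the algorithm
      (∀ (n r k : ℕ) (ε p : ℝ) (M : Matrix (Qubits n) (Qubits n) ℂ)
        (ψ : EuclideanSpace ℂ (Qubits n)),
        1 ≤ n → 1 ≤ r → r ≤ 2 ^ n → 0 < ε → ε < 1 → 0 < p → p < 1 →
        M.IsHermitian → ‖Matrix.toEuclideanCLM (n := Qubits n) (𝕜 := ℂ) M‖ ≤ 1 → M.rank ≤ r →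
        ‖ψ‖ = 1 →
        IsGreatest {l : ℕ | l ≤ n ∧
          (2 : ℝ) ^ l ≤ 24 * max ((ε ^ 2)⁻¹) (Real.sqrt r * ε⁻¹)} k →
        -- it always halts in time `2^O(n) log(1/p)`
        (∀ (C : Fin (N p) → Clifford n) (S : Fin (N p) → Sketch n k),
          (∀ j, (S j).Describes (C j) ψ (g * n ^ 2) (1 / 2 ^ b n ε)) →
          ∃ (t : ℕ) (E : ℝ), P.Outputs (inputMemory r ε p M S) t E ∧
            (t : ℝ) ≤ 2 ^ (c * n) * (1 + Real.log p⁻¹)) ∧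
        -- with probability at least `1 - p` over the Cliffords its output is `ε`-close
        ENNReal.ofReal (1 - p) ≤ iidCliffords n (N p)
          {C | ∀ S : Fin (N p) → Sketch n k,
            (∀ j, (S j).Describes (C j) ψ (g * n ^ 2) (1 / 2 ^ b n ε)) →
            ∃ (t : ℕ) (E : ℝ), P.Outputs (inputMemory r ε p M S) t E ∧
              ‖(E : ℂ) - expectation M ψ‖ ≤ ε}) ∧
      -- for `r = 2^n` the total size is `√(2^n) ε^(-1) log(1/p)` bits, up to factors polynomial
      -- in `n` and `log(1/ε)`
      (∀ (n k : ℕ) (ε p : ℝ), 1 ≤ n → 0 < ε → ε < 1 → 0 < p → p < 1 →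
        IsGreatest {l : ℕ | l ≤ n ∧
          (2 : ℝ) ^ l ≤ 24 * max ((ε ^ 2)⁻¹) (Real.sqrt (2 ^ n) * ε⁻¹)} k →
        ((N p * sketchBits n k (g * n ^ 2) (b n ε) : ℕ) : ℝ) ≤
          c * (n + Real.log ε⁻¹) ^ c * Real.sqrt (2 ^ n) * ε⁻¹ * (1 + Real.log p⁻¹)) := by
  have hone : ∀ {n : ℕ} {ε : ℝ}, 1 ≤ n → 0 < ε → ε < 1 → 1 ≤ n + Real.log ε⁻¹ := by
    intro n ε hn h0 h1
    have hlog : 0 ≤ Real.log ε⁻¹ := Real.log_nonneg (one_le_inv_iff₀.2 ⟨h0, h1.le⟩)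
    have hn' : (1 : ℝ) ≤ n := by exact_mod_cast hn
    linarith
  -- The value `12000 = 10 · 1200` comes from the number of sketches and `sketchBits_le`. It serves
  -- for all bounds and is kept opaque, since only the inequality matters.
  obtain ⟨c, hc⟩ : ∃ c : ℕ, 12000 ≤ c := ⟨_, le_rfl⟩
  have hc' : (12000 : ℝ) ≤ c := by exact_mod_cast hc
  refine ⟨mainProgram, fun p => pairCount p * 2, precision, 81, c, ?_, ?_, ?_, ?_, ?_⟩
  · intro p h0 h1
    have hlog : 0 ≤ Real.log p⁻¹ := Real.log_nonneg (one_le_inv_iff₀.2 ⟨h0, h1.le⟩)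
    have := pairCount_le h0 h1
    push_cast
    nlinarith
  · intro n ε hn h0 h1
    have hy := hone hn h0 h1
    refine (precision_le hn h0 h1).trans ?_
    have h2 : n + Real.log ε⁻¹ ≤ (n + Real.log ε⁻¹) ^ c :=
      le_self_pow₀ hy (by omega)
    exact mul_le_mul (by linarith) h2 (by linarith) (by linarith)
  · intro n k b' C ψ hn _ hψ
    exact exists_sketch hn b' C hψ
  · intro n r k ε p M ψ hn _ _ h0 h1 hp0 hp1 hM hM1 hr hψ hk
    refine ⟨fun C S hS => ?_, outputs_probability hn h0 h1 hp0 hM hM1 hr hψ hk _⟩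
    obtain ⟨t, E, hE, ht⟩ := outputs_time (M := M) hn hp0 hp1 hk S fun j => (hS j).2.1
    refine ⟨t, E, hE, ht.trans ?_⟩
    have hlog : 0 ≤ Real.log p⁻¹ := Real.log_nonneg (one_le_inv_iff₀.2 ⟨hp0, hp1.le⟩)
    refine mul_le_mul_of_nonneg_right (pow_le_pow_right₀ one_le_two ?_) (by positivity)
    exact Nat.mul_le_mul_right n (by omega)
  · intro n k ε p hn h0 h1 hp0 hp1 hk
    have hy := hone hn h0 h1
    have hlog : 0 ≤ Real.log p⁻¹ := Real.log_nonneg (one_le_inv_iff₀.2 ⟨hp0, hp1.le⟩)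
    have hN : ((pairCount p * 2 : ℕ) : ℝ) ≤ 10 * (1 + Real.log p⁻¹) := by
      push_cast; linarith [pairCount_le hp0 hp1]
    have hpow : (n + Real.log ε⁻¹) ^ 3 ≤ (n + Real.log ε⁻¹) ^ c :=
      pow_le_pow_right₀ hy (by omega)
    have hinv : 0 < ε⁻¹ := inv_pos.2 h0
    rw [Nat.cast_mul]
    have hz : 0 ≤ (n + Real.log ε⁻¹) ^ c := pow_nonneg (by linarith) _
    generalize (n + Real.log ε⁻¹) ^ c = z at hpow hz ⊢
    calc _ ≤ 10 * (1 + Real.log p⁻¹) *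
          (1200 * (n + Real.log ε⁻¹) ^ 3 * (Real.sqrt (2 ^ n) * ε⁻¹)) :=
          mul_le_mul hN (sketchBits_le hn h0 h1 hk.1) (Nat.cast_nonneg _) (by positivity)
      _ ≤ 10 * (1 + Real.log p⁻¹) * (1200 * z * (Real.sqrt (2 ^ n) * ε⁻¹)) := by gcongr
      _ = 12000 * (z * Real.sqrt (2 ^ n) * ε⁻¹ * (1 + Real.log p⁻¹)) := by ring
      _ ≤ c * (z * Real.sqrt (2 ^ n) * ε⁻¹ * (1 + Real.log p⁻¹)) :=
          mul_le_mul_of_nonneg_right hc' (by positivity)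
      _ = _ := by ring
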